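/- All Lie superalgebras are finite-dimensional. A complex Lie superalgebra $\mathfrak g=\mathfrak g_{\bar 0}\oplus\mathfrak g_{\bar 1}$ is called basic if it is simple, $\mathfrak g_{\bar 0}$ is reductive, and $\mathfrak g$ carries a nondegenerate even supersymmetric invariant bilinear form; a Cartan subalgebra $\mathfrak h$ of $\mathfrak g$ is one of $\mathfrak g_{\bar 0}$. A simple system of $(\mathfrak g,\mathfrak h)$ consists of simple roots $\alpha_i\in\mathfrak h^*$ and nonzero homogeneous root vectors $e_i,f_i$ of weights $\alpha_i,-\alpha_i$ and equal parity that generate $\mathfrak g$, with $[e_i,f_j]=0$ for $i\ne j$ and $h_i=[e_i,f_i]\in\mathfrak h$, such that $\mathfrak g$ is graded by the free abelian group $\bigoplus_i\mathbb Z\varepsilon_i$ with $e_i,f_i$ in degrees $\varepsilon_i,-\varepsilon_i$ and with $\mathfrak h$ as the component of degree $0$. (The grading matters only for type $A(n,n)$, where the $\alpha_i$ are linearly dependent on $\mathfrak h$.) Its Dynkin diagram is given by the parities of the vertices $i$ and the Cartan matrix $a_{ij}=\alpha_j(h_i)$, normalized by $a_{ii}=2$ if $i$ is even and $a_{ii}\in\{0,2\}$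 if $i$ is odd. Its even positive roots $\Delta_{\bar 0}^+$ are the even roots occurring in degrees with nonnegative coefficients. An abstract Vogan diagram is the Dynkin diagram, with real Cartan matrix, of some basic Lie superalgebra with respect to some simple system, together with (1) an automorphism $d$ of the diagram of order $1$ or $2$, that is, a permutation of the vertices preserving parities and preserving the Cartan matrix up to rescaling its rows by nonzero real numbers, and (2) a set of painted vertices among the even vertices fixed by $d$. Theorem. For every abstract Vogan diagram there exist a real Lie superalgebra $\mathfrak g_C$ whose complexification $\mathfrak g=\mathfrak g_C\otimes\mathbb C$ is basic, a Cartan involution $\theta$ of its even part $\mathfrak g_{\bar 0C}=\mathfrak k_{\bar 0}\oplus\mathfrak p_{\bar 0}$ (an involutive automorphism preserving $B(X,Y)=\operatorname{tr}_{\mathfrak g_C}(\operatorname{ad}X\operatorname{ad}Y)$ and such that $-B(X,\theta Y)$ is positive definite), a maximally compact $\theta$-stable Cartan subalgebra $\mathfrak h_{\bar 0}=\mathfrak t_{\bar 0}\oplus\mathfrak a_{\bar 0}$ of $\mathfrak g_{\bar 0C}$ (where $\mathfrak t_{\bar 0}=\mathfrak h_{\bar 0}\cap\mathfrak k_{\bar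 0}$ has the largest possible dimension and $\mathfrak a_{\bar 0}=\mathfrak h_{\bar 0}\cap\mathfrak p_{\bar 0}$), and a simple system of $\mathfrak g$ with respect to $\mathfrak h=\mathfrak h_{\bar 0}\otimes\mathbb C$ with the given Dynkin diagram, such that $\Delta_{\bar 0}^+$ takes $i\mathfrak t_{\bar 0}$ before $\mathfrak a_{\bar 0}$ (it is the positive system of the lexicographic order given by a basis of $i\mathfrak t_{\bar 0}$ followed by a basis of $\mathfrak a_{\bar 0}$) and the given diagram is the Vogan diagram of $(\mathfrak g_C,\mathfrak h_{\bar 0},\Delta_{\bar 0}^+)$: the transpose of $\theta$ maps $\alpha_i$ to $\alpha_{d(i)}$ for all $i$, and an even simple root $\alpha_i$ with $d(i)=i$ is noncompact ($e_i\in\mathfrak p_{\bar 0}\otimes\mathbb C$) if $i$ is painted and compact ($e_i\in\mathfrak k_{\bar 0}\otimes\mathbb C$) if $i$ is not painted. -/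

import Mathlib

open scoped TensorProduct

noncomputable section

/-- The sign `(-1)^{|x||y|}` for homogeneous elements of degrees `i` and `j`. -/
def superSign (i j : ZMod 2) : ℤ := if i = 1 ∧ j = 1 then -1 else 1

/-- A Lie superalgebra over a field of characteristic zero: a `ℤ/2`-graded vector space
`V = V₀ ⊕ V₁` with an even bilinear bracket that is super skew-symmetric and satisfies the
super Jacobi identity. -/
class LieSuperalgebra (K : Type*) [Field K] (V : Type*) [AddCommGroup V] [Module K V] where
  /-- The homogeneous subspaces `V₀`, `V₁`. -/
  part : ZMod 2 → Submodule K V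
  isCompl : IsCompl (part 0) (part 1)
  /-- The superbracket `[x, y]`. -/
  sbr : V →ₗ[K] V →ₗ[K] V
  sbr_mem : ∀ {i j : ZMod 2} {x y : V}, x ∈ part i → y ∈ part j → sbr x y ∈ part (i + j)
  sbr_skew : ∀ {i j : ZMod 2} {x y : V}, x ∈ part i → y ∈ part j →
    sbr x y = -(superSign i j • sbr y x)
  sbr_jacobi : ∀ {i j k : ZMod 2} {x y z : V}, x ∈ part i → y ∈ part j → z ∈ part k →
    sbr x (sbr y z) = sbr (sbr x y) z + superSign i j • sbr y (sbr x z)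

namespace LieSuperalgebra

/-! ### The even part -/

section EvenPart

variable (K : Type*) [Field K] (V : Type*) [AddCommGroup V] [Module K V] [LieSuperalgebra K V]

/-- The even part `V₀`, as a type. -/
abbrev EvenPart : Type _ := ↥(part (K := K) (V := V) 0)

variable {K V}

/-- The even part of a Lie superalgebra is a Lie algebra under the superbracket. -/
instance [CharZero K] : LieRing (EvenPart K V) where
  bracket x y := ⟨sbr (K := K) (x : V) (y : V), by simpa using sbr_mem x.2 y.2⟩
  add_lie x y z := by ext; simp
  lie_add x y z := by ext; simp
  lie_self x := by
    ext
    have h := sbr_skew (K := K) x.2 x.2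
    simp only [superSign, zero_ne_one, false_and, if_false, one_smul] at h
    have h2 : (2 : K) • sbr (K := K) (x : V) (x : V) = 0 := by
      rw [two_smul]; nth_rewrite 1 [h]; simp
    simpa using (smul_eq_zero.mp h2).resolve_left two_ne_zero
  leibniz_lie x y z := by
    ext
    simpa [superSign] using sbr_jacobi (K := K) x.2 y.2 z.2

instance [CharZero K] : LieAlgebra K (EvenPart K V) where
  lie_smul t x y := by
    ext
    exact map_smul (sbr (K := K) (x : V)) t (y : V)

theorem coe_lie [CharZero K] (x y : EvenPart K V) :
    ((⁅x, y⁆ : EvenPart K V) : V) = sbr (K := K) (x : V) (y : V) := rfl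

/-- A subalgebra of the even part, regarded as a subspace of the whole superalgebra. -/
def evenSubspace [CharZero K] (h : LieSubalgebra K (EvenPart K V)) : Submodule K V :=
  h.toSubmodule.map (part (K := K) (V := V) 0).subtype

end EvenPart

/-! ### Complexification of a real Lie superalgebra -/

section Complexification

variable {V : Type*} [AddCommGroup V] [Module ℝ V]

theorem baseChange_induction {p : Submodule ℝ V} {C : ℂ ⊗[ℝ] V → Prop}
    (mem : ∀ m ∈ p, C (1 ⊗ₜ m)) (zero : C 0) (add : ∀ x y, C x → C y → C (x + y))
    (smul : ∀ (a : ℂ) x, C x → C (a • x)) {x : ℂ ⊗[ℝ] V} (hx : x ∈ p.baseChange ℂ) : C x := by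
  rw [Submodule.baseChange_eq_span] at hx
  induction hx using Submodule.span_induction with
  | mem z hz =>
    obtain ⟨m, hm, rfl⟩ := hz
    exact mem m hm
  | zero => exact zero
  | add a b _ _ ha hb => exact add a b ha hb
  | smul a b _ hb => exact smul a b hb

theorem isCompl_baseChange {p q : Submodule ℝ V} (h : IsCompl p q) :
    IsCompl (p.baseChange ℂ) (q.baseChange ℂ) := by
  constructor
  · rw [Submodule.disjoint_def]
    intro x hp hq
    have h1 : ((p.projection q h).baseChange ℂ) x = x := by
      refine baseChange_induction (C := fun y => ((p.projection q h).baseChange ℂ) y = y)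
        (fun m hm => ?_) (by simp) (fun a b ha hb => ?_) (fun a b hb => ?_) hp
      · simp [Submodule.projection_apply, Submodule.projectionOnto_apply_of_mem_left h hm,
          -Submodule.coe_projectionOnto_apply]
      · rw [map_add, ha, hb]
      · rw [map_smul, hb]
    have h2 : ((p.projection q h).baseChange ℂ) x = 0 := by
      refine baseChange_induction (C := fun y => ((p.projection q h).baseChange ℂ) y = 0)
        (fun m hm => ?_) (by simp) (fun a b ha hb => ?_) (fun a b hb => ?_) hq
      · simp [Submodule.projection_apply, (Submodule.projectionOnto_apply_eq_zero_iff h).2 hm,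
          -Submodule.coe_projectionOnto_apply]
      · rw [map_add, ha, hb, add_zero]
      · rw [map_smul, hb, smul_zero]
    rw [← h1, h2]
  · rw [codisjoint_iff, eq_top_iff]
    rintro x -
    induction x using TensorProduct.induction_on with
    | zero => exact zero_mem _
    | add a b ha hb => exact add_mem ha hb
    | tmul z m =>
      have hm : m ∈ p ⊔ q := by rw [h.sup_eq_top]; trivial
      obtain ⟨a, ha, b, hb, rfl⟩ := Submodule.mem_sup.mp hm
      rw [TensorProduct.tmul_add]
      exact add_mem (Submodule.mem_sup_left (Submodule.tmul_mem_baseChange_of_mem _ ha))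
        (Submodule.mem_sup_right (Submodule.tmul_mem_baseChange_of_mem _ hb))

variable [LieSuperalgebra ℝ V]

/-- The complexification `ℂ ⊗ V` of a real Lie superalgebra `V`. -/
instance complexification : LieSuperalgebra ℂ (ℂ ⊗[ℝ] V) where
  part i := (part (K := ℝ) (V := V) i).baseChange ℂ
  isCompl := isCompl_baseChange isCompl
  sbr := LinearMap.BilinMap.baseChange ℂ (sbr (K := ℝ) (V := V))
  sbr_mem {i j x y} hx hy := by
    set β := LinearMap.BilinMap.baseChange ℂ (sbr (K := ℝ) (V := V))
    refine baseChange_induction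
      (C := fun x => β x y ∈ (part (K := ℝ) (V := V) (i + j)).baseChange ℂ)
      (fun m hm => ?_) (by simp)
      (fun a b ha hb => by rw [map_add, LinearMap.add_apply]; exact add_mem ha hb)
      (fun a b hb => by rw [map_smul, LinearMap.smul_apply]; exact Submodule.smul_mem _ _ hb) hx
    refine baseChange_induction
      (C := fun y => β (1 ⊗ₜ m) y ∈ (part (K := ℝ) (V := V) (i + j)).baseChange ℂ)
      (fun n hn => ?_) (by simp)
      (fun a b ha hb => by rw [map_add]; exact add_mem ha hb)
      (fun a b hb => by rw [map_smul]; exact Submodule.smul_mem _ _ hb) hy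
    simpa [β] using Submodule.tmul_mem_baseChange_of_mem (1 : ℂ) (sbr_mem hm hn)
  sbr_skew {i j x y} hx hy := by
    set β := LinearMap.BilinMap.baseChange ℂ (sbr (K := ℝ) (V := V)) with hβ
    refine baseChange_induction (C := fun x => β x y = -(superSign i j • β y x))
      (fun m hm => ?_) (by simp)
      (fun a b ha hb => ?_) (fun a b hb => ?_) hx
    · refine baseChange_induction
        (C := fun y => β (1 ⊗ₜ m) y = -(superSign i j • β y (1 ⊗ₜ m)))
        (fun n hn => ?_) (by simp)
        (fun a b ha hb => ?_) (fun a b hb => ?_) hy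
      · rw [hβ, LinearMap.BilinMap.baseChange_tmul, LinearMap.BilinMap.baseChange_tmul,
          sbr_skew hm hn, TensorProduct.tmul_neg, TensorProduct.tmul_smul]
      · simp only [map_add, LinearMap.add_apply, smul_add, ha, hb, neg_add]
      · simp only [map_smul, LinearMap.smul_apply, hb, smul_neg]
        rw [smul_comm]
    · simp only [map_add, LinearMap.add_apply, smul_add, ha, hb, neg_add]
    · simp only [map_smul, LinearMap.smul_apply, hb, smul_neg]
      rw [smul_comm]
  sbr_jacobi {i j k x y z} hx hy hz := by
    set β := LinearMap.BilinMap.baseChange ℂ (sbr (K := ℝ) (V := V)) with hβ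
    refine baseChange_induction
      (C := fun x => β x (β y z) = β (β x y) z + superSign i j • β y (β x z))
      (fun m hm => ?_) (by simp)
      (fun a b ha hb => ?_) (fun a b hb => ?_) hx
    · refine baseChange_induction
        (C := fun y => β (1 ⊗ₜ m) (β y z) =
          β (β (1 ⊗ₜ m) y) z + superSign i j • β y (β (1 ⊗ₜ m) z))
        (fun n hn => ?_) (by simp)
        (fun a b ha hb => ?_) (fun a b hb => ?_) hy
      · refine baseChange_induction
          (C := fun z => β (1 ⊗ₜ m) (β (1 ⊗ₜ n) z) =
            β (β (1 ⊗ₜ m) (1 ⊗ₜ n)) z + superSign i j • β (1 ⊗ₜ n) (β (1 ⊗ₜ m) z))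
          (fun l hl => ?_) (by simp)
          (fun a b ha hb => ?_) (fun a b hb => ?_) hz
        · simp only [hβ, LinearMap.BilinMap.baseChange_tmul, sbr_jacobi hm hn hl,
            TensorProduct.tmul_add, TensorProduct.tmul_smul, mul_one]
        · simp only [map_add, smul_add, ha, hb]
          abel
        · simp only [map_smul, hb, smul_add]
          rw [smul_comm]
      · simp only [map_add, LinearMap.add_apply, smul_add, ha, hb]
        abel
      · simp only [map_smul, LinearMap.smul_apply, hb, smul_add]
        rw [smul_comm]
    · simp only [map_add, LinearMap.add_apply, smul_add, ha, hb]
      abel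
    · simp only [map_smul, LinearMap.smul_apply, hb, smul_add]
      rw [smul_comm]

/-- The complexification `𝔥 = ℂ ⊗ 𝔥₀` of a subalgebra `𝔥₀` of the even part of a real Lie
superalgebra, as a subspace of the complexified superalgebra. -/
def complexify (h : LieSubalgebra ℝ (EvenPart ℝ V)) : Submodule ℂ (ℂ ⊗[ℝ] V) :=
  (evenSubspace h).baseChange ℂ

/-- The inclusion `𝔥₀ → ℂ ⊗ 𝔥₀`. -/
def toComplexify (h : LieSubalgebra ℝ (EvenPart ℝ V)) (X : h) : complexify h :=
  ⟨1 ⊗ₜ ((X : EvenPart ℝ V) : V), Submodule.tmul_mem_baseChange_of_mem _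
    (Submodule.mem_map_of_mem (f := (part (K := ℝ) (V := V) 0).subtype) X.2)⟩

end Complexification

/-! ### Basic Lie superalgebras -/

section Basic

variable (g : Type*) [AddCommGroup g] [Module ℂ g] [LieSuperalgebra ℂ g]

/-- Simplicity: the bracket is not identically zero and there is no graded ideal except `0` and
the whole superalgebra. -/
def IsSimple : Prop :=
  (∃ x y : g, sbr (K := ℂ) x y ≠ 0) ∧
  ∀ I : Submodule ℂ g, (∀ x : g, ∀ y ∈ I, sbr (K := ℂ) x y ∈ I) →
    I = (I ⊓ part 0) ⊔ (I ⊓ part 1) → I = ⊥ ∨ I = ⊤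

/-- An even, supersymmetric, invariant, nondegenerate bilinear form. -/
structure IsBasicForm (B : LinearMap.BilinForm ℂ g) : Prop where
  even : ∀ x ∈ part (K := ℂ) (V := g) 0, ∀ y ∈ part (K := ℂ) (V := g) 1, B x y = 0
  supersymm : ∀ (i j : ZMod 2) (x y : g), x ∈ part (K := ℂ) i → y ∈ part (K := ℂ) j →
    B x y = superSign i j • B y x
  invariant : ∀ x y z : g, B (sbr (K := ℂ) x y) z = B x (sbr (K := ℂ) y z)
  nondegenerate : B.Nondegenerate

/-- A (complex) basic Lie superalgebra: finite-dimensional and simple, with reductive even part,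
and carrying a nondegenerate even invariant supersymmetric bilinear form. -/
structure IsBasic : Prop where
  finite : FiniteDimensional ℂ g
  simple : IsSimple g
  reductive : LieAlgebra.radical ℂ (EvenPart ℂ g) = LieAlgebra.center ℂ (EvenPart ℂ g)
  form : ∃ B : LinearMap.BilinForm ℂ g, IsBasicForm g B

variable {g}

/-- The even roots `Δ₀` of `𝔤` with respect to `𝔥`: the nonzero weights of `𝔥` on `𝔤₀`. -/
def evenRoots (h : Submodule ℂ g) : Set (Module.Dual ℂ h) :=
  {β | β ≠ 0 ∧ ∃ x ∈ part (K := ℂ) (V := g) 0, x ≠ 0 ∧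
    ∀ H : h, sbr (K := ℂ) (H : g) x = β H • x}

end Basic

end LieSuperalgebra

open LieSuperalgebra

/-! ### Dynkin diagrams and abstract Vogan diagrams -/

/-- A Dynkin diagram with vertex set `ι`, encoded by its real Cartan matrix and the parities of its
vertices. Even vertices have diagonal entry `2`; odd vertices have diagonal entry `0` (isotropic) or
`2` (nonisotropic). -/
structure SuperDynkin (ι : Type*) where
  parity : ι → ZMod 2
  cartan : Matrix ι ι ℝ
  diag_even : ∀ i, parity i = 0 → cartan i i = 2
  diag_odd : ∀ i, parity i = 1 → cartan i i = 0 ∨ cartan i i = 2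

/-- A simple system with Dynkin diagram `D` for the complex Lie superalgebra `g` with respect
to `h`: simple roots `root i`, with nonzero simple root vectors `e i` and `f i` (of weights
`root i` and `- root i`) that generate `g`, satisfy `[e i, f j] = 0` for `i ≠ j`, and for which
`coroot i = [e i, f i]` lies in `h` and `root j (coroot i)` is the `(i, j)` entry of the Cartan
matrix. Moreover `g` is graded by the free abelian group on the simple roots, with `h` in degree
`0`; the grading is part of the data because the simple roots, as functionals on `h`, are linearly
dependent when `g` is of type `A(n,n)`. (It is determined by the other data.) -/
structure SimpleSystem {ι : Type*} [Fintype ι] [DecidableEq ι] (D : SuperDynkin ι) {g : Type*}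
    [AddCommGroup g] [Module ℂ g] [LieSuperalgebra ℂ g] (h : Submodule ℂ g) where
  root : ι → Module.Dual ℂ h
  e : ι → g
  f : ι → g
  coroot : ι → h
  e_ne : ∀ i, e i ≠ 0
  f_ne : ∀ i, f i ≠ 0
  e_mem : ∀ i, e i ∈ part (K := ℂ) (D.parity i)
  f_mem : ∀ i, f i ∈ part (K := ℂ) (D.parity i)
  weight_e : ∀ (H : h) i, sbr (K := ℂ) (H : g) (e i) = root i H • e i
  weight_f : ∀ (H : h) i, sbr (K := ℂ) (H : g) (f i) = -(root i H • f i)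
  e_f : ∀ i, sbr (K := ℂ) (e i) (f i) = coroot i
  e_f_ne : ∀ i j, i ≠ j → sbr (K := ℂ) (e i) (f j) = 0
  root_coroot : ∀ i j, root j (coroot i) = (D.cartan i j : ℂ)
  generates : ∀ S : Submodule ℂ g, (∀ x ∈ S, ∀ y ∈ S, sbr (K := ℂ) x y ∈ S) →
    (∀ i, e i ∈ S ∧ f i ∈ S) → S = ⊤
  deg : (ι → ℤ) → Submodule ℂ g
  deg_internal : DirectSum.IsInternal deg
  deg_sbr : ∀ a b, ∀ x ∈ deg a, ∀ y ∈ deg b, sbr (K := ℂ) x y ∈ deg (a + b)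
  deg_e : ∀ i, e i ∈ deg (Pi.single i 1)
  deg_f : ∀ i, f i ∈ deg (-Pi.single i 1)
  deg_zero : deg 0 = h

/-- The even positive roots `Δ₀⁺` determined by a simple system: the even roots that are sums
`∑ aᵢ αᵢ` with coefficients `aᵢ ≥ 0`. -/
def SimpleSystem.evenPositive {ι : Type*} [Fintype ι] [DecidableEq ι] {D : SuperDynkin ι}
    {g : Type*} [AddCommGroup g] [Module ℂ g] [LieSuperalgebra ℂ g] {h : Submodule ℂ g}
    (S : SimpleSystem D h) : Set (Module.Dual ℂ h) :=
  {β | ∃ a : ι → ℤ, 0 ≤ a ∧ a ≠ 0 ∧ (∃ x ∈ S.deg a, x ∈ part (K := ℂ) (V := g) 0 ∧ x ≠ 0) ∧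
    β = ∑ i, a i • S.root i}

/-- `D` is the Dynkin diagram of a basic Lie superalgebra, with respect to some Cartan subalgebra
(of the even part) and some simple system. -/
def SuperDynkin.IsBasic {ι : Type*} [Fintype ι] [DecidableEq ι] (D : SuperDynkin ι) : Prop :=
  ∃ (g : Type) (_ : AddCommGroup g) (_ : Module ℂ g) (_ : LieSuperalgebra ℂ g)
    (h : LieSubalgebra ℂ (EvenPart ℂ g)),
    LieSuperalgebra.IsBasic g ∧ h.IsCartanSubalgebra ∧ Nonempty (SimpleSystem D (evenSubspace h))

/-- A diagram automorphism: a permutation of the vertices that preserves parities and the Cartan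
matrix up to rescaling of its rows. (Rescaling the simple root vectors rescales the rows of the
Cartan matrix; the rows of isotropic vertices have no normalization.) -/
def SuperDynkin.IsAutomorphism {ι : Type*} (D : SuperDynkin ι) (d : Equiv.Perm ι) : Prop :=
  (∀ i, D.parity (d i) = D.parity i) ∧
  ∃ r : ι → ℝ, (∀ i, r i ≠ 0) ∧ ∀ i j, D.cartan (d i) (d j) = r i * D.cartan i j

/-- The structure that turns a Dynkin diagram into an abstract Vogan diagram: an automorphism of
order `1` or `2`, and a set of painted vertices among the even vertices that it fixes. -/
structure AbstractVogan {ι : Type*} (D : SuperDynkin ι) where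
  aut : Equiv.Perm ι
  isAutomorphism : D.IsAutomorphism aut
  involutive : ∀ i, aut (aut i) = i
  painted : Set ι
  painted_fixed : ∀ i ∈ painted, aut i = i
  painted_even : ∀ i ∈ painted, D.parity i = 0

/-! ### Cartan involutions, Cartan subalgebras, and the Vogan diagram of a triple -/

section RealForm

variable {V : Type*} [AddCommGroup V] [Module ℝ V] [LieSuperalgebra ℝ V]

/-- The trace form `tr (ad X ∘ ad Y)` of the action of the even part on the whole superalgebra. -/
def adTrace (X Y : EvenPart ℝ V) : ℝ :=
  LinearMap.trace ℝ V (sbr (K := ℝ) (X : V) ∘ₗ sbr (K := ℝ) (Y : V))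

/-- A Cartan involution of the (reductive) even part of a real Lie superalgebra: an involutive
automorphism `θ` that preserves the form `B (X, Y) = tr (ad X ∘ ad Y)` and for which
`-B (X, θ Y)` is positive definite. The trace is taken over the whole superalgebra, on which the
even part acts faithfully in the cases of interest, so that the centre of the even part is covered
as well. -/
structure IsCartanInvolution (θ : EvenPart ℝ V ≃ₗ⁅ℝ⁆ EvenPart ℝ V) : Prop where
  involutive : ∀ X, θ (θ X) = X
  invariant : ∀ X Y, adTrace (θ X) (θ Y) = adTrace X Y
  pos : ∀ X, X ≠ 0 → 0 < -adTrace X (θ X)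

/-- The `+1` eigenspace `𝔨₀` of `θ`. -/
def compactSpace (θ : EvenPart ℝ V ≃ₗ⁅ℝ⁆ EvenPart ℝ V) : Submodule ℝ (EvenPart ℝ V) :=
  LinearMap.ker ((θ : EvenPart ℝ V →ₗ[ℝ] EvenPart ℝ V) - LinearMap.id)

/-- The `-1` eigenspace `𝔭₀` of `θ`. -/
def noncompactSpace (θ : EvenPart ℝ V ≃ₗ⁅ℝ⁆ EvenPart ℝ V) : Submodule ℝ (EvenPart ℝ V) :=
  LinearMap.ker ((θ : EvenPart ℝ V →ₗ[ℝ] EvenPart ℝ V) + LinearMap.id)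

/-- `h` is a `θ`-stable Cartan subalgebra of the even part. -/
def IsStableCartan (θ : EvenPart ℝ V ≃ₗ⁅ℝ⁆ EvenPart ℝ V)
    (h : LieSubalgebra ℝ (EvenPart ℝ V)) : Prop :=
  h.IsCartanSubalgebra ∧ ∀ X ∈ h, θ X ∈ h

/-- `h` is a maximally compact `θ`-stable Cartan subalgebra: the dimension of `𝔱 = 𝔥 ∩ 𝔨` is as
large as possible among the `θ`-stable Cartan subalgebras. -/
def IsMaximallyCompact (θ : EvenPart ℝ V ≃ₗ⁅ℝ⁆ EvenPart ℝ V)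
    (h : LieSubalgebra ℝ (EvenPart ℝ V)) : Prop :=
  IsStableCartan θ h ∧ ∀ h' : LieSubalgebra ℝ (EvenPart ℝ V), IsStableCartan θ h' →
    Module.finrank ℝ ↥(h'.toSubmodule ⊓ compactSpace θ) ≤
      Module.finrank ℝ ↥(h.toSubmodule ⊓ compactSpace θ)

/-- `𝔱 = 𝔥 ∩ 𝔨`, as a subspace of `𝔥`. -/
def tPart (θ : EvenPart ℝ V ≃ₗ⁅ℝ⁆ EvenPart ℝ V) (h : LieSubalgebra ℝ (EvenPart ℝ V)) :
    Submodule ℝ h :=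
  (compactSpace θ).comap h.toSubmodule.subtype

/-- `𝔞 = 𝔥 ∩ 𝔭`, as a subspace of `𝔥`. -/
def aPart (θ : EvenPart ℝ V ≃ₗ⁅ℝ⁆ EvenPart ℝ V) (h : LieSubalgebra ℝ (EvenPart ℝ V)) :
    Submodule ℝ h :=
  (noncompactSpace θ).comap h.toSubmodule.subtype

/-- A finite sequence of complex numbers whose first nonzero term is a positive real number. -/
def LexPositive {n : ℕ} (z : Fin n → ℂ) : Prop :=
  ∃ k, (∀ j < k, z j = 0) ∧ ∃ x : ℝ, 0 < x ∧ z k = x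

/-- The set `P` is the system of positive even roots that takes `i𝔱` before `𝔞`: it is the system
of positive even roots of the lexicographic order defined by a basis of `i𝔱` followed by a basis
of `𝔞`. -/
def TakesItBeforeA (θ : EvenPart ℝ V ≃ₗ⁅ℝ⁆ EvenPart ℝ V) (h : LieSubalgebra ℝ (EvenPart ℝ V))
    (P : Set (Module.Dual ℂ (complexify h))) : Prop :=
  ∃ (r s : ℕ) (b : Module.Basis (Fin r) ℝ (tPart θ h)) (c : Module.Basis (Fin s) ℝ (aPart θ h)),
    P = {β | β ∈ evenRoots (complexify h) ∧
      LexPositive (Fin.append (fun k => β (Complex.I • toComplexify h (b k)))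
        (fun k => β (toComplexify h (c k))))}

/-- The complexification of a subspace of the even part. -/
def complexSpan (W : Submodule ℝ (EvenPart ℝ V)) : Submodule ℂ (ℂ ⊗[ℝ] V) :=
  (W.map (part (K := ℝ) (V := V) 0).subtype).baseChange ℂ

/-- The given abstract Vogan diagram is the Vogan diagram of the simple system `S` with respect
to `θ`: the involution `θ` permutes the simple roots by the diagram automorphism, and among
the even vertices fixed by `θ` the painted ones are the noncompact simple roots (root vector in the
complexification of `𝔭`) and the unpainted ones are the compact ones (root vector in the
complexification of `𝔨`). Odd vertices carry no painting. -/
structure AbstractVogan.IsVoganDiagramOf {ι : Type*} [Fintype ι] [DecidableEq ι]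
    {D : SuperDynkin ι} (A : AbstractVogan D)
    (θ : EvenPart ℝ V ≃ₗ⁅ℝ⁆ EvenPart ℝ V)
    (h : LieSubalgebra ℝ (EvenPart ℝ V)) (S : SimpleSystem D (complexify h)) : Prop where
  orbit : ∀ (i : ι) (X Y : h), (Y : EvenPart ℝ V) = θ X →
    S.root (A.aut i) (toComplexify h X) = S.root i (toComplexify h Y)
  painted : ∀ i, i ∈ A.painted → S.e i ∈ complexSpan (noncompactSpace θ)
  unpainted : ∀ i, A.aut i = i → D.parity i = 0 → i ∉ A.painted →
    S.e i ∈ complexSpan (compactSpace θ)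

end RealForm

end

open LieSuperalgebra

noncomputable section

-- Take a complex basic superalgebra with the given diagram. Its Chevalley generators yield two
-- antilinear automorphisms. The first, `ψ`, sends `e i` to `-f i`, and `f i` to `-e i` or `e i`
-- according to parity. The second, `σ`, is an involution sending `e i` to a multiple of `f (d i)`,
-- the multiple being `1` at painted vertices and `-1` at unpainted even ones. The required real
-- superalgebra is the fixed space of `σ`.
--
-- Both automorphisms come from an isomorphism theorem (`exists_hom_of_isChevalley`) that needs no
-- Serre relations: the subalgebra of a product generated by the diagonal pairs of generators is a
-- graph, because the second factor is simple. Its antilinear form takes the complex conjugate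
-- superalgebra as second factor.
--
-- On the even part `ψ` need not be the compact conjugation: an even root whose expansion involves
-- odd simple roots may carry the wrong sign. But even root spaces are one-dimensional, and strings
-- for `sl₂`-triples together with the trace form show that the required signs are multiplicative on
-- even roots (`sgn_add`). So `ψ` corrected by these signs, `compactConj`, is an automorphism of the
-- even part. It commutes there with `σ`, and its restriction to the real form is `θ`. No correction
-- occurs at even simple roots (`sgn_single`), so comparing `σ` with `ψ` on `e i` gives the
-- painting.
--
-- The remaining claims rest on an element `H` of the Cartan subalgebra at which every even root
-- takes its height (`exists_height_invariant`). Then `-iH` lies in `𝔱` and no even root vanishes on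
-- it, so its centralizer in `𝔨` lies in `𝔱`. In a compact Lie algebra a commuting subspace has at
-- most the dimension of the centralizer of any given element (`finrank_le`), whence maximal
-- compactness. As the first basis vector of `i𝔱`, a nonzero `H` decides the lexicographic order.

local notation:70 x:71 "◃" y:70 => LieSuperalgebra.sbr (K := ℂ) x y

/-! ### Generalities on complex Lie superalgebras -/

namespace LieSuperalgebra

section General

variable {g : Type*} [AddCommGroup g] [Module ℂ g] [LieSuperalgebra ℂ g]

theorem exists_eq_add_parts (x : g) :
    ∃ x₀ ∈ part (K := ℂ) (V := g) 0, ∃ x₁ ∈ part (K := ℂ) (V := g) 1, x = x₀ + x₁ := by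
  have hx : x ∈ part (K := ℂ) (V := g) 0 ⊔ part 1 := by
    rw [(isCompl (K := ℂ) (V := g)).sup_eq_top]; trivial
  obtain ⟨a, ha, b, hb, rfl⟩ := Submodule.mem_sup.mp hx
  exact ⟨a, ha, b, hb, rfl⟩

theorem eq_zero_of_mem_parts {x : g} (h0 : x ∈ part (K := ℂ) (V := g) 0)
    (h1 : x ∈ part (K := ℂ) (V := g) 1) : x = 0 :=
  (Submodule.disjoint_def.mp (isCompl (K := ℂ) (V := g)).disjoint) x h0 h1

theorem eq_zero_of_mem_part_ne {i j : ZMod 2} (hij : i ≠ j) {x : g}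
    (hi : x ∈ part (K := ℂ) (V := g) i) (hj : x ∈ part (K := ℂ) (V := g) j) : x = 0 := by
  fin_cases i <;> fin_cases j
  · exact absurd rfl hij
  · exact eq_zero_of_mem_parts hi hj
  · exact eq_zero_of_mem_parts hj hi
  · exact absurd rfl hij

theorem sbr_jacobi_left {i j : ZMod 2} {x y : g} (hx : x ∈ part (K := ℂ) i)
    (hy : y ∈ part (K := ℂ) j) (z : g) :
    x ◃ y ◃ z = (x ◃ y) ◃ z + superSign i j • (y ◃ x ◃ z) := by
  obtain ⟨z₀, h₀, z₁, h₁, rfl⟩ := exists_eq_add_parts z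
  simp only [map_add, smul_add, sbr_jacobi hx hy h₀, sbr_jacobi hx hy h₁]
  abel

theorem superSign_zero_left (j : ZMod 2) : superSign 0 j = 1 := by simp [superSign]

theorem superSign_zero_right (j : ZMod 2) : superSign j 0 = 1 := by simp [superSign]

theorem superSign_mul_self (i j : ZMod 2) : superSign i j * superSign i j = 1 := by
  unfold superSign; split_ifs <;> simp

theorem sbr_even_jacobi {x : g} (hx : x ∈ part (K := ℂ) (V := g) 0) (y z : g) :
    x ◃ y ◃ z = (x ◃ y) ◃ z + y ◃ x ◃ z := by
  obtain ⟨y₀, h₀, y₁, h₁, rfl⟩ := exists_eq_add_parts y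
  simp only [map_add, LinearMap.add_apply, sbr_jacobi_left hx h₀, sbr_jacobi_left hx h₁,
    superSign_zero_left, one_smul]
  abel

theorem sbr_even_skew {x : g} (hx : x ∈ part (K := ℂ) (V := g) 0) (y : g) :
    y ◃ x = -(x ◃ y) := by
  obtain ⟨y₀, h₀, y₁, h₁, rfl⟩ := exists_eq_add_parts y
  simp only [map_add, LinearMap.add_apply, sbr_skew h₀ hx, sbr_skew h₁ hx,
    superSign_zero_right, one_smul]
  abel

theorem part_add_self {i : ZMod 2} {x y : g} (hx : x ∈ part (K := ℂ) i)
    (hy : y ∈ part (K := ℂ) i) : x ◃ y ∈ part (K := ℂ) (V := g) 0 := by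
  have := sbr_mem hx hy
  rwa [CharTwo.add_self_eq_zero] at this

/-- In a simple Lie superalgebra only `0` is annihilated by all brackets. -/
theorem IsSimple.eq_zero_of_central (hg : IsSimple g) {x : g}
    (hx0 : x ∈ part (K := ℂ) (V := g) 0) (hx : ∀ y, y ◃ x = 0) : x = 0 := by
  rcases hg.2 (ℂ ∙ x) (fun y z hz => by
    obtain ⟨c, rfl⟩ := Submodule.mem_span_singleton.mp hz
    simp [hx y]) (by
    have : ℂ ∙ x ≤ part (K := ℂ) (V := g) 0 := by simpa using hx0
    rw [inf_eq_left.mpr this]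
    exact (sup_eq_left.mpr inf_le_left).symm) with h | h
  · simpa using h
  · obtain ⟨⟨y, z, hyz⟩, -⟩ := hg
    obtain ⟨c, rfl⟩ := Submodule.mem_span_singleton.mp (h ▸ Submodule.mem_top : z ∈ ℂ ∙ x)
    exact absurd (by simp [hx y]) hyz

end General

/-! ### Subalgebras generated by Chevalley generators -/

section Words

variable {ι : Type*} {M : Type*} [AddCommGroup M] [Module ℂ M] [LieSuperalgebra ℂ M]

/-- Elements `e i`, `f i` satisfying the relations of Chevalley generators with parities `p` and
Cartan matrix `a` (without Serre relations). -/
structure IsChevalley (p : ι → ZMod 2) (a : ι → ι → ℂ) (e f : ι → M) : Prop where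
  e_mem : ∀ i, e i ∈ part (K := ℂ) (p i)
  f_mem : ∀ i, f i ∈ part (K := ℂ) (p i)
  e_f_ne : ∀ i j, i ≠ j → e i ◃ f j = 0
  h_e : ∀ i j, (e i ◃ f i) ◃ e j = a i j • e j
  h_f : ∀ i j, (e i ◃ f i) ◃ f j = -(a i j • f j)

/-- Right-normed iterated brackets of the elements `e i`. -/
inductive Word (e : ι → M) : M → Prop
  | base (i : ι) : Word e (e i)
  | step (i : ι) {x : M} : Word e x → Word e (e i ◃ x)

/-- The span of all right-normed iterated brackets. -/
def wordSpan (e : ι → M) : Submodule ℂ M := Submodule.span ℂ {x | Word e x}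

theorem sbr_mem_wordSpan (e : ι → M) (i : ι) {x : M} (hx : x ∈ wordSpan e) :
    e i ◃ x ∈ wordSpan e := by
  have : wordSpan e ≤ (wordSpan e).comap (sbr (K := ℂ) (e i)) :=
    Submodule.span_le.mpr fun y hy => Submodule.subset_span (Word.step i hy)
  exact this hx

namespace IsChevalley

variable {p : ι → ZMod 2} {a : ι → ι → ℂ} {e f : ι → M}

theorem h_mem (hc : IsChevalley p a e f) (i : ι) :
    e i ◃ f i ∈ part (K := ℂ) (V := M) 0 := part_add_self (hc.e_mem i) (hc.f_mem i)

theorem f_e (hc : IsChevalley p a e f) (i : ι) :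
    f i ◃ e i = -(superSign (p i) (p i) • (e i ◃ f i)) := sbr_skew (hc.f_mem i) (hc.e_mem i)

theorem f_e_ne (hc : IsChevalley p a e f) {i j : ι} (hij : i ≠ j) : f i ◃ e j = 0 := by
  rw [sbr_skew (hc.f_mem i) (hc.e_mem j), hc.e_f_ne j i hij.symm, smul_zero, neg_zero]

/-- Exchanging the roles of the `e i` and the `f i`. -/
theorem opp (hc : IsChevalley p a e f) :
    IsChevalley p a f (fun i => superSign (p i) (p i) • e i) where
  e_mem := hc.f_mem
  f_mem i := zsmul_mem (hc.e_mem i) _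
  e_f_ne i j hij := by rw [map_zsmul, hc.f_e_ne hij, smul_zero]
  h_e i j := by
    rw [map_zsmul, hc.f_e, smul_neg, smul_smul, superSign_mul_self, one_smul, map_neg,
      LinearMap.neg_apply, hc.h_f, neg_neg]
  h_f i j := by
    rw [map_zsmul (sbr (K := ℂ) (f i)), hc.f_e, smul_neg, smul_smul, superSign_mul_self, one_smul,
      map_neg, LinearMap.neg_apply, map_zsmul, hc.h_e, smul_comm]

theorem word_mem_part (hc : IsChevalley p a e f) {x : M} (hx : Word e x) :
    ∃ q, x ∈ part (K := ℂ) (V := M) q := by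
  induction hx with
  | base i => exact ⟨_, hc.e_mem i⟩
  | step i _ ih =>
    obtain ⟨q, hq⟩ := ih
    exact ⟨_, sbr_mem (hc.e_mem i) hq⟩

theorem h_word (hc : IsChevalley p a e f) (j : ι) {x : M} (hx : Word e x) :
    ∃ c : ℂ, (e j ◃ f j) ◃ x = c • x := by
  induction hx with
  | base i => exact ⟨_, hc.h_e j i⟩
  | step i _ ih =>
    obtain ⟨c, hcx⟩ := ih
    refine ⟨a j i + c, ?_⟩
    rw [sbr_even_jacobi (hc.h_mem j), hc.h_e, hcx, map_smul, map_smul, LinearMap.smul_apply,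
      add_smul]

theorem h_wordSpan (hc : IsChevalley p a e f) (j : ι) {x : M} (hx : x ∈ wordSpan e) :
    (e j ◃ f j) ◃ x ∈ wordSpan e := by
  have : wordSpan e ≤ (wordSpan e).comap (sbr (K := ℂ) (e j ◃ f j)) :=
    Submodule.span_le.mpr fun y hy => by
      obtain ⟨c, hcy⟩ := hc.h_word j hy
      simp only [Submodule.comap_coe, Set.mem_preimage, SetLike.mem_coe, hcy]
      exact Submodule.smul_mem _ _ (Submodule.subset_span hy)
  exact this hx

/-- The span of the elements `h i = [e i, f i]`. -/
def corootSpan (e f : ι → M) : Submodule ℂ M :=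
  Submodule.span ℂ (Set.range fun i => e i ◃ f i)

theorem e_corootSpan (hc : IsChevalley p a e f) (j : ι) {x : M} (hx : x ∈ corootSpan e f) :
    e j ◃ x ∈ wordSpan e := by
  have : corootSpan e f ≤ (wordSpan e).comap (sbr (K := ℂ) (e j)) := by
    refine Submodule.span_le.mpr ?_
    rintro _ ⟨i, rfl⟩
    simp only [Submodule.comap_coe, Set.mem_preimage, SetLike.mem_coe]
    rw [sbr_even_skew (hc.h_mem i), hc.h_e]
    exact neg_mem (Submodule.smul_mem _ _ (Submodule.subset_span (Word.base j)))
  exact this hx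

/-- Jacobi moves `f j` past the first letter. The bracket `[f j, e i]` is zero or a multiple of a
coroot, and coroots only scale words; the rest is induction on length. Only words of length one
produce coroots. -/
theorem f_word (hc : IsChevalley p a e f) (j : ι) {x : M} (hx : Word e x) :
    f j ◃ x ∈ wordSpan e ⊔ corootSpan e f := by
  induction hx with
  | base i =>
    refine Submodule.mem_sup_right ?_
    by_cases hij : j = i
    · subst hij
      rw [hc.f_e]
      exact neg_mem (zsmul_mem (K := corootSpan e f) (Submodule.subset_span ⟨j, rfl⟩) _)
    · rw [hc.f_e_ne hij]; exact zero_mem _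
  | @step i x hx ih =>
    refine Submodule.mem_sup_left ?_
    rw [sbr_jacobi_left (hc.f_mem j) (hc.e_mem i)]
    refine add_mem ?_ (zsmul_mem ?_ _)
    · by_cases hij : j = i
      · subst hij
        rw [hc.f_e, map_neg, map_zsmul, LinearMap.neg_apply, LinearMap.smul_apply]
        exact neg_mem (zsmul_mem (hc.h_wordSpan j (Submodule.subset_span hx)) _)
      · rw [hc.f_e_ne hij, map_zero]; exact zero_mem _
    · obtain ⟨u, hu, v, hv, huv⟩ := Submodule.mem_sup.mp ih
      rw [← huv, map_add]
      exact add_mem (sbr_mem_wordSpan e i hu) (hc.e_corootSpan i hv)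

theorem f_wordSpan (hc : IsChevalley p a e f) (j : ι) {x : M} (hx : x ∈ wordSpan e) :
    f j ◃ x ∈ wordSpan e ⊔ corootSpan e f := by
  have : wordSpan e ≤ (wordSpan e ⊔ corootSpan e f).comap (sbr (K := ℂ) (f j)) :=
    Submodule.span_le.mpr fun y hy => hc.f_word j hy
  exact this hx

theorem corootSpan_opp (hc : IsChevalley p a e f) :
    corootSpan f (fun i => superSign (p i) (p i) • e i) ≤ corootSpan e f := by
  refine Submodule.span_le.mpr ?_
  rintro _ ⟨i, rfl⟩
  simp only [map_zsmul, hc.f_e, SetLike.mem_coe]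
  exact zsmul_mem (neg_mem (zsmul_mem (K := corootSpan e f)
    (Submodule.subset_span ⟨i, rfl⟩) _)) _

/-- The triangular sum: span of words in the `f i`, of the `h i`, and of words in the `e i`. -/
def tri (e f : ι → M) : Submodule ℂ M := wordSpan e ⊔ corootSpan e f ⊔ wordSpan f

theorem f_tri_half (hc : IsChevalley p a e f) (j : ι) {x : M}
    (hx : x ∈ corootSpan e f) : f j ◃ x ∈ wordSpan f := by
  have : corootSpan e f ≤ (wordSpan f).comap (sbr (K := ℂ) (f j)) := by
    refine Submodule.span_le.mpr ?_
    rintro _ ⟨i, rfl⟩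
    simp only [Submodule.comap_coe, Set.mem_preimage, SetLike.mem_coe]
    rw [sbr_even_skew (hc.h_mem i), hc.h_f, neg_neg]
    exact Submodule.smul_mem _ _ (Submodule.subset_span (Word.base j))
  exact this hx

theorem e_tri (hc : IsChevalley p a e f) (j : ι) {x : M} (hx : x ∈ tri e f) :
    e j ◃ x ∈ tri e f := by
  obtain ⟨y, hy, w, hw, rfl⟩ := Submodule.mem_sup.mp hx
  obtain ⟨u, hu, v, hv, rfl⟩ := Submodule.mem_sup.mp hy
  simp only [map_add]
  refine add_mem (Submodule.mem_sup_left (Submodule.mem_sup_left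
    (add_mem (sbr_mem_wordSpan e j hu) (hc.e_corootSpan j hv)))) ?_
  -- Words in the `f i` are treated by `f_wordSpan` for the opposite generators, whose lowering
  -- elements are `± e j`; the sign is then removed by squaring it.
  have h := hc.opp.f_wordSpan j hw
  have h2 : wordSpan f ⊔ corootSpan f (fun i => superSign (p i) (p i) • e i) ≤ tri e f :=
    sup_le le_sup_right (hc.corootSpan_opp.trans (le_sup_right.trans le_sup_left))
  have h3 := zsmul_mem (h2 h) (superSign (p j) (p j))
  rwa [map_zsmul, LinearMap.smul_apply, smul_smul, superSign_mul_self, one_smul] at h3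

theorem f_tri (hc : IsChevalley p a e f) (j : ι) {x : M} (hx : x ∈ tri e f) :
    f j ◃ x ∈ tri e f := by
  obtain ⟨y, hy, w, hw, rfl⟩ := Submodule.mem_sup.mp hx
  obtain ⟨u, hu, v, hv, rfl⟩ := Submodule.mem_sup.mp hy
  simp only [map_add]
  exact add_mem (add_mem (Submodule.mem_sup_left (hc.f_wordSpan j hu))
    (Submodule.mem_sup_right (hc.f_tri_half j hv)))
    (Submodule.mem_sup_right (sbr_mem_wordSpan f j hw))

/-- By Jacobi, homogeneous elements whose adjoint action preserves the triangular sum are stable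
under brackets. The parity clause is carried along because super Jacobi needs homogeneous left
arguments. -/
theorem word_tri {u : ι → M} (hp : ∀ i, u i ∈ part (K := ℂ) (p i))
    (hu : ∀ j, ∀ x ∈ tri e f, u j ◃ x ∈ tri e f) {w : M} (hw : Word u w) :
    (∃ q, w ∈ part (K := ℂ) (V := M) q) ∧ ∀ x ∈ tri e f, w ◃ x ∈ tri e f := by
  induction hw with
  | base i => exact ⟨⟨_, hp i⟩, hu i⟩
  | @step i w _ ih =>
    obtain ⟨⟨q, hq⟩, ih⟩ := ih
    refine ⟨⟨_, sbr_mem (hp i) hq⟩, fun x hx => ?_⟩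
    have h := sbr_jacobi_left (hp i) hq x
    rw [← sub_eq_iff_eq_add] at h
    rw [← h]
    exact sub_mem (hu i _ (ih x hx)) (zsmul_mem (ih _ (hu i x hx)) _)

/-- Stability under the generators suffices, since every summand is spanned by iterated brackets of
generators. -/
theorem tri_closed (hc : IsChevalley p a e f) : ∀ x ∈ tri e f, ∀ y ∈ tri e f,
    x ◃ y ∈ tri e f := by
  intro x hx y hy
  have key : tri e f ≤ (tri e f).comap ((sbr (K := ℂ) (V := M)).flip y) := by
    refine sup_le (sup_le (Submodule.span_le.mpr ?_) (Submodule.span_le.mpr ?_))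
      (Submodule.span_le.mpr ?_)
    · intro w hw
      exact (word_tri hc.e_mem (fun j x hx => hc.e_tri j hx) hw).2 y hy
    · rintro _ ⟨i, rfl⟩
      have h := sbr_jacobi_left (hc.e_mem i) (hc.f_mem i) y
      rw [← sub_eq_iff_eq_add] at h
      simp only [Submodule.comap_coe, Set.mem_preimage, LinearMap.flip_apply, SetLike.mem_coe]
      rw [← h]
      exact sub_mem (hc.e_tri i (hc.f_tri i hy)) (zsmul_mem (hc.f_tri i (hc.e_tri i hy)) _)
    · intro w hw
      exact (word_tri hc.f_mem (fun j x hx => hc.f_tri j hx) hw).2 y hy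
  exact key hx

theorem e_mem_tri (i : ι) : e i ∈ tri e f :=
  Submodule.mem_sup_left (Submodule.mem_sup_left (Submodule.subset_span (Word.base i)))

theorem f_mem_tri (i : ι) : f i ∈ tri e f :=
  Submodule.mem_sup_right (Submodule.subset_span (Word.base i))

/-- The triangular sum is a graded subspace. -/
theorem tri_graded (hc : IsChevalley p a e f) {x : M} (hx : x ∈ tri e f) :
    ∃ x₀ ∈ part (K := ℂ) (V := M) 0, x₀ ∈ tri e f ∧
      ∃ x₁ ∈ part (K := ℂ) (V := M) 1, x₁ ∈ tri e f ∧ x = x₀ + x₁ := by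
  have hom : ∀ {q : ZMod 2} {w : M}, w ∈ part (K := ℂ) q → w ∈ tri e f →
      w ∈ (part 0 ⊓ tri e f) ⊔ (part 1 ⊓ tri e f) := by
    intro q w hw ht
    fin_cases q
    · exact Submodule.mem_sup_left ⟨hw, ht⟩
    · exact Submodule.mem_sup_right ⟨hw, ht⟩
  have key : tri e f ≤ (part 0 ⊓ tri e f) ⊔ (part 1 ⊓ tri e f) := by
    refine sup_le (sup_le (Submodule.span_le.mpr ?_) (Submodule.span_le.mpr ?_))
      (Submodule.span_le.mpr ?_)
    · intro w hw
      obtain ⟨q, hq⟩ := hc.word_mem_part hw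
      exact hom hq (Submodule.mem_sup_left (Submodule.mem_sup_left (Submodule.subset_span hw)))
    · rintro _ ⟨i, rfl⟩
      exact hom (hc.h_mem i)
        (Submodule.mem_sup_left (Submodule.mem_sup_right (Submodule.subset_span ⟨i, rfl⟩)))
    · intro w hw
      obtain ⟨q, hq⟩ := hc.opp.word_mem_part hw
      exact hom hq (Submodule.mem_sup_right (Submodule.subset_span hw))
  obtain ⟨x₀, h₀, x₁, h₁, rfl⟩ := Submodule.mem_sup.mp (key hx)
  exact ⟨x₀, h₀.1, h₀.2, x₁, h₁.1, h₁.2, rfl⟩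

end IsChevalley

end Words

/-! ### Products and complex conjugate superalgebras -/

section Product

variable {g g' : Type*} [AddCommGroup g] [Module ℂ g] [LieSuperalgebra ℂ g]
  [AddCommGroup g'] [Module ℂ g'] [LieSuperalgebra ℂ g']

instance prodSuperalgebra : LieSuperalgebra ℂ (g × g') where
  part i := (part i).prod (part i)
  isCompl := by
    constructor
    · rw [Submodule.disjoint_def]
      rintro ⟨x, y⟩ ⟨hx, hy⟩ ⟨hx', hy'⟩
      exact Prod.ext (eq_zero_of_mem_parts hx hx') (eq_zero_of_mem_parts hy hy')
    · rw [codisjoint_iff, Submodule.prod_sup_prod, (isCompl (K := ℂ) (V := g)).sup_eq_top,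
        (isCompl (K := ℂ) (V := g')).sup_eq_top, Submodule.prod_top]
  sbr := LinearMap.mk₂ ℂ (fun x y => (x.1 ◃ y.1, x.2 ◃ y.2))
    (by intros; simp) (by intros; simp) (by intros; simp) (by intros; simp)
  sbr_mem hx hy := ⟨sbr_mem hx.1 hy.1, sbr_mem hx.2 hy.2⟩
  sbr_skew hx hy := Prod.ext (sbr_skew hx.1 hy.1) (sbr_skew hx.2 hy.2)
  sbr_jacobi hx hy hz := Prod.ext (sbr_jacobi hx.1 hy.1 hz.1) (sbr_jacobi hx.2 hy.2 hz.2)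

theorem prod_sbr (x y : g × g') : x ◃ y = (x.1 ◃ y.1, x.2 ◃ y.2) := rfl

end Product

/-- The complex conjugate of a complex vector space. -/
def ConjSpace (g : Type*) : Type _ := g

section Conj

variable {g : Type*} [AddCommGroup g] [Module ℂ g]

instance : AddCommGroup (ConjSpace g) := inferInstanceAs (AddCommGroup g)

instance : Module ℂ (ConjSpace g) :=
  Module.compHom (M := g) (starRingEnd ℂ)

/-- The identity map to the complex conjugate space. -/
def toConj : g ≃+ ConjSpace g := AddEquiv.refl g

theorem toConj_smul (z : ℂ) (x : g) :
    toConj (z • x) = (starRingEnd ℂ z) • toConj x := by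
  change z • x = (starRingEnd ℂ (starRingEnd ℂ z)) • x
  rw [Complex.conj_conj]

theorem toConj_symm_smul (z : ℂ) (x : ConjSpace g) :
    toConj.symm (z • x) = (starRingEnd ℂ z) • toConj.symm x := rfl

/-- A complex subspace as a subspace of the complex conjugate space. -/
def conjSub (p : Submodule ℂ g) : Submodule ℂ (ConjSpace g) where
  carrier := {x | toConj.symm x ∈ p}
  add_mem' hx hy := p.add_mem hx hy
  zero_mem' := p.zero_mem
  smul_mem' c _ hx := p.smul_mem (starRingEnd ℂ c) hx

variable [LieSuperalgebra ℂ g]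

/-- An antilinear automorphism of `g` is a linear isomorphism from `g` onto this superalgebra, so
the linear isomorphism theorem also produces antilinear maps. -/
instance conjSuperalgebra : LieSuperalgebra ℂ (ConjSpace g) where
  part i := conjSub (part i)
  isCompl := by
    constructor
    · rw [Submodule.disjoint_def]
      intro x hx hy
      exact eq_zero_of_mem_parts (g := g) hx hy
    · rw [codisjoint_iff, eq_top_iff]
      rintro x -
      obtain ⟨x₀, h₀, x₁, h₁, h⟩ := exists_eq_add_parts (toConj.symm x)
      have : x = toConj x₀ + toConj x₁ := h
      rw [this]
      exact add_mem (Submodule.mem_sup_left h₀) (Submodule.mem_sup_right h₁)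
  sbr := LinearMap.mk₂ ℂ (fun x y => toConj (toConj.symm x ◃ toConj.symm y))
    (by intros; simp) (by intros; simp [toConj_symm_smul, toConj_smul]) (by intros; simp)
    (by intros; simp [toConj_symm_smul, toConj_smul])
  sbr_mem hx hy := sbr_mem (V := g) hx hy
  sbr_skew hx hy := sbr_skew (V := g) (K := ℂ) hx hy
  sbr_jacobi hx hy hz := sbr_jacobi (V := g) (K := ℂ) hx hy hz

theorem conj_sbr (x y : g) : toConj x ◃ toConj y = toConj (x ◃ y) := rfl

theorem IsSimple.conj (hg : IsSimple g) : IsSimple (ConjSpace g) := by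
  obtain ⟨⟨x, y, hxy⟩, h⟩ := hg
  refine ⟨⟨toConj x, toConj y, hxy⟩, fun I hI hgr => ?_⟩
  let J : Submodule ℂ g :=
    { carrier := {x | toConj x ∈ I}
      add_mem' := fun hx hy => I.add_mem hx hy
      zero_mem' := I.zero_mem
      smul_mem' := fun c x hx => by
        simp only [Set.mem_ofPred_eq, toConj_smul]; exact I.smul_mem _ hx }
  rcases h J (fun x y hy => hI (toConj x) (toConj y) hy) (by
    refine le_antisymm (fun z hz => ?_) (sup_le inf_le_left inf_le_left)
    have hz' : toConj z ∈ I := hz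
    rw [hgr] at hz'
    obtain ⟨u, hu, v, hv, huv⟩ := Submodule.mem_sup.mp hz'
    have : z = toConj.symm u + toConj.symm v := huv.symm
    rw [this]
    exact add_mem (Submodule.mem_sup_left ⟨hu.1, hu.2⟩)
      (Submodule.mem_sup_right ⟨hv.1, hv.2⟩)) with hJ | hJ
  · left
    rw [eq_bot_iff]
    intro x hx
    have : toConj.symm x ∈ J := hx
    rw [hJ] at this
    exact this
  · right
    rw [eq_top_iff]
    intro x _
    have : toConj.symm x ∈ J := by rw [hJ]; trivial
    exact this

end Conj

/-! ### The isomorphism theorem -/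

/-- A family of elements generates a Lie superalgebra. -/
def Generates {ι : Type*} {g : Type*} [AddCommGroup g] [Module ℂ g] [LieSuperalgebra ℂ g]
    (e f : ι → g) : Prop :=
  ∀ S : Submodule ℂ g, (∀ x ∈ S, ∀ y ∈ S, x ◃ y ∈ S) → (∀ i, e i ∈ S ∧ f i ∈ S) → S = ⊤

section Isomorphism

variable {ι : Type*} {g g' : Type*} [AddCommGroup g] [Module ℂ g]
  [LieSuperalgebra ℂ g] [AddCommGroup g'] [Module ℂ g'] [LieSuperalgebra ℂ g']
  {p : ι → ZMod 2} {a : ι → ι → ℂ} {e f : ι → g} {e' f' : ι → g'}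

theorem IsChevalley.prod (hc : IsChevalley p a e f) (hc' : IsChevalley p a e' f') :
    IsChevalley (M := g × g') p a (fun i => (e i, e' i)) (fun i => (f i, f' i)) where
  e_mem i := ⟨hc.e_mem i, hc'.e_mem i⟩
  f_mem i := ⟨hc.f_mem i, hc'.f_mem i⟩
  e_f_ne i j hij := Prod.ext (hc.e_f_ne i j hij) (hc'.e_f_ne i j hij)
  h_e i j := Prod.ext (hc.h_e i j) (hc'.h_e i j)
  h_f i j := Prod.ext (hc.h_f i j) (hc'.h_f i j)

theorem Word.prod {u : ι → g} {u' : ι → g'} {w : g × g'}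
    (hw : Word (fun i => (u i, u' i)) w) : Word u w.1 ∧ Word u' w.2 := by
  induction hw with
  | base i => exact ⟨Word.base i, Word.base i⟩
  | step i _ ih => exact ⟨Word.step i ih.1, Word.step i ih.2⟩

/-- The triangular sum in a product projects to the diagonal Cartan part. -/
theorem tri_prod_proj [Fintype ι] {π : g →ₗ[ℂ] g} {π' : g' →ₗ[ℂ] g'}
    (hπe : ∀ w, Word e w → π w = 0) (hπf : ∀ w, Word f w → π w = 0)
    (hπh : ∀ i, π (e i ◃ f i) = e i ◃ f i)
    (hπe' : ∀ w, Word e' w → π' w = 0) (hπf' : ∀ w, Word f' w → π' w = 0)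
    (hπh' : ∀ i, π' (e' i ◃ f' i) = e' i ◃ f' i) {x : g × g'}
    (hx : x ∈ IsChevalley.tri (fun i => (e i, e' i)) (fun i => (f i, f' i))) :
    ∃ s : ι → ℂ, π x.1 = ∑ i, s i • (e i ◃ f i) ∧ π' x.2 = ∑ i, s i • (e' i ◃ f' i) := by
  have key : IsChevalley.tri (fun i => (e i, e' i)) (fun i => (f i, f' i)) ≤
      (Submodule.span ℂ (Set.range fun i => ((e i, e' i) : g × g') ◃ (f i, f' i))).comap
        (π.prodMap π') := by
    refine sup_le (sup_le (Submodule.span_le.mpr ?_) (Submodule.span_le.mpr ?_))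
      (Submodule.span_le.mpr ?_)
    · intro w hw
      have : π.prodMap π' w = 0 := Prod.ext (hπe _ hw.prod.1) (hπe' _ hw.prod.2)
      simp only [Submodule.comap_coe, Set.mem_preimage, SetLike.mem_coe, this]
      exact zero_mem _
    · rintro _ ⟨i, rfl⟩
      have : π.prodMap π' (((e i, e' i) : g × g') ◃ (f i, f' i)) =
        ((e i, e' i) : g × g') ◃ (f i, f' i) := Prod.ext (hπh i) (hπh' i)
      simp only [Submodule.comap_coe, Set.mem_preimage, SetLike.mem_coe, this]
      exact Submodule.subset_span ⟨i, rfl⟩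
    · intro w hw
      have : π.prodMap π' w = 0 := Prod.ext (hπf _ hw.prod.1) (hπf' _ hw.prod.2)
      simp only [Submodule.comap_coe, Set.mem_preimage, SetLike.mem_coe, this]
      exact zero_mem _
  obtain ⟨s, hs⟩ := (Submodule.mem_span_range_iff_exists_fun ℂ).mp (key hx)
  refine ⟨s, ?_, ?_⟩
  · have := congrArg Prod.fst hs
    simpa [Prod.fst_sum, prod_sbr] using this.symm
  · have := congrArg Prod.snd hs
    simpa [Prod.snd_sum, prod_sbr] using this.symm

/-- Isomorphism theorem: Lie superalgebras generated by Chevalley generators with the same Cartan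
matrix, the second one simple, are related by a homomorphism matching the generators. -/
theorem exists_hom_of_isChevalley [Fintype ι] (hc : IsChevalley p a e f) (hc' : IsChevalley p a e' f')
    (hgen : Generates e f) (hgen' : Generates e' f') (hsim : IsSimple g')
    {π : g →ₗ[ℂ] g} {π' : g' →ₗ[ℂ] g'}
    (hπe : ∀ w, Word e w → π w = 0) (hπf : ∀ w, Word f w → π w = 0)
    (hπh : ∀ i, π (e i ◃ f i) = e i ◃ f i)
    (hπe' : ∀ w, Word e' w → π' w = 0) (hπf' : ∀ w, Word f' w → π' w = 0)
    (hπh' : ∀ i, π' (e' i ◃ f' i) = e' i ◃ f' i)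
    (he : ∀ i, e i ≠ 0) (he' : ∀ i, e' i ≠ 0) (ha : ∃ i k, a i k ≠ 0) :
    ∃ Φ : g →ₗ[ℂ] g', (∀ x y, Φ (x ◃ y) = Φ x ◃ Φ y) ∧ (∀ i, Φ (e i) = e' i) ∧
      ∀ i, Φ (f i) = f' i := by
  have hcp := hc.prod hc'
  -- The subalgebra generated by the diagonal pairs; it will be the graph of `Φ`.
  set T := IsChevalley.tri (fun i => ((e i, e' i) : g × g')) (fun i => (f i, f' i)) with hT
  have heT : ∀ i, (e i, e' i) ∈ T := fun i =>
    IsChevalley.e_mem_tri (e := fun i => ((e i, e' i) : g × g')) (f := fun i => (f i, f' i)) i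
  have hfT : ∀ i, (f i, f' i) ∈ T := fun i =>
    IsChevalley.f_mem_tri (e := fun i => ((e i, e' i) : g × g')) (f := fun i => (f i, f' i)) i
  have hcl : ∀ x ∈ T, ∀ y ∈ T, x ◃ y ∈ T := hcp.tri_closed
  have h1 : T.map (LinearMap.fst ℂ g g') = ⊤ := by
    refine hgen _ ?_ fun i => ⟨⟨_, heT i, rfl⟩, ⟨_, hfT i, rfl⟩⟩
    rintro _ ⟨x, hx, rfl⟩ _ ⟨y, hy, rfl⟩
    exact ⟨_, hcl x hx y hy, rfl⟩
  have h2 : T.map (LinearMap.snd ℂ g g') = ⊤ := by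
    refine hgen' _ ?_ fun i => ⟨⟨_, heT i, rfl⟩, ⟨_, hfT i, rfl⟩⟩
    rintro _ ⟨x, hx, rfl⟩ _ ⟨y, hy, rfl⟩
    exact ⟨_, hcl x hx y hy, rfl⟩
  -- The fibre of `T` over `0` is a graded ideal of `g'`, because `T` is a subalgebra projecting
  -- onto `g'`. Simplicity leaves one case to exclude, that the fibre is all of `g'`.
  have huniq : T.comap (LinearMap.inr ℂ g g') = ⊥ := by
    refine (hsim.2 _ ?_ ?_).resolve_right ?_
    · intro x y hy
      obtain ⟨z, hz, rfl⟩ := (h2 ▸ Submodule.mem_top : x ∈ T.map (LinearMap.snd ℂ g g'))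
      have := hcl z hz _ hy
      rw [prod_sbr] at this
      simpa using this
    · refine le_antisymm (fun y hy => ?_) (sup_le inf_le_left inf_le_left)
      obtain ⟨x₀, h₀, h₀T, x₁, h₁, h₁T, hx⟩ := hcp.tri_graded hy
      have hx1 : 0 = x₀.1 + x₁.1 := congrArg Prod.fst hx
      have hx2 : y = x₀.2 + x₁.2 := congrArg Prod.snd hx
      have hx0 : x₀.1 = 0 := by
        refine eq_zero_of_mem_parts h₀.1 ?_
        rw [eq_neg_of_add_eq_zero_left hx1.symm]
        exact neg_mem h₁.1
      have hx01 : x₁.1 = 0 := by rw [hx0, zero_add] at hx1; exact hx1.symm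
      rw [hx2]
      refine add_mem (Submodule.mem_sup_left ⟨?_, h₀.2⟩) (Submodule.mem_sup_right ⟨?_, h₁.2⟩)
      · have : (0, x₀.2) = x₀ := Prod.ext hx0.symm rfl
        simpa [this] using h₀T
      · have : (0, x₁.2) = x₁ := Prod.ext hx01.symm rfl
        simpa [this] using h₁T
    -- Otherwise `T` contains `(0, h' i)` with `a i k ≠ 0`. Projecting to the Cartan parts writes
    -- `0` and `h' i` as combinations of coroots with the same coefficients `s`. Acting on `e k`,
    -- the first gives `∑ s j * a j k = 0`; acting on `e' k`, the second then gives `a i k = 0`.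
    · intro htop
      obtain ⟨i, k, hik⟩ := ha
      have hmem : ((0, e' i ◃ f' i) : g × g') ∈ T :=
        (htop ▸ Submodule.mem_top : e' i ◃ f' i ∈ T.comap (LinearMap.inr ℂ g g'))
      obtain ⟨s, hs, hs'⟩ := tri_prod_proj hπe hπf hπh hπe' hπf' hπh' hmem
      simp only [map_zero] at hs
      rw [hπh'] at hs'
      have hsum : ∑ j, s j * a j k = 0 := by
        have := congrArg (fun z => z ◃ e k) hs
        simp only [map_zero, LinearMap.zero_apply, map_sum, map_smul, LinearMap.sum_apply,
          LinearMap.smul_apply, hc.h_e, smul_smul, ← Finset.sum_smul] at this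
        exact (smul_eq_zero.mp this.symm).resolve_right (he k)
      have := congrArg (fun z => z ◃ e' k) hs'
      simp only [map_sum, map_smul, LinearMap.sum_apply,
        LinearMap.smul_apply, hc'.h_e, smul_smul, ← Finset.sum_smul, hsum, zero_smul] at this
      exact (smul_eq_zero.mp this).elim hik (he' k)
  have hex : ∀ x : g, ∃ y : g', (x, y) ∈ T := by
    intro x
    obtain ⟨z, hz, rfl⟩ := (h1 ▸ Submodule.mem_top : x ∈ T.map (LinearMap.fst ℂ g g'))
    exact ⟨z.2, hz⟩
  have hun : ∀ {x y y'}, (x, y) ∈ T → (x, y') ∈ T → y = y' := by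
    intro x y y' h h'
    have : y - y' ∈ T.comap (LinearMap.inr ℂ g g') := by
      simpa using sub_mem h h'
    rw [huniq, Submodule.mem_bot] at this
    exact sub_eq_zero.mp this
  choose Φ hΦ using hex
  refine ⟨⟨⟨Φ, fun x y => ?_⟩, fun c x => ?_⟩, fun x y => ?_, fun i => ?_, fun i => ?_⟩
  · exact hun (hΦ _) (by simpa using add_mem (hΦ x) (hΦ y))
  · exact hun (hΦ _) (by simpa using T.smul_mem c (hΦ x))
  · exact hun (hΦ _) (hcl _ (hΦ x) _ (hΦ y))
  · exact hun (hΦ _) (heT i)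
  · exact hun (hΦ _) (hfT i)

theorem toConj_word {u : ι → g} {w : ConjSpace g} (hw : Word (fun i => toConj (u i)) w) :
    Word u (toConj.symm w) := by
  induction hw with
  | base i => exact Word.base i
  | step i _ ih => exact Word.step i ih

/-- Antilinear version of the isomorphism theorem for a real Cartan matrix. -/
theorem exists_antilinear_of_isChevalley [Fintype ι] {a : ι → ι → ℝ} {e' f' : ι → g}
    (hc : IsChevalley p (fun i j => (a i j : ℂ)) e f)
    (hc' : IsChevalley p (fun i j => (a i j : ℂ)) e' f')
    (hgen : Generates e f) (hgen' : Generates e' f') (hsim : IsSimple g)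
    {π : g →ₗ[ℂ] g}
    (hπe : ∀ w, Word e w → π w = 0) (hπf : ∀ w, Word f w → π w = 0)
    (hπh : ∀ i, π (e i ◃ f i) = e i ◃ f i)
    (hπe' : ∀ w, Word e' w → π w = 0) (hπf' : ∀ w, Word f' w → π w = 0)
    (hπh' : ∀ i, π (e' i ◃ f' i) = e' i ◃ f' i)
    (he : ∀ i, e i ≠ 0) (he' : ∀ i, e' i ≠ 0) (ha : ∃ i k, a i k ≠ 0) :
    ∃ Φ : g →ₛₗ[starRingEnd ℂ] g, (∀ x y, Φ (x ◃ y) = Φ x ◃ Φ y) ∧ (∀ i, Φ (e i) = e' i) ∧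
      ∀ i, Φ (f i) = f' i := by
  let π' : ConjSpace g →ₗ[ℂ] ConjSpace g :=
    { toFun := fun x => toConj (π (toConj.symm x))
      map_add' := fun x y => by simp
      map_smul' := fun c x => by simp [toConj_symm_smul, toConj_smul] }
  -- The reality of the matrix enters here: passing to the conjugate space conjugates its entries.
  have hcc : IsChevalley p (fun i j => (a i j : ℂ)) (fun i => toConj (e' i))
      (fun i => toConj (f' i)) :=
    { e_mem := hc'.e_mem
      f_mem := hc'.f_mem
      e_f_ne := hc'.e_f_ne
      h_e := fun i j => by
        simp only [conj_sbr, hc'.h_e, toConj_smul, Complex.conj_ofReal]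
      h_f := fun i j => by
        simp only [conj_sbr, hc'.h_f, map_neg, toConj_smul, Complex.conj_ofReal] }
  have hgc : Generates (fun i => toConj (e' i)) (fun i => toConj (f' i)) := by
    intro S hS hef
    let J : Submodule ℂ g :=
      { carrier := {x | toConj x ∈ S}
        add_mem' := fun hx hy => S.add_mem hx hy
        zero_mem' := S.zero_mem
        smul_mem' := fun c x hx => by
          simp only [Set.mem_ofPred_eq, toConj_smul]; exact S.smul_mem _ hx }
    have hJ : J = ⊤ := hgen' J (fun x hx y hy => hS _ hx _ hy) hef
    rw [eq_top_iff]
    intro x _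
    have : toConj.symm x ∈ J := by rw [hJ]; trivial
    exact this
  obtain ⟨Φ, h1, h2, h3⟩ := exists_hom_of_isChevalley hc hcc hgen hgc hsim.conj
    (π := π) (π' := π') hπe hπf hπh
    (fun w hw => by simp [π', hπe' _ (toConj_word hw)])
    (fun w hw => by simp [π', hπf' _ (toConj_word hw)])
    (fun i => by
      simp only [conj_sbr]
      change toConj (π (e' i ◃ f' i)) = _
      rw [hπh']) he
    (fun i h => he' i h) (by
      obtain ⟨i, k, hik⟩ := ha
      exact ⟨i, k, by exact_mod_cast hik⟩)
  refine ⟨⟨⟨fun x => toConj.symm (Φ x), fun x y => by simp⟩, fun c x => ?_⟩, fun x y => ?_,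
    fun i => ?_, fun i => ?_⟩
  · simp [toConj_symm_smul]
  · exact h1 x y
  · exact h2 i
  · exact h3 i

end Isomorphism

end LieSuperalgebra

/-! ### The grading of a simple system -/

namespace SimpleSystem

theorem single_comp {ι : Type*} [DecidableEq ι] (d : Equiv.Perm ι) (i : ι) :
    (Pi.single i (1 : ℤ) : ι → ℤ) ∘ d.symm = Pi.single (d i) 1 := by
  funext j
  simp [Pi.single_apply, Equiv.symm_apply_eq]

variable {ι : Type*} [Fintype ι] [DecidableEq ι] {D : SuperDynkin ι} {g : Type*}
  [AddCommGroup g] [Module ℂ g] [LieSuperalgebra ℂ g] {h : Submodule ℂ g}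
  (S : SimpleSystem D h)

/-- The linear map that multiplies the component of degree `a` by `χ a`. -/
def scale (χ : (ι → ℤ) → ℂ) : g →ₗ[ℂ] g :=
  (DirectSum.toModule ℂ (ι → ℤ) g fun a => χ a • (S.deg a).subtype) ∘ₗ
    (LinearEquiv.ofBijective (DirectSum.coeLinearMap S.deg) S.deg_internal).symm.toLinearMap

theorem scale_of_mem (χ : (ι → ℤ) → ℂ) {a : ι → ℤ} {x : g} (hx : x ∈ S.deg a) :
    S.scale χ x = χ a • x := by
  have h1 : (LinearEquiv.ofBijective (DirectSum.coeLinearMap S.deg) S.deg_internal).symm x =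
      DirectSum.lof ℂ (ι → ℤ) (fun a => S.deg a) a ⟨x, hx⟩ := by
    rw [LinearEquiv.symm_apply_eq]
    exact (DirectSum.coeLinearMap_lof S.deg a ⟨x, hx⟩).symm
  simp [scale, h1]

theorem homog_induction {P : g → Prop} (zero : P 0) (add : ∀ x y, P x → P y → P (x + y))
    (mem : ∀ a, ∀ x ∈ S.deg a, P x) (x : g) : P x := by
  have hx : x ∈ ⨆ a, S.deg a := by
    rw [S.deg_internal.submodule_iSup_eq_top]; trivial
  exact Submodule.iSup_induction S.deg (motive := P) hx mem zero add

/-- Projection to the component of degree `a`. -/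
def proj (a : ι → ℤ) : g →ₗ[ℂ] g := S.scale fun b => if b = a then 1 else 0

theorem proj_self {a : ι → ℤ} {x : g} (hx : x ∈ S.deg a) : S.proj a x = x := by
  simp [proj, S.scale_of_mem _ hx]

theorem proj_ne {a b : ι → ℤ} (hab : b ≠ a) {x : g} (hx : x ∈ S.deg b) : S.proj a x = 0 := by
  simp [proj, S.scale_of_mem _ hx, hab]

theorem proj_mem (a : ι → ℤ) (x : g) : S.proj a x ∈ S.deg a := by
  refine S.homog_induction (P := fun x => S.proj a x ∈ S.deg a) (by simp)
    (fun x y hx hy => by rw [map_add]; exact add_mem hx hy) (fun b x hx => ?_) x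
  by_cases hab : b = a
  · subst hab; rwa [S.proj_self hx]
  · rw [S.proj_ne hab hx]; exact zero_mem _

theorem eq_zero_of_proj {x : g} (hx : ∀ a, S.proj a x = 0) : x = 0 := by
  classical
  have key : ∀ x : g, ∃ F : Finset (ι → ℤ), x = ∑ a ∈ F, S.proj a x ∧
      ∀ a ∉ F, S.proj a x = 0 := by
    refine S.homog_induction ⟨∅, by simp⟩ ?_ ?_
    · rintro x y ⟨F, hF, hF'⟩ ⟨G, hG, hG'⟩
      refine ⟨F ∪ G, ?_, ?_⟩
      · simp only [map_add, Finset.sum_add_distrib]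
        rw [← Finset.sum_subset (Finset.subset_union_left) (fun a _ ha => hF' a ha),
          ← Finset.sum_subset (Finset.subset_union_right) (fun a _ ha => hG' a ha), ← hF, ← hG]
      · intro a ha
        rw [Finset.mem_union, not_or] at ha
        rw [map_add, hF' a ha.1, hG' a ha.2, add_zero]
    · intro a x hx
      refine ⟨{a}, by simp [S.proj_self hx], fun b hb => S.proj_ne ?_ hx⟩
      simpa [eq_comm] using hb
  obtain ⟨F, hF, -⟩ := key x
  rw [hF]
  exact Finset.sum_eq_zero fun a _ => hx a

theorem deg_disjoint {a b : ι → ℤ} (hab : a ≠ b) {x : g} (ha : x ∈ S.deg a)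
    (hb : x ∈ S.deg b) : x = 0 := by
  rw [← S.proj_self ha, S.proj_ne hab.symm hb]

/-- A property of homogeneous elements that holds for the generators and is stable under the
bracket holds for all homogeneous elements. -/
theorem deg_induction {P : (ι → ℤ) → g → Prop} (zero : ∀ a, P a 0)
    (add : ∀ a x y, P a x → P a y → P a (x + y)) (smul : ∀ a (c : ℂ) x, P a x → P a (c • x))
    (he : ∀ i, P (Pi.single i 1) (S.e i)) (hf : ∀ i, P (-Pi.single i 1) (S.f i))
    (hbr : ∀ a b x y, x ∈ S.deg a → y ∈ S.deg b → P a x → P b y → P (a + b) (x ◃ y))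
    {a : ι → ℤ} {x : g} (hx : x ∈ S.deg a) : P a x := by
  -- The sum of the spaces `N a` of good homogeneous elements is a subalgebra containing the
  -- generators, hence everything; projecting to degree `a` then shows that `N a` is all of `deg a`.
  let N : (ι → ℤ) → Submodule ℂ g := fun a =>
    { carrier := {x | x ∈ S.deg a ∧ P a x}
      add_mem' := fun hx hy => ⟨add_mem hx.1 hy.1, add _ _ _ hx.2 hy.2⟩
      zero_mem' := ⟨zero_mem _, zero a⟩
      smul_mem' := fun c x hx => ⟨Submodule.smul_mem _ c hx.1, smul _ c x hx.2⟩ }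
  have htop : ⨆ a, N a = ⊤ := by
    refine S.generates _ ?_ fun i => ⟨Submodule.mem_iSup_of_mem _ ⟨S.deg_e i, he i⟩,
      Submodule.mem_iSup_of_mem _ ⟨S.deg_f i, hf i⟩⟩
    intro x hx y hy
    induction hx using Submodule.iSup_induction' with
    | zero => simp
    | add x x' _ _ ih ih' => rw [map_add, LinearMap.add_apply]; exact add_mem ih ih'
    | mem a x hx =>
      induction hy using Submodule.iSup_induction' with
      | zero => simp
      | add y y' _ _ ih ih' => rw [map_add]; exact add_mem ih ih'
      | mem b y hy =>
        exact Submodule.mem_iSup_of_mem (a + b)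
          ⟨S.deg_sbr a b x hx.1 y hy.1, hbr a b x y hx.1 hy.1 hx.2 hy.2⟩
  have hproj : ∀ y ∈ ⨆ a, N a, S.proj a y ∈ N a := by
    intro y hy
    induction hy using Submodule.iSup_induction' with
    | zero => simp
    | add y y' _ _ ih ih' => rw [map_add]; exact add_mem ih ih'
    | mem b y hy =>
      by_cases hab : b = a
      · subst hab; rwa [S.proj_self hy.1]
      · rw [S.proj_ne hab hy.1]; exact zero_mem _
  have := hproj x (by rw [htop]; trivial)
  rw [S.proj_self hx] at this
  exact this.2

/-! ### Parity, weights, and the triangular decomposition -/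

/-- The parity of a degree. -/
def _root_.SuperDynkin.degParity (D : SuperDynkin ι) (a : ι → ℤ) : ZMod 2 :=
  ∑ i, (a i : ZMod 2) * D.parity i

/-- The grading of a simple system carries no parity condition, but the generators force one: the
claim holds for them and is additive under brackets. -/
theorem deg_le_part {a : ι → ℤ} {x : g} (hx : x ∈ S.deg a) :
    x ∈ part (K := ℂ) (V := g) (D.degParity a) := by
  refine S.deg_induction (P := fun a x => x ∈ part (K := ℂ) (V := g) (D.degParity a))
    (fun a => zero_mem _) (fun a x y hx hy => add_mem hx hy)
    (fun a c x hx => Submodule.smul_mem _ c hx) (fun i => ?_) (fun i => ?_)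
    (fun a b x y _ _ hx hy => ?_) hx
  · have : D.degParity (Pi.single i 1) = D.parity i := by
      simp [SuperDynkin.degParity, Pi.single_apply]
    rw [this]; exact S.e_mem i
  · have : D.degParity (-Pi.single i 1) = D.parity i := by
      simp [SuperDynkin.degParity, Pi.single_apply]
    rw [this]; exact S.f_mem i
  · have : D.degParity (a + b) = D.degParity a + D.degParity b := by
      simp [SuperDynkin.degParity, add_mul, Finset.sum_add_distrib]
    rw [this]; exact sbr_mem hx hy

theorem even_of_mem (S : SimpleSystem D h) {H : g} (hH : H ∈ h) : H ∈ part (K := ℂ) (V := g) 0 := by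
  rw [← S.deg_zero] at hH
  have := S.deg_le_part hH
  simpa [SuperDynkin.degParity] using this

theorem part_induction {q : ZMod 2} {P : g → Prop} (zero : P 0)
    (add : ∀ x y, P x → P y → P (x + y))
    (mem : ∀ a, ∀ x ∈ S.deg a, x ∈ part (K := ℂ) (V := g) q → P x)
    {x : g} (hx : x ∈ part (K := ℂ) (V := g) q) : P x := by
  have key : ∀ x : g, ∃ y z : g, x = y + z ∧ P y ∧ y ∈ part (K := ℂ) (V := g) q ∧
      z ∈ part (K := ℂ) (V := g) (q + 1) := by
    refine S.homog_induction ⟨0, 0, by simp, zero, zero_mem _, zero_mem _⟩ ?_ ?_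
    · rintro _ _ ⟨y, z, rfl, h1, h2, h3⟩ ⟨y', z', rfl, h1', h2', h3'⟩
      exact ⟨y + y', z + z', by abel, add _ _ h1 h1', add_mem h2 h2', add_mem h3 h3'⟩
    · intro a x hx
      by_cases hq : D.degParity a = q
      · exact ⟨x, 0, by simp, mem a x hx (hq ▸ S.deg_le_part hx), hq ▸ S.deg_le_part hx,
          zero_mem _⟩
      · have hq' : D.degParity a = q + 1 := by
          generalize D.degParity a = t at hq
          clear * - hq
          revert t q; decide
        exact ⟨0, x, by simp, zero, zero_mem _, hq' ▸ S.deg_le_part hx⟩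
  obtain ⟨y, z, hxyz, h1, h2, h3⟩ := key x
  have hz : z = 0 := by
    refine eq_zero_of_mem_part_ne (i := q) (j := q + 1) (by clear * -; revert q; decide) ?_ h3
    rw [show z = x - y by rw [hxyz]; abel]
    exact sub_mem hx h2
  rw [hxyz, hz, add_zero]
  exact h1

theorem proj_mem_part {q : ZMod 2} {x : g} (hx : x ∈ part (K := ℂ) (V := g) q) (a : ι → ℤ) :
    S.proj a x ∈ part (K := ℂ) (V := g) q := by
  refine S.part_induction (P := fun x => S.proj a x ∈ part (K := ℂ) (V := g) q) (by simp)
    (fun x y hx hy => by rw [map_add]; exact add_mem hx hy) (fun b x hb hx => ?_) hx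
  by_cases hab : b = a
  · subst hab; rwa [S.proj_self hb]
  · rw [S.proj_ne hab hb]; exact zero_mem _

/-- A linear extension of the simple root `α i` to the whole superalgebra. -/
def rt (i : ι) : g →ₗ[ℂ] ℂ := (LinearMap.exists_extend (S.root i)).choose

theorem rt_apply (i : ι) (H : h) : S.rt i H = S.root i H :=
  LinearMap.congr_fun (LinearMap.exists_extend (S.root i)).choose_spec H

/-- The weight `∑ a i • α i` of the degree `a`. -/
def wt (a : ι → ℤ) : g →ₗ[ℂ] ℂ := ∑ i, (a i : ℂ) • S.rt i

theorem wt_apply (a : ι → ℤ) (H : g) : S.wt a H = ∑ i, (a i : ℂ) * S.rt i H := by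
  simp [wt, LinearMap.sum_apply]

theorem wt_add (a b : ι → ℤ) : S.wt (a + b) = S.wt a + S.wt b := by
  simp [wt, add_smul, Finset.sum_add_distrib]

theorem wt_neg (a : ι → ℤ) : S.wt (-a) = -S.wt a := by
  simp [wt]

theorem wt_zero : S.wt 0 = 0 := by simp [wt]

theorem wt_single (i : ι) : S.wt (Pi.single i 1) = S.rt i := by
  simp [wt, Pi.single_apply, ite_smul]

theorem sbr_of_mem_deg {H : g} (hH : H ∈ h) {a : ι → ℤ} {x : g} (hx : x ∈ S.deg a) :
    H ◃ x = S.wt a H • x := by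
  refine S.deg_induction (P := fun a x => H ◃ x = S.wt a H • x) (by simp)
    (fun a x y hx hy => by rw [map_add, hx, hy, smul_add])
    (fun a c x hx => by rw [map_smul, hx, smul_comm]) (fun i => ?_) (fun i => ?_)
    (fun a b x y _ _ hx hy => ?_) hx
  · rw [wt_single, S.rt_apply i ⟨H, hH⟩]; exact S.weight_e ⟨H, hH⟩ i
  · rw [wt_neg, wt_single, LinearMap.neg_apply, S.rt_apply i ⟨H, hH⟩, neg_smul]
    exact S.weight_f ⟨H, hH⟩ i
  · rw [sbr_even_jacobi (S.even_of_mem hH), hx, hy, map_smul, map_smul, LinearMap.smul_apply,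
      wt_add, LinearMap.add_apply, add_smul]

theorem sbr_cartan (S : SimpleSystem D h) {H H' : g} (hH : H ∈ h) (hH' : H' ∈ h) : H ◃ H' = 0 := by
  rw [S.sbr_of_mem_deg hH (S.deg_zero ▸ hH'), wt_zero, LinearMap.zero_apply, zero_smul]

theorem isChevalley : IsChevalley D.parity (fun i j => (D.cartan i j : ℂ)) S.e S.f where
  e_mem := S.e_mem
  f_mem := S.f_mem
  e_f_ne := S.e_f_ne
  h_e i j := by rw [S.e_f, S.weight_e, S.root_coroot]
  h_f i j := by rw [S.e_f, S.weight_f, S.root_coroot]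

theorem word_deg {C : (ι → ℤ) → Prop} (hC : ∀ a b, C a → C b → C (a + b)) {u : ι → g}
    (hu : ∀ i, ∃ b, C b ∧ u i ∈ S.deg b) {w : g} (hw : Word u w) : ∃ b, C b ∧ w ∈ S.deg b := by
  induction hw with
  | base i => exact hu i
  | step i _ ih =>
    obtain ⟨b, hb, hw⟩ := ih
    obtain ⟨c, hc, hi⟩ := hu i
    exact ⟨c + b, hC c b hc hb, S.deg_sbr _ _ _ hi _ hw⟩

theorem e_word_deg {w : g} (hw : Word S.e w) : ∃ b, 0 < b ∧ w ∈ S.deg b :=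
  S.word_deg (C := fun b => 0 < b) (fun _ _ ha hb => add_pos ha hb)
    (fun i => ⟨_, by simp, S.deg_e i⟩) hw

theorem f_word_deg {w : g} (hw : Word S.f w) : ∃ b, b < 0 ∧ w ∈ S.deg b :=
  S.word_deg (C := fun b => b < 0) (fun _ _ ha hb => add_neg ha hb)
    (fun i => ⟨_, by simp, S.deg_f i⟩) hw

theorem e_f_mem_deg (i : ι) : S.e i ◃ S.f i ∈ S.deg 0 := by
  rw [S.deg_zero, S.e_f]; exact (S.coroot i).2

theorem tri_eq_top : IsChevalley.tri S.e S.f = ⊤ :=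
  S.generates _ S.isChevalley.tri_closed
    fun i => ⟨IsChevalley.e_mem_tri i, IsChevalley.f_mem_tri i⟩

/-- Degrees that occur are nonnegative or nonpositive. -/
theorem nonneg_or_nonpos {a : ι → ℤ} {x : g} (hx : x ∈ S.deg a) (hx0 : x ≠ 0) :
    0 ≤ a ∨ a ≤ 0 := by
  by_contra hcon
  rw [not_or] at hcon
  have key : IsChevalley.tri S.e S.f ≤ LinearMap.ker (S.proj a) := by
    refine sup_le (sup_le (Submodule.span_le.mpr ?_) (Submodule.span_le.mpr ?_))
      (Submodule.span_le.mpr ?_)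
    · intro w hw
      obtain ⟨b, hb, hwb⟩ := S.e_word_deg hw
      exact S.proj_ne (fun hba : b = a => hcon.1 (hba ▸ hb.le)) hwb
    · rintro _ ⟨i, rfl⟩
      exact S.proj_ne (fun hba : 0 = a => hcon.1 (hba ▸ le_rfl)) (S.e_f_mem_deg i)
    · intro w hw
      obtain ⟨b, hb, hwb⟩ := S.f_word_deg hw
      exact S.proj_ne (fun hba : b = a => hcon.2 (hba ▸ hb.le)) hwb
  have := key (S.tri_eq_top ▸ Submodule.mem_top : x ∈ _)
  rw [LinearMap.mem_ker, S.proj_self hx] at this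
  exact hx0 this

theorem mem_deg_zero (S : SimpleSystem D h) {H : g} (hH : H ∈ h) : H ∈ S.deg 0 := by
  rwa [S.deg_zero]

/-- The Cartan subalgebra is spanned by the simple coroots. -/
theorem cartan_le : h ≤ IsChevalley.corootSpan S.e S.f := by
  intro H hH
  have key : IsChevalley.tri S.e S.f ≤ (IsChevalley.corootSpan S.e S.f).comap (S.proj 0) := by
    refine sup_le (sup_le (Submodule.span_le.mpr ?_) (Submodule.span_le.mpr ?_))
      (Submodule.span_le.mpr ?_)
    · intro w hw
      obtain ⟨b, hb, hwb⟩ := S.e_word_deg hw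
      simp only [Submodule.comap_coe, Set.mem_preimage, SetLike.mem_coe, S.proj_ne hb.ne' hwb]
      exact zero_mem _
    · rintro _ ⟨i, rfl⟩
      simp only [Submodule.comap_coe, Set.mem_preimage, SetLike.mem_coe,
        S.proj_self (S.e_f_mem_deg i)]
      exact Submodule.subset_span ⟨i, rfl⟩
    · intro w hw
      obtain ⟨b, hb, hwb⟩ := S.f_word_deg hw
      simp only [Submodule.comap_coe, Set.mem_preimage, SetLike.mem_coe, S.proj_ne hb.ne hwb]
      exact zero_mem _
  have := key (S.tri_eq_top ▸ Submodule.mem_top : H ∈ _)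
  simpa [S.proj_self (S.mem_deg_zero hH)] using this

/-- An element of `h` on which all occurring weights vanish is central, and a simple superalgebra
has no nonzero even central element. -/
theorem eq_zero_of_wt (hsim : IsSimple g) {H : g} (hH : H ∈ h)
    (hwt : ∀ a, ∀ x ∈ S.deg a, x ≠ 0 → S.wt a H = 0) : H = 0 := by
  refine hsim.eq_zero_of_central (S.even_of_mem hH) fun y => ?_
  rw [sbr_even_skew (S.even_of_mem hH), neg_eq_zero]
  refine S.homog_induction (P := fun y => H ◃ y = 0) (by simp)
    (fun x y hx hy => by rw [map_add, hx, hy, add_zero]) (fun a x hx => ?_) y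
  by_cases hx0 : x = 0
  · simp [hx0]
  · rw [S.sbr_of_mem_deg hH hx, hwt a x hx hx0, zero_smul]

theorem eq_zero_of_rt (hsim : IsSimple g) {H : g} (hH : H ∈ h) (hrt : ∀ i, S.rt i H = 0) :
    H = 0 :=
  S.eq_zero_of_wt hsim hH fun a _ _ _ => by simp [wt_apply, hrt]

theorem rt_coroot (i j : ι) : S.rt j (S.e i ◃ S.f i) = D.cartan i j := by
  rw [S.e_f, S.rt_apply, S.root_coroot]

/-- The subspace `h` is its own centralizer in the even part. -/
def SelfCentralizing (h : Submodule ℂ g) : Prop :=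
  ∀ x ∈ part (K := ℂ) (V := g) 0, (∀ H ∈ h, H ◃ x = 0) → x ∈ h

/-- If the matrix vanished, `h` would be central, hence zero. Being self-centralizing it would then
be the whole even part, and brackets of odd elements, which are even, would vanish too. -/
theorem exists_cartan_ne (S : SimpleSystem D h) (hsim : IsSimple g) (hcart : SelfCentralizing h) :
    ∃ i k, D.cartan i k ≠ 0 := by
  by_contra hcon
  push Not at hcon
  have hrt : ∀ H ∈ h, H = 0 := by
    intro H hH
    refine S.eq_zero_of_rt hsim hH fun k => ?_
    have : IsChevalley.corootSpan S.e S.f ≤ LinearMap.ker (S.rt k) := by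
      refine Submodule.span_le.mpr ?_
      rintro _ ⟨i, rfl⟩
      simp [S.rt_coroot, hcon]
    exact this (S.cartan_le hH)
  have h0 : ∀ x ∈ part (K := ℂ) (V := g) 0, x = 0 := fun x hx =>
    hrt x (hcart x hx fun H hH => by rw [hrt H hH, map_zero, LinearMap.zero_apply])
  obtain ⟨⟨x, y, hxy⟩, -⟩ := hsim
  obtain ⟨x₀, hx₀, x₁, hx₁, rfl⟩ := exists_eq_add_parts x
  obtain ⟨y₀, hy₀, y₁, hy₁, rfl⟩ := exists_eq_add_parts y
  refine hxy ?_
  rw [h0 x₀ hx₀, h0 y₀ hy₀, zero_add, zero_add]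
  exact h0 _ (part_add_self hx₁ hy₁)

/-- An even element of nonzero degree has nonzero weight. -/
theorem wt_ne_zero (hcart : SelfCentralizing h) {a : ι → ℤ} (ha : a ≠ 0) {x : g}
    (hx : x ∈ S.deg a) (hx0 : x ∈ part (K := ℂ) (V := g) 0) (hne : x ≠ 0) :
    ∃ H ∈ h, S.wt a H ≠ 0 := by
  by_contra hcon
  push Not at hcon
  have : x ∈ h := hcart x hx0 fun H hH => by rw [S.sbr_of_mem_deg hH hx, hcon H hH, zero_smul]
  exact hne (S.deg_disjoint ha hx (S.mem_deg_zero this))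

/-! ### Antilinear automorphisms -/

/-- The proposed images are again Chevalley generators. Their bracket is `-(r i)⁻¹` times the coroot
of `d i`, by the normalization `hcc`; the factor `(r i)⁻¹` undoes the row scaling, and the sign
accounts for the exchange of the `e` and the `f`. -/
theorem exists_antilinear (hsim : IsSimple g) (hcart : SelfCentralizing h) (d : Equiv.Perm ι)
    (hp : ∀ i, D.parity (d i) = D.parity i) (r : ι → ℝ)
    (hr : ∀ i j, D.cartan (d i) (d j) = r i * D.cartan i j) (c c' : ι → ℂ)
    (hcc : ∀ i, c i * c' i * superSign (D.parity i) (D.parity i) * r i = 1) :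
    ∃ Φ : g →ₛₗ[starRingEnd ℂ] g, (∀ x y, Φ (x ◃ y) = Φ x ◃ Φ y) ∧
      (∀ i, Φ (S.e i) = c i • S.f (d i)) ∧ ∀ i, Φ (S.f i) = c' i • S.e (d i) := by
  have hc0 : ∀ i, c i ≠ 0 := fun i h0 => by simpa [h0] using hcc i
  have hc0' : ∀ i, c' i ≠ 0 := fun i h0 => by simpa [h0] using hcc i
  have hh : ∀ i, (c i • S.f (d i)) ◃ (c' i • S.e (d i)) =
      -((c i * c' i * superSign (D.parity i) (D.parity i)) • (S.e (d i) ◃ S.f (d i))) := by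
    intro i
    rw [map_smul, map_smul, LinearMap.smul_apply, S.isChevalley.f_e, hp, smul_neg, smul_neg,
      ← Int.cast_smul_eq_zsmul ℂ, smul_smul, smul_smul]
    congr 2; ring
  have hch : IsChevalley D.parity (fun i j => (D.cartan i j : ℂ)) (fun i => c i • S.f (d i))
      (fun i => c' i • S.e (d i)) :=
    { e_mem := fun i => by simpa [hp] using Submodule.smul_mem _ (c i) (S.f_mem (d i))
      f_mem := fun i => by simpa [hp] using Submodule.smul_mem _ (c' i) (S.e_mem (d i))
      e_f_ne := fun i j hij => by
        rw [map_smul, map_smul, LinearMap.smul_apply,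
          S.isChevalley.f_e_ne (fun hd => hij (d.injective hd)), smul_zero, smul_zero]
      h_e := fun i j => by
        rw [hh, map_neg, LinearMap.neg_apply, map_smul (sbr (K := ℂ) (V := g)), LinearMap.smul_apply,
          map_smul,
          S.isChevalley.h_f, hr, smul_neg, smul_neg, neg_neg, smul_smul, smul_smul, smul_smul]
        congr 1
        push_cast
        linear_combination (c j * D.cartan i j) * hcc i
      h_f := fun i j => by
        rw [hh, map_neg, LinearMap.neg_apply, map_smul (sbr (K := ℂ) (V := g)), LinearMap.smul_apply,
          map_smul,
          S.isChevalley.h_e, hr, smul_smul, smul_smul, smul_smul]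
        congr 2
        push_cast
        linear_combination (c' j * D.cartan i j) * hcc i }
  have hgen' : Generates (fun i => c i • S.f (d i)) (fun i => c' i • S.e (d i)) := by
    intro T hT hef
    refine S.generates T hT fun i => ?_
    obtain ⟨j, rfl⟩ := d.surjective i
    exact ⟨(Submodule.smul_mem_iff _ (hc0' j)).mp (hef j).2,
      (Submodule.smul_mem_iff _ (hc0 j)).mp (hef j).1⟩
  refine exists_antilinear_of_isChevalley (π := S.proj 0) S.isChevalley hch S.generates hgen'
    hsim (fun w hw => ?_) (fun w hw => ?_) (fun i => S.proj_self (S.e_f_mem_deg i))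
    (fun w hw => ?_) (fun w hw => ?_) (fun i => ?_) S.e_ne
    (fun i => smul_ne_zero (hc0 i) (S.f_ne _)) (S.exists_cartan_ne hsim hcart)
  · obtain ⟨b, hb, hwb⟩ := S.e_word_deg hw
    exact S.proj_ne hb.ne' hwb
  · obtain ⟨b, hb, hwb⟩ := S.f_word_deg hw
    exact S.proj_ne hb.ne hwb
  · obtain ⟨b, hb, hwb⟩ := S.word_deg (C := fun b => b < 0) (fun _ _ ha hb => add_neg ha hb)
      (fun i => ⟨_, by simp, Submodule.smul_mem _ (c i) (S.deg_f (d i))⟩) hw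
    exact S.proj_ne (ne_of_lt hb) hwb
  · obtain ⟨b, hb, hwb⟩ := S.word_deg (C := fun b => 0 < b) (fun _ _ ha hb => add_pos ha hb)
      (fun i => ⟨_, by simp, Submodule.smul_mem _ (c' i) (S.deg_e (d i))⟩) hw
    exact S.proj_ne (ne_of_gt hb) hwb
  · rw [hh]
    exact S.proj_self (neg_mem (Submodule.smul_mem _ _ (S.e_f_mem_deg (d i))))

/-- An antilinear automorphism that maps `e i` to a nonzero multiple of `f (d i)` and `f i` to a
nonzero multiple of `e (d i)`. -/
structure Flips (S : SimpleSystem D h) (d : Equiv.Perm ι) (c c' : ι → ℂ)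
    (Φ : g →ₛₗ[starRingEnd ℂ] g) : Prop where
  map_sbr : ∀ x y, Φ (x ◃ y) = Φ x ◃ Φ y
  map_e : ∀ i, Φ (S.e i) = c i • S.f (d i)
  map_f : ∀ i, Φ (S.f i) = c' i • S.e (d i)
  ne : ∀ i, c i ≠ 0
  parity : ∀ i, D.parity (d i) = D.parity i

namespace Flips

variable {S} {d : Equiv.Perm ι} {c c' : ι → ℂ} {Φ : g →ₛₗ[starRingEnd ℂ] g}

theorem map_deg (hΦ : S.Flips d c c' Φ) {a : ι → ℤ} {x : g} (hx : x ∈ S.deg a) :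
    Φ x ∈ S.deg (-(a ∘ d.symm)) := by
  refine S.deg_induction (P := fun a x => Φ x ∈ S.deg (-(a ∘ d.symm))) (by simp)
    (fun a x y hx hy => by rw [map_add]; exact add_mem hx hy)
    (fun a c x hx => by rw [map_smulₛₗ]; exact Submodule.smul_mem _ _ hx) (fun i => ?_)
    (fun i => ?_) (fun a b x y _ _ hx hy => ?_) hx
  · rw [hΦ.map_e, single_comp]; exact Submodule.smul_mem _ _ (S.deg_f _)
  · rw [hΦ.map_f, Pi.neg_comp, neg_neg, single_comp]
    exact Submodule.smul_mem _ _ (S.deg_e _)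
  · rw [hΦ.map_sbr]
    have := S.deg_sbr _ _ _ hx _ hy
    rwa [← neg_add] at this

theorem map_cartan (hΦ : S.Flips d c c' Φ) {H : g} (hH : H ∈ h) : Φ H ∈ h := by
  rw [← S.deg_zero] at hH ⊢
  simpa using hΦ.map_deg hH

theorem degParity_map (hΦ : S.Flips d c c' Φ) (a : ι → ℤ) :
    D.degParity (-(a ∘ d.symm)) = D.degParity a := by
  simp only [SuperDynkin.degParity, Pi.neg_apply, Function.comp_apply, Int.cast_neg,
    CharTwo.neg_eq]
  rw [← Equiv.sum_comp d]
  simp [hΦ.parity]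

theorem map_part (hΦ : S.Flips d c c' Φ) {q : ZMod 2} {x : g}
    (hx : x ∈ part (K := ℂ) (V := g) q) : Φ x ∈ part (K := ℂ) (V := g) q := by
  refine S.part_induction (P := fun x => Φ x ∈ part (K := ℂ) (V := g) q) (by simp)
    (fun x y hx hy => by rw [map_add]; exact add_mem hx hy) (fun a x ha hx => ?_) hx
  by_cases h0 : x = 0
  · simp [h0]
  · have : D.degParity a = q := by
      by_contra hne
      exact h0 (eq_zero_of_mem_part_ne hne (S.deg_le_part ha) hx)
    rw [← this, ← hΦ.degParity_map]
    exact S.deg_le_part (hΦ.map_deg ha)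

/-- Apply `Φ` to `[H, e i] = αᵢ(H) e i`: antilinearity conjugates the scalar, and the weight of `f
(d i)` supplies the sign. -/
theorem rt_map (hΦ : S.Flips d c c' Φ) {H : g} (hH : H ∈ h) (i : ι) :
    S.rt (d i) (Φ H) = -starRingEnd ℂ (S.rt i H) := by
  have h1 := congrArg Φ (S.sbr_of_mem_deg hH (S.deg_e i))
  rw [hΦ.map_sbr, map_smulₛₗ, hΦ.map_e, map_smul, S.sbr_of_mem_deg (hΦ.map_cartan hH) (S.deg_f _),
    wt_neg, wt_single, wt_single, smul_comm, LinearMap.neg_apply] at h1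
  rw [← sub_eq_zero, ← sub_smul] at h1
  have h3 := (smul_eq_zero.mp h1).resolve_right (smul_ne_zero (hΦ.ne i) (S.f_ne _))
  linear_combination -h3

theorem wt_map (hΦ : S.Flips d c c' Φ) {H : g} (hH : H ∈ h) (a : ι → ℤ) :
    S.wt (a ∘ d.symm) (Φ H) = -starRingEnd ℂ (S.wt a H) := by
  rw [wt_apply, wt_apply, ← Equiv.sum_comp d, map_sum, ← Finset.sum_neg_distrib]
  refine Finset.sum_congr rfl fun i _ => ?_
  simp [hΦ.rt_map hH]

end Flips

end SimpleSystem

/-! ### Strings for operators of `sl₂` or Heisenberg type -/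

/-- The chain through `v` is stable because `v` is an eigenvector of both `h` and `f ∘ e`. If `e^p
v` and `f^q v` are the last nonzero terms, the two ends of the chain give two linear equations for
`c` and `μ`, which are solved here. The case `κ = 0` (Heisenberg) is allowed and forces `μ = 0`. -/
theorem chain_eq {V : Type*} [AddCommGroup V] [Module ℂ V] {e f h : V →ₗ[ℂ] V} {κ μ c : ℂ}
    (hef : ∀ x, e (f x) = f (e x) + h x) (he : ∀ x, h (e x) = e (h x) + κ • e x)
    (hf : ∀ x, h (f x) = f (h x) - κ • f x) {v : V} (hv : v ≠ 0) (hhv : h v = μ • v)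
    (hfev : f (e v) = c • v) (hE : ∃ n, (e ^ n) v = 0) (hF : ∃ n, (f ^ n) v = 0) :
    ∃ p q : ℕ, μ = κ / 2 * (q - p) ∧ c = κ / 2 * (p * (q + 1)) ∧ (p = 0 ↔ e v = 0) := by
  have hhe : ∀ k : ℕ, h ((e ^ k) v) = (μ + k * κ) • (e ^ k) v := by
    intro k
    induction k with
    | zero => simp [hhv]
    | succ k ih =>
      rw [pow_succ', Module.End.mul_apply, he, ih, map_smul, ← add_smul]
      push_cast; congr 1; ring
  have hhf : ∀ k : ℕ, h ((f ^ k) v) = (μ - k * κ) • (f ^ k) v := by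
    intro k
    induction k with
    | zero => simp [hhv]
    | succ k ih =>
      rw [pow_succ', Module.End.mul_apply, hf, ih, map_smul, ← sub_smul]
      push_cast; congr 1; ring
  have hfe : ∀ k : ℕ, f ((e ^ (k + 1)) v) =
      (c - k * μ - κ * (k * (k + 1)) / 2) • (e ^ k) v := by
    intro k
    induction k with
    | zero => simp [hfev]
    | succ k ih =>
      have h1 := hef ((e ^ (k + 1)) v)
      rw [ih, map_smul, hhe, ← Module.End.mul_apply (f := e) (g := e ^ k), ← pow_succ',
        ← Module.End.mul_apply (f := e) (g := e ^ (k + 1)), ← pow_succ'] at h1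
      rw [← sub_eq_iff_eq_add, ← sub_smul] at h1
      rw [← h1]
      push_cast; congr 1; ring
  have hef' : ∀ k : ℕ, e ((f ^ (k + 1)) v) =
      (c + (k + 1) * μ - κ * (k * (k + 1)) / 2) • (f ^ k) v := by
    intro k
    induction k with
    | zero => simp [hef, hfev, hhv, add_smul]
    | succ k ih =>
      have h1 := hef ((f ^ (k + 1)) v)
      rw [ih, map_smul, hhf, ← Module.End.mul_apply (f := f), ← pow_succ',
        ← Module.End.mul_apply (f := f), ← pow_succ', ← add_smul] at h1
      rw [h1]
      push_cast; congr 1; ring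
  classical
  obtain ⟨p, hp, hp'⟩ : ∃ p, (e ^ (p + 1)) v = 0 ∧ (e ^ p) v ≠ 0 := by
    have h0 : Nat.find hE ≠ 0 := fun h0 => hv (by simpa [h0] using Nat.find_spec hE)
    obtain ⟨p, hp⟩ := Nat.exists_eq_succ_of_ne_zero h0
    exact ⟨p, by simpa [hp] using Nat.find_spec hE, Nat.find_min hE (by omega)⟩
  obtain ⟨q, hq, hq'⟩ : ∃ q, (f ^ (q + 1)) v = 0 ∧ (f ^ q) v ≠ 0 := by
    have h0 : Nat.find hF ≠ 0 := fun h0 => hv (by simpa [h0] using Nat.find_spec hF)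
    obtain ⟨q, hq⟩ := Nat.exists_eq_succ_of_ne_zero h0
    exact ⟨q, by simpa [hq] using Nat.find_spec hF, Nat.find_min hF (by omega)⟩
  have h1 : c - p * μ - κ * (p * (p + 1)) / 2 = 0 := by
    have := hfe p
    rw [hp, map_zero] at this
    exact (smul_eq_zero.mp this.symm).resolve_right hp'
  have h2 : c + (q + 1) * μ - κ * (q * (q + 1)) / 2 = 0 := by
    have := hef' q
    rw [hq, map_zero] at this
    exact (smul_eq_zero.mp this.symm).resolve_right hq'
  have hpq : (p + q + 1 : ℂ) ≠ 0 := by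
    exact_mod_cast Nat.succ_ne_zero (p + q)
  have hμ : μ = κ / 2 * (q - p) := by
    apply mul_left_cancel₀ hpq
    linear_combination h2 - h1
  refine ⟨p, q, hμ, ?_, ?_, ?_⟩
  · linear_combination h1 + (p : ℂ) * hμ
  · rintro rfl; simpa using hp
  · intro h0
    by_contra hp0
    obtain ⟨k, rfl⟩ := Nat.exists_eq_succ_of_ne_zero hp0
    exact hp' (by rw [Nat.succ_eq_add_one, pow_succ, Module.End.mul_apply, h0, map_zero])

/-! ### Finiteness of the grading and ad-nilpotency. -/

namespace SimpleSystem

variable {ι : Type*} [Fintype ι] [DecidableEq ι] {D : SuperDynkin ι} {g : Type*}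
  [AddCommGroup g] [Module ℂ g] [LieSuperalgebra ℂ g] {h : Submodule ℂ g}
  (S : SimpleSystem D h)

theorem finite_deg [FiniteDimensional ℂ g] : {a | S.deg a ≠ ⊥}.Finite :=
  WellFoundedGT.finite_ne_bot_of_iSupIndep S.deg_internal.submodule_iSupIndep

theorem pow_sbr_mem {a b : ι → ℤ} {x v : g} (hx : x ∈ S.deg a) (hv : v ∈ S.deg b) (n : ℕ) :
    ((sbr (K := ℂ) x) ^ n) v ∈ S.deg (b + n • a) := by
  induction n with
  | zero => simpa using hv
  | succ n ih =>
    rw [pow_succ', Module.End.mul_apply]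
    have := S.deg_sbr _ _ _ hx _ ih
    rwa [show a + (b + n • a) = b + (n + 1) • a by rw [succ_nsmul]; abel] at this

/-- The degrees `b + n • a` are distinct, and only finitely many degrees occur. -/
theorem exists_pow_sbr_eq_zero [FiniteDimensional ℂ g] {a b : ι → ℤ} (ha : a ≠ 0) {x v : g}
    (hx : x ∈ S.deg a) (hv : v ∈ S.deg b) : ∃ n, ((sbr (K := ℂ) x) ^ n) v = 0 := by
  by_contra hcon
  push Not at hcon
  have hinj : Function.Injective fun n : ℕ => b + n • a := by
    intro m n hmn
    have h1 : m • a = n • a := by simpa using hmn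
    obtain ⟨i, hi⟩ := Function.ne_iff.mp ha
    have h2 := congrFun h1 i
    simp only [Pi.smul_apply, nsmul_eq_mul, mul_eq_mul_right_iff, Nat.cast_inj] at h2
    exact h2.resolve_right hi
  refine Set.infinite_of_injective_forall_mem hinj (s := {a | S.deg a ≠ ⊥}) (fun n => ?_)
    S.finite_deg
  intro hbot
  have := S.pow_sbr_mem hx hv n
  rw [hbot] at this
  exact hcon n this

theorem sbr_mem_cartan {a : ι → ℤ} {x y : g} (hx : x ∈ S.deg a) (hy : y ∈ S.deg (-a)) :
    x ◃ y ∈ h := by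
  have := S.deg_sbr _ _ _ hx _ hy
  rwa [add_neg_cancel, S.deg_zero] at this

/-! ### Orthogonality for the invariant form. -/

section Form

variable {B : LinearMap.BilinForm ℂ g}

/-- With `H'` in `h` on which the weight of `z` is nonzero, invariance gives `0 = B([H, H'], z) = wt
b H' * B(H, z)`. -/
theorem form_cartan (hB : IsBasicForm g B) (hcart : SelfCentralizing h) {H z : g} (hH : H ∈ h)
    {b : ι → ℤ} (hb : b ≠ 0) (hz : z ∈ S.deg b) (hz0 : z ∈ part (K := ℂ) (V := g) 0) :
    B H z = 0 := by
  by_cases hz' : z = 0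
  · simp [hz']
  obtain ⟨H', hH', hne⟩ := S.wt_ne_zero hcart hb hz hz0 hz'
  have h1 := hB.invariant H H' z
  rw [S.sbr_cartan hH hH', S.sbr_of_mem_deg hH' hz] at h1
  simp only [map_zero, LinearMap.zero_apply, map_smul, smul_eq_mul] at h1
  exact (mul_eq_zero.mp h1.symm).resolve_left hne

theorem form_sbr (hB : IsBasicForm g B) {a : ι → ℤ} {x y H : g}
    (hy : y ∈ S.deg (-a)) (hH : H ∈ h) : B (x ◃ y) H = S.wt a H * B x y := by
  rw [hB.invariant, sbr_even_skew (S.even_of_mem hH), S.sbr_of_mem_deg hH hy, wt_neg]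
  simp

theorem form_eq_zero_of_homog (hB : IsBasicForm g B) {x : g}
    (hx0 : x ∈ part (K := ℂ) (V := g) 0)
    (hx : ∀ b, ∀ y ∈ S.deg b, y ∈ part (K := ℂ) (V := g) 0 → B x y = 0) : x = 0 := by
  refine hB.nondegenerate.1 x fun y => ?_
  obtain ⟨y₀, hy₀, y₁, hy₁, rfl⟩ := exists_eq_add_parts y
  rw [map_add, hB.even x hx0 y₁ hy₁, add_zero]
  exact S.part_induction (P := fun y => B x y = 0) (by simp)
    (fun y z hy hz => by rw [map_add, hy, hz, add_zero]) hx hy₀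

theorem cartan_eq_zero_of_form (S : SimpleSystem D h) (hB : IsBasicForm g B) (hcart : SelfCentralizing h) {H : g}
    (hH : H ∈ h) (hH' : ∀ H' ∈ h, B H H' = 0) : H = 0 := by
  refine S.form_eq_zero_of_homog hB (S.even_of_mem hH) fun b y hy hy0 => ?_
  by_cases hb : b = 0
  · subst hb; exact hH' y (S.deg_zero ▸ hy)
  · exact S.form_cartan hB hcart hH hb hy hy0

/-- By nondegeneracy it is enough that `x` is orthogonal to all even elements `y` of degree `b ≠
-a`. There `[x, y]` has nonzero degree, so it is orthogonal to `h`, while `B(H, [x, y]) = wt a H *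
B(x, y)`. -/
theorem exists_form_ne_zero (hB : IsBasicForm g B) (hcart : SelfCentralizing h) {a : ι → ℤ}
    (ha : a ≠ 0) {x : g} (hx : x ∈ S.deg a) (hx0 : x ∈ part (K := ℂ) (V := g) 0) (hne : x ≠ 0) :
    ∃ y ∈ S.deg (-a), y ∈ part (K := ℂ) (V := g) 0 ∧ B x y ≠ 0 := by
  by_contra hcon
  push Not at hcon
  refine hne (S.form_eq_zero_of_homog hB hx0 fun b y hy hy0 => ?_)
  by_cases hab : a + b = 0
  · exact hcon y (by rwa [← eq_neg_of_add_eq_zero_right hab]) hy0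
  obtain ⟨H, hH, hwt⟩ := S.wt_ne_zero hcart ha hx hx0 hne
  have h1 := hB.invariant H x y
  rw [S.form_cartan hB hcart hH hab (S.deg_sbr _ _ _ hx _ hy) (part_add_self hx0 hy0),
    S.sbr_of_mem_deg hH hx] at h1
  simp only [map_smul, LinearMap.smul_apply, smul_eq_mul] at h1
  exact (mul_eq_zero.mp h1).resolve_left hwt

end Form

/-! ### The trace form -/

/-- The trace form of the adjoint representation. -/
def tr (x y : g) : ℂ := LinearMap.trace ℂ g (sbr (K := ℂ) x ∘ₗ sbr (K := ℂ) y)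

theorem tr_add_left (x x' y : g) : tr (x + x') y = tr x y + tr x' y := by
  simp [tr, LinearMap.add_comp]

theorem tr_add_right (x y y' : g) : tr x (y + y') = tr x y + tr x y' := by
  simp [tr, LinearMap.comp_add]

theorem tr_smul_left (c : ℂ) (x y : g) : tr (c • x) y = c * tr x y := by
  simp [tr, LinearMap.smul_comp]

theorem tr_smul_right (c : ℂ) (x y : g) : tr x (c • y) = c * tr x y := by
  simp [tr, LinearMap.comp_smul]

theorem tr_zero_left (y : g) : tr 0 y = 0 := by simp [tr]

theorem tr_zero_right (x : g) : tr x 0 = 0 := by simp [tr]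

theorem tr_comm (x y : g) : tr x y = tr y x := LinearMap.trace_mul_comm ℂ _ _

theorem sbr_sbr_eq {x : g} (hx : x ∈ part (K := ℂ) (V := g) 0) (y : g) :
    sbr (K := ℂ) (x ◃ y) = sbr (K := ℂ) x * sbr (K := ℂ) y - sbr (K := ℂ) y * sbr (K := ℂ) x := by
  ext z
  simp [sbr_even_jacobi hx]

/-- For even elements the adjoint action of a bracket is an ordinary commutator, so the ordinary
trace is invariant without passing to a supertrace. -/
theorem tr_sbr {x y : g} (hx : x ∈ part (K := ℂ) (V := g) 0)
    (hy : y ∈ part (K := ℂ) (V := g) 0) (z : g) : tr (x ◃ y) z = tr x (y ◃ z) := by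
  simp only [tr, sbr_sbr_eq hx, sbr_sbr_eq hy]
  change LinearMap.trace ℂ g ((_ - _) * _) = LinearMap.trace ℂ g (_ * (_ - _))
  rw [sub_mul, mul_sub, map_sub, map_sub, mul_assoc, mul_assoc,
    LinearMap.trace_mul_comm ℂ (sbr (K := ℂ) y), mul_assoc]

/-! ### Even root vectors -/

variable [FiniteDimensional ℂ g]

theorem root_string {a b : ι → ℤ} (ha : a ≠ 0) {x y v : g} {c : ℂ} (hx : x ∈ S.deg a)
    (hx0 : x ∈ part (K := ℂ) (V := g) 0) (hy : y ∈ S.deg (-a)) (hv : v ∈ S.deg b) (hv0 : v ≠ 0)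
    (hc : y ◃ x ◃ v = c • v) :
    ∃ p q : ℕ, S.wt b (x ◃ y) = S.wt a (x ◃ y) / 2 * (q - p) ∧
      c = S.wt a (x ◃ y) / 2 * (p * (q + 1)) ∧ (p = 0 ↔ x ◃ v = 0) := by
  have hH := S.sbr_mem_cartan hx hy
  refine chain_eq (e := sbr (K := ℂ) x) (f := sbr (K := ℂ) y) (h := sbr (K := ℂ) (x ◃ y))
    (fun z => ?_) (fun z => ?_) (fun z => ?_) hv0 (S.sbr_of_mem_deg hH hv) hc
    (S.exists_pow_sbr_eq_zero ha hx hv) (S.exists_pow_sbr_eq_zero (neg_ne_zero.mpr ha) hy hv)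
  · rw [sbr_even_jacobi hx0, add_comm]
  · rw [sbr_even_jacobi (S.even_of_mem hH), S.sbr_of_mem_deg hH hx, map_smul,
      LinearMap.smul_apply, add_comm]
  · rw [sbr_even_jacobi (S.even_of_mem hH), S.sbr_of_mem_deg hH hy, map_smul,
      LinearMap.smul_apply, wt_neg, LinearMap.neg_apply, neg_smul]
    abel

/-- The space `deg b` may have dimension above one, so the string argument is applied to an
eigenvector of `ad y ∘ ad x` on it; all of `deg b` has the same weight. No assumption is made that
`wt a (x ◃ y)` is nonzero. -/
theorem wt_eq_int_mul {a b : ι → ℤ} (ha : a ≠ 0) {x y v : g} (hx : x ∈ S.deg a)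
    (hx0 : x ∈ part (K := ℂ) (V := g) 0) (hy : y ∈ S.deg (-a)) (hv : v ∈ S.deg b) (hv0 : v ≠ 0) :
    ∃ n : ℤ, S.wt b (x ◃ y) = S.wt a (x ◃ y) / 2 * n := by
  have hmaps : ∀ z ∈ S.deg b, (sbr (K := ℂ) y ∘ₗ sbr (K := ℂ) x) z ∈ S.deg b := by
    intro z hz
    have := S.deg_sbr _ _ _ hy _ (S.deg_sbr _ _ _ hx _ hz)
    rwa [neg_add_cancel_left] at this
  have : Nontrivial (S.deg b) := ⟨⟨⟨v, hv⟩, 0, fun h => hv0 (congrArg Subtype.val h)⟩⟩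
  obtain ⟨c, hc⟩ := Module.End.exists_eigenvalue
    (LinearMap.restrict (sbr (K := ℂ) y ∘ₗ sbr (K := ℂ) x) hmaps)
  obtain ⟨w, hw⟩ := hc.exists_hasEigenvector
  obtain ⟨p, q, h1, -⟩ := S.root_string ha hx hx0 hy w.2
    (fun h => hw.2 (Subtype.ext h)) (congrArg Subtype.val hw.apply_eq_smul)
  exact ⟨q - p, by rw [h1]; push_cast; ring⟩

/-- Every even root vector of nonzero degree is part of an `sl₂`-triple. -/
theorem exists_triple (hg : LieSuperalgebra.IsBasic g) (hcart : SelfCentralizing h) {a : ι → ℤ}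
    (ha : a ≠ 0) {x : g} (hx : x ∈ S.deg a) (hx0 : x ∈ part (K := ℂ) (V := g) 0) (hne : x ≠ 0) :
    ∃ y ∈ S.deg (-a), y ∈ part (K := ℂ) (V := g) 0 ∧ S.wt a (x ◃ y) = 2 := by
  obtain ⟨B, hB⟩ := hg.form
  obtain ⟨y, hy, hy0, hxy⟩ := S.exists_form_ne_zero hB hcart ha hx hx0 hne
  -- If `[x, y]` had weight `0` on `x`, it would have weight `0` everywhere and so vanish,
  -- contradicting `B([x, y], H) = wt a H * B(x, y) ≠ 0` for a suitable `H`.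
  have hne2 : S.wt a (x ◃ y) ≠ 0 := by
    intro h0
    have hz : x ◃ y = 0 := S.eq_zero_of_wt hg.simple (S.sbr_mem_cartan hx hy) fun b v hv hv0 => by
      obtain ⟨n, hn⟩ := S.wt_eq_int_mul ha hx hx0 hy hv hv0
      simp [hn, h0]
    obtain ⟨H, hH, hwt⟩ := S.wt_ne_zero hcart ha hx hx0 hne
    have := S.form_sbr hB (x := x) hy hH
    rw [hz, map_zero, LinearMap.zero_apply] at this
    exact mul_ne_zero hwt hxy this.symm
  refine ⟨(2 / S.wt a (x ◃ y)) • y, Submodule.smul_mem _ _ hy, Submodule.smul_mem _ _ hy0, ?_⟩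
  rw [map_smul, map_smul, smul_eq_mul]
  field_simp

/-- Even root spaces are one-dimensional. -/
theorem exists_eq_smul (hg : LieSuperalgebra.IsBasic g) (hcart : SelfCentralizing h) {a : ι → ℤ}
    (ha : a ≠ 0) {x z : g} (hx : x ∈ S.deg a) (hx0 : x ∈ part (K := ℂ) (V := g) 0) (hne : x ≠ 0)
    (hz : z ∈ S.deg a) (hz0 : z ∈ part (K := ℂ) (V := g) 0) : ∃ s : ℂ, z = s • x := by
  obtain ⟨y, hy, hy0, hxy⟩ := S.exists_triple hg hcart ha hx hx0 hne
  obtain ⟨B, hB⟩ := hg.form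
  have hBne : B x y ≠ 0 := by
    intro h0
    have : x ◃ y = 0 := S.cartan_eq_zero_of_form hB hcart (S.sbr_mem_cartan hx hy)
      fun H hH => by rw [S.form_sbr hB hy hH, h0, mul_zero]
    rw [this, map_zero] at hxy
    exact two_ne_zero hxy.symm
  refine ⟨B z y / B x y, ?_⟩
  -- The component of `z` orthogonal to `y`. The bracket `[w, y]` is orthogonal to `h`, hence zero.
  set w := z - (B z y / B x y) • x with hw
  have hwd : w ∈ S.deg a := sub_mem hz (Submodule.smul_mem _ _ hx)
  have hw0 : w ∈ part (K := ℂ) (V := g) 0 := sub_mem hz0 (Submodule.smul_mem _ _ hx0)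
  have hBw : B w y = 0 := by
    rw [hw, map_sub, LinearMap.sub_apply, map_smul, LinearMap.smul_apply, smul_eq_mul]
    field_simp
    ring
  have hwy : w ◃ y = 0 := S.cartan_eq_zero_of_form hB hcart (S.sbr_mem_cartan hwd hy)
    fun H hH => by rw [S.form_sbr hB hy hH, hBw, mul_zero]
  by_contra hcon
  have hwne : w ≠ 0 := fun h0 => hcon (sub_eq_zero.mp h0)
  -- Since `[w, y] = 0`, the operator `ad y ∘ ad x` has eigenvalue `-2` on `w`. The string formula
  -- requires `p * (q + 1) ≥ 0`.
  have hc : y ◃ x ◃ w = (-2 : ℂ) • w := by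
    rw [sbr_even_jacobi hy0, sbr_even_skew hx0 y, sbr_even_skew hw0 y, hwy, neg_zero, map_zero,
      add_zero, map_neg, LinearMap.neg_apply, S.sbr_of_mem_deg (S.sbr_mem_cartan hx hy) hwd,
      hxy, neg_smul]
  obtain ⟨p, q, -, h2, -⟩ := S.root_string ha hx hx0 hy hwd hwne hc
  rw [hxy] at h2
  have h3 : (p * (q + 1) + 2 : ℂ) = 0 := by linear_combination -h2
  norm_cast at h3

/-- The operator shifts every degree by `a + b`, so it has no diagonal block. -/
theorem tr_of_ne {a b : ι → ℤ} (hab : a + b ≠ 0) {x y : g} (hx : x ∈ S.deg a)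
    (hy : y ∈ S.deg b) : tr x y = 0 := by
  refine LinearMap.trace_eq_zero_of_mapsTo_ne S.deg_internal (fun c => a + (b + c)) (fun c hc => ?_)
    (fun c z hz => S.deg_sbr _ _ _ hx _ (S.deg_sbr _ _ _ hy _ hz))
  refine hab ?_
  have : (a + b) + c = 0 + c := by simpa [add_assoc] using hc
  exact add_right_cancel this

theorem trace_of_scalar {T : g →ₗ[ℂ] g} {χ : (ι → ℤ) → ℂ}
    (hT : ∀ b, ∀ z ∈ S.deg b, T z = χ b • z) :
    LinearMap.trace ℂ g T =
      ∑ b ∈ S.finite_deg.toFinset, Module.finrank ℂ (S.deg b) * χ b := by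
  have hm : ∀ b, Set.MapsTo T (S.deg b) (S.deg b) := fun b z hz => by
    rw [SetLike.mem_coe, hT b z hz]; exact Submodule.smul_mem _ _ hz
  rw [LinearMap.trace_eq_sum_trace_restrict' S.deg_internal S.finite_deg hm]
  refine Finset.sum_congr rfl fun b _ => ?_
  have : T.restrict (hm b) = χ b • LinearMap.id := by
    ext z
    exact hT b z z.2
  rw [this, map_smul, LinearMap.trace_id, smul_eq_mul, mul_comm]

theorem tr_cartan {H H' : g} (hH : H ∈ h) (hH' : H' ∈ h) :
    tr H H' = ∑ b ∈ S.finite_deg.toFinset,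
      Module.finrank ℂ (S.deg b) * (S.wt b H * S.wt b H') :=
  S.trace_of_scalar fun b z hz => by
    rw [LinearMap.comp_apply, S.sbr_of_mem_deg hH' hz, map_smul, S.sbr_of_mem_deg hH hz,
      smul_smul, mul_comm]

/-- Positivity of the trace form on the real span of the coroots, in Hermitian form. -/
theorem tr_cartan_pos (hsim : IsSimple g) {H H' : g} (hH : H ∈ h) (hH' : H' ∈ h)
    (hwt : ∀ b, S.wt b H' = starRingEnd ℂ (S.wt b H)) (hne : H ≠ 0) :
    ∃ t : ℝ, 0 < t ∧ tr H H' = t := by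
  refine ⟨∑ b ∈ S.finite_deg.toFinset, Module.finrank ℂ (S.deg b) * Complex.normSq (S.wt b H),
    ?_, ?_⟩
  · obtain ⟨b, x, hx, hx0, hb⟩ : ∃ b, ∃ x ∈ S.deg b, x ≠ 0 ∧ S.wt b H ≠ 0 := by
      by_contra hcon
      push Not at hcon
      exact hne (S.eq_zero_of_wt hsim hH hcon)
    have hbot : S.deg b ≠ ⊥ := fun h0 => hx0 (by rw [h0] at hx; exact hx)
    refine Finset.sum_pos' (fun b _ => mul_nonneg (Nat.cast_nonneg _) (Complex.normSq_nonneg _))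
      ⟨b, by simpa using hbot, mul_pos ?_ (Complex.normSq_pos.mpr hb)⟩
    have : Nontrivial (S.deg b) := ⟨⟨⟨x, hx⟩, 0, fun h0 => hx0 (congrArg Subtype.val h0)⟩⟩
    exact_mod_cast Module.finrank_pos
  · rw [S.tr_cartan hH hH']
    push_cast
    refine Finset.sum_congr rfl fun b _ => ?_
    rw [hwt, Complex.mul_conj]

end SimpleSystem

/-! ### The compact conjugation of the even part -/

namespace SimpleSystem

variable {ι : Type*} [Fintype ι] [DecidableEq ι] {D : SuperDynkin ι} {g : Type*}
  [AddCommGroup g] [Module ℂ g] [LieSuperalgebra ℂ g] {h : Submodule ℂ g}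
  (S : SimpleSystem D h)

/-- An antilinear automorphism that flips every simple root and is involutive on the even part. -/
structure IsChevalleyFlip (S : SimpleSystem D h) (ψ : g →ₛₗ[starRingEnd ℂ] g) : Prop where
  flips : ∃ c c', S.Flips 1 c c' ψ
  even_invol : ∀ x ∈ part (K := ℂ) (V := g) 0, ψ (ψ x) = x
  bijective : Function.Bijective ψ

namespace IsChevalleyFlip

variable {S} {ψ : g →ₛₗ[starRingEnd ℂ] g}

theorem map_sbr (hψ : S.IsChevalleyFlip ψ) (x y : g) : ψ (x ◃ y) = ψ x ◃ ψ y := by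
  obtain ⟨c, c', hf⟩ := hψ.flips
  exact hf.map_sbr x y

theorem map_deg (hψ : S.IsChevalleyFlip ψ) {a : ι → ℤ} {x : g} (hx : x ∈ S.deg a) :
    ψ x ∈ S.deg (-a) := by
  obtain ⟨c, c', hf⟩ := hψ.flips
  exact hf.map_deg hx

theorem map_part (hψ : S.IsChevalleyFlip ψ) {q : ZMod 2} {x : g}
    (hx : x ∈ part (K := ℂ) (V := g) q) : ψ x ∈ part (K := ℂ) (V := g) q := by
  obtain ⟨c, c', hf⟩ := hψ.flips
  exact hf.map_part hx

theorem map_cartan (hψ : S.IsChevalleyFlip ψ) {H : g} (hH : H ∈ h) : ψ H ∈ h := by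
  obtain ⟨c, c', hf⟩ := hψ.flips
  exact hf.map_cartan hH

theorem wt_map (hψ : S.IsChevalleyFlip ψ) {H : g} (hH : H ∈ h) (a : ι → ℤ) :
    S.wt a (ψ H) = -starRingEnd ℂ (S.wt a H) := by
  obtain ⟨c, c', hf⟩ := hψ.flips
  exact hf.wt_map hH a

theorem map_ne_zero (hψ : S.IsChevalleyFlip ψ) {x : g} (hx : x ≠ 0) : ψ x ≠ 0 := fun h0 =>
  hx (hψ.bijective.1 (by rw [h0, map_zero]))

end IsChevalleyFlip

variable [FiniteDimensional ℂ g] {S} {ψ : g →ₛₗ[starRingEnd ℂ] g}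

/-- The weights of the coroot `x ◃ y` are integers, hence real, while `ψ` sends weights to minus
their conjugates; so all weights of `ψ (x ◃ y) + x ◃ y` vanish. -/
theorem IsChevalleyFlip.map_coroot (hψ : S.IsChevalleyFlip ψ) (hsim : IsSimple g) {a : ι → ℤ}
    (ha : a ≠ 0) {x y : g} (hx : x ∈ S.deg a) (hx0 : x ∈ part (K := ℂ) (V := g) 0)
    (hy : y ∈ S.deg (-a)) (hxy : S.wt a (x ◃ y) = 2) : ψ (x ◃ y) = -(x ◃ y) := by
  have hT := S.sbr_mem_cartan hx hy
  rw [eq_neg_iff_add_eq_zero]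
  refine S.eq_zero_of_wt hsim (add_mem (hψ.map_cartan hT) hT) fun b v hv hv0 => ?_
  obtain ⟨n, hn⟩ := S.wt_eq_int_mul ha hx hx0 hy hv hv0
  rw [map_add, hψ.wt_map hT, hn, hxy]
  simp

/-- The trace form is positive on `sl₂`-triples. -/
theorem tr_triple_pos (hψ : S.IsChevalleyFlip ψ) (hsim : IsSimple g) {a : ι → ℤ}
    (ha : a ≠ 0) {x y : g} (hx : x ∈ S.deg a) (hx0 : x ∈ part (K := ℂ) (V := g) 0)
    (hy : y ∈ S.deg (-a)) (hy0 : y ∈ part (K := ℂ) (V := g) 0) (hxy : S.wt a (x ◃ y) = 2) :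
    ∃ t : ℝ, 0 < t ∧ tr x y = t := by
  have hT := S.sbr_mem_cartan hx hy
  have hne : x ◃ y ≠ 0 := fun h0 => by
    rw [h0, map_zero] at hxy
    exact two_ne_zero hxy.symm
  obtain ⟨t, ht, h1⟩ := S.tr_cartan_pos hsim hT hT (fun b => by
    have := hψ.wt_map hT b
    rw [hψ.map_coroot hsim ha hx hx0 hy hxy, map_neg, neg_inj] at this
    exact this) hne
  refine ⟨t / 2, by positivity, ?_⟩
  -- With `T = [x, y]`, invariance gives `tr(T, T) = tr(x, [y, T]) = 2 tr(x, y)`, and `T` has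
  -- positive square because it has real weights.
  rw [tr_sbr hx0 hy0, sbr_even_skew (S.even_of_mem hT), S.sbr_of_mem_deg hT hy, wt_neg,
    LinearMap.neg_apply, hxy, neg_smul, neg_neg, tr_smul_right] at h1
  push_cast
  rw [← h1]
  ring

/-- The image of an even root vector is a real multiple of the opposite vector of its triple. -/
theorem IsChevalleyFlip.exists_real (hψ : S.IsChevalleyFlip ψ) (hg : LieSuperalgebra.IsBasic g)
    (hcart : SelfCentralizing h) {a : ι → ℤ} (ha : a ≠ 0) {x : g} (hx : x ∈ S.deg a)
    (hx0 : x ∈ part (K := ℂ) (V := g) 0) (hne : x ≠ 0) :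
    ∃ y ∈ S.deg (-a), y ∈ part (K := ℂ) (V := g) 0 ∧ S.wt a (x ◃ y) = 2 ∧
      ∃ s : ℝ, s ≠ 0 ∧ ψ x = (s : ℂ) • y := by
  obtain ⟨y, hy, hy0, hxy⟩ := S.exists_triple hg hcart ha hx hx0 hne
  have hTne : x ◃ y ≠ 0 := fun h0 => by
    rw [h0, map_zero] at hxy
    exact two_ne_zero hxy.symm
  have hyne : y ≠ 0 := fun h0 => hTne (by rw [h0, map_zero])
  obtain ⟨s, hs⟩ := S.exists_eq_smul hg hcart (neg_ne_zero.mpr ha) hy hy0 hyne (hψ.map_deg hx)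
    (hψ.map_part hx0)
  -- As `ψ` exchanges `x` and `ψ x`, it negates their bracket. It also negates the coroot `[x, y]`,
  -- so the scalar `s` in `ψ x = s • y` equals its conjugate.
  have h1 : ψ (x ◃ ψ x) = -(x ◃ ψ x) := by
    rw [hψ.map_sbr, hψ.even_invol x hx0, sbr_even_skew hx0]
  rw [hs, map_smul, map_smulₛₗ, hψ.map_coroot hg.simple ha hx hx0 hy hxy, smul_neg, neg_inj] at h1
  have h2 : starRingEnd ℂ s = s := by
    rw [← sub_eq_zero, ← sub_smul] at h1
    exact sub_eq_zero.mp ((smul_eq_zero.mp h1).resolve_right hTne)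
  obtain ⟨r, rfl⟩ := Complex.conj_eq_iff_real.mp h2
  refine ⟨y, hy, hy0, hxy, r, fun h0 => ?_, hs⟩
  rw [h0, Complex.ofReal_zero, zero_smul] at hs
  exact hψ.map_ne_zero hne hs

open Classical in
/-- The sign by which `ψ` has to be corrected on the even root space of degree `a`. -/
def sgn (S : SimpleSystem D h) (ψ : g →ₛₗ[starRingEnd ℂ] g) (a : ι → ℤ) : ℝ :=
  if ∃ x ∈ S.deg a, x ∈ part (K := ℂ) (V := g) 0 ∧ 0 < (S.wt a (x ◃ ψ x)).re then -1 else 1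

omit [FiniteDimensional ℂ g] in
theorem sgn_eq_or (a : ι → ℤ) : S.sgn ψ a = 1 ∨ S.sgn ψ a = -1 := by
  unfold sgn
  split_ifs
  · exact Or.inr rfl
  · exact Or.inl rfl

omit [FiniteDimensional ℂ g] in
theorem sgn_mul_self (a : ι → ℤ) : S.sgn ψ a * S.sgn ψ a = 1 := by
  rcases S.sgn_eq_or (ψ := ψ) a with h | h <;> rw [h] <;> norm_num

omit [FiniteDimensional ℂ g] in
theorem sgn_zero : S.sgn ψ 0 = 1 := by
  simp [sgn, wt_zero]

theorem eq_of_mul_neg {s s' t : ℝ} (hs : s = 1 ∨ s = -1) (hs' : s' = 1 ∨ s' = -1)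
    (h1 : s * t < 0) (h2 : s' * t < 0) : s = s' := by
  rcases hs with rfl | rfl <;> rcases hs' with rfl | rfl <;> first | rfl | linarith

/-- Characterization of the sign by the bracket. -/
theorem sgn_wt (hψ : S.IsChevalleyFlip ψ) (hg : LieSuperalgebra.IsBasic g)
    (hcart : SelfCentralizing h) {a : ι → ℤ} (ha : a ≠ 0) {x : g} (hx : x ∈ S.deg a)
    (hx0 : x ∈ part (K := ℂ) (V := g) 0) (hne : x ≠ 0) :
    ∃ t : ℝ, S.wt a (x ◃ ψ x) = t ∧ S.sgn ψ a * t < 0 := by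
  obtain ⟨y, hy, hy0, hxy, s, hs0, hs⟩ := hψ.exists_real hg hcart ha hx hx0 hne
  have h1 : S.wt a (x ◃ ψ x) = ((2 * s : ℝ) : ℂ) := by
    rw [hs, map_smul, map_smul, hxy, smul_eq_mul]; push_cast; ring
  refine ⟨2 * s, h1, ?_⟩
  -- By one-dimensionality any other vector is `w • x`, which multiplies the value by `|w|²`. Hence
  -- the existential in `sgn` does not depend on the choice of vector.
  have h2 : ∀ z ∈ S.deg a, z ∈ part (K := ℂ) (V := g) 0 →
      ∃ u : ℝ, 0 ≤ u ∧ (S.wt a (z ◃ ψ z)).re = u * (2 * s) := by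
    intro z hz hz0
    obtain ⟨w, rfl⟩ := S.exists_eq_smul hg hcart ha hx hx0 hne hz hz0
    refine ⟨Complex.normSq w, Complex.normSq_nonneg w, ?_⟩
    have h3 : S.wt a ((w • x) ◃ ψ (w • x)) = ((Complex.normSq w * (2 * s) : ℝ) : ℂ) := by
      rw [map_smulₛₗ ψ w x, map_smul, map_smul, map_smul, LinearMap.smul_apply, map_smul, h1,
        smul_eq_mul, smul_eq_mul, Complex.ofReal_mul (Complex.normSq w), ← Complex.mul_conj]
      ring
    rw [h3, Complex.ofReal_re]
  rcases lt_or_gt_of_ne hs0 with hneg | hpos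
  · have : S.sgn ψ a = 1 := by
      unfold sgn
      rw [if_neg]
      rintro ⟨z, hz, hz0, hlt⟩
      obtain ⟨u, hu, h4⟩ := h2 z hz hz0
      nlinarith
    rw [this]; linarith
  · have : S.sgn ψ a = -1 := by
      unfold sgn
      rw [if_pos]
      exact ⟨x, hx, hx0, by rw [h1, Complex.ofReal_re]; linarith⟩
    rw [this]; linarith

theorem sgn_of_real (hψ : S.IsChevalleyFlip ψ) (hg : LieSuperalgebra.IsBasic g)
    (hcart : SelfCentralizing h) {a : ι → ℤ} (ha : a ≠ 0) {x y : g} (hx : x ∈ S.deg a)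
    (hx0 : x ∈ part (K := ℂ) (V := g) 0) (hne : x ≠ 0) (hxy : S.wt a (x ◃ y) = 2) {s : ℝ}
    (hs : ψ x = (s : ℂ) • y) : S.sgn ψ a * s < 0 := by
  obtain ⟨t, ht, h1⟩ := S.sgn_wt hψ hg hcart ha hx hx0 hne
  rw [hs, map_smul, map_smul, hxy, smul_eq_mul] at ht
  have : t = 2 * s := by
    have h2 : ((t : ℝ) : ℂ) = ((2 * s : ℝ) : ℂ) := by rw [← ht]; push_cast; ring
    exact_mod_cast h2
  rw [this] at h1
  linarith

/-- Use `ψ x` as test vector in degree `-a`: reversing the bracket and negating the weight are two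
sign changes that cancel. -/
theorem sgn_neg (hψ : S.IsChevalleyFlip ψ) (hg : LieSuperalgebra.IsBasic g)
    (hcart : SelfCentralizing h) {a : ι → ℤ} (ha : a ≠ 0) {x : g} (hx : x ∈ S.deg a)
    (hx0 : x ∈ part (K := ℂ) (V := g) 0) (hne : x ≠ 0) : S.sgn ψ (-a) = S.sgn ψ a := by
  obtain ⟨t, ht, h1⟩ := S.sgn_wt hψ hg hcart ha hx hx0 hne
  obtain ⟨t', ht', h1'⟩ := S.sgn_wt hψ hg hcart (neg_ne_zero.mpr ha) (hψ.map_deg hx)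
    (hψ.map_part hx0) (hψ.map_ne_zero hne)
  rw [hψ.even_invol x hx0, sbr_even_skew hx0, map_neg, wt_neg, LinearMap.neg_apply, neg_neg,
    ht] at ht'
  have : t = t' := by exact_mod_cast ht'
  rw [← this] at h1'
  exact eq_of_mul_neg (sgn_eq_or _) (sgn_eq_or _) h1' h1

/-- Characterization of the sign by the trace form. -/
theorem sgn_tr (hψ : S.IsChevalleyFlip ψ) (hg : LieSuperalgebra.IsBasic g)
    (hcart : SelfCentralizing h) {a : ι → ℤ} (ha : a ≠ 0) {x : g} (hx : x ∈ S.deg a)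
    (hx0 : x ∈ part (K := ℂ) (V := g) 0) (hne : x ≠ 0) :
    ∃ u : ℝ, tr x (ψ x) = u ∧ S.sgn ψ a * u < 0 := by
  obtain ⟨y, hy, hy0, hxy, s, hs0, hs⟩ := hψ.exists_real hg hcart ha hx hx0 hne
  obtain ⟨t, ht, htr⟩ := S.tr_triple_pos hψ hg.simple ha hx hx0 hy hy0 hxy
  have h1 := S.sgn_of_real hψ hg hcart ha hx hx0 hne hxy hs
  refine ⟨s * t, by rw [hs, tr_smul_right, htr]; push_cast; ring, ?_⟩
  rw [← mul_assoc]
  exact mul_neg_of_neg_of_pos h1 ht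

/-- The sign is multiplicative on even roots. -/
theorem sgn_add (hψ : S.IsChevalleyFlip ψ) (hg : LieSuperalgebra.IsBasic g)
    (hcart : SelfCentralizing h) {a b : ι → ℤ} (ha : a ≠ 0) (hb : b ≠ 0) (hab : a + b ≠ 0)
    {x z : g} (hx : x ∈ S.deg a) (hx0 : x ∈ part (K := ℂ) (V := g) 0) (hz : z ∈ S.deg b)
    (hz0 : z ∈ part (K := ℂ) (V := g) 0) (hne : x ◃ z ≠ 0) :
    S.sgn ψ (a + b) = S.sgn ψ a * S.sgn ψ b := by
  have hxne : x ≠ 0 := fun h0 => hne (by rw [h0, map_zero, LinearMap.zero_apply])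
  have hzne : z ≠ 0 := fun h0 => hne (by rw [h0, map_zero])
  obtain ⟨y, hy, hy0, hxy, s, hs0, hs⟩ := hψ.exists_real hg hcart ha hx hx0 hxne
  have h1 := S.sgn_of_real hψ hg hcart ha hx hx0 hxne hxy hs
  obtain ⟨u, hu, hu'⟩ := S.sgn_tr hψ hg hcart hb hz hz0 hzne
  obtain ⟨w, hw, hw'⟩ := S.sgn_tr hψ hg hcart hab (S.deg_sbr _ _ _ hx _ hz)
    (part_add_self hx0 hz0) hne
  have hψz := hψ.map_deg hz
  have hψz0 := hψ.map_part hz0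
  have hψzne := hψ.map_ne_zero hzne
  have hmem : x ◃ y ◃ ψ z ∈ S.deg (-b) := by
    have := S.deg_sbr _ _ _ hx _ (S.deg_sbr _ _ _ hy _ hψz)
    rwa [add_neg_cancel_left] at this
  -- The line of `ψ z` is stable under `ad x ∘ ad y`, and the string formula makes the eigenvalue `p
  -- * (q + 1)`; this is positive because `[y, ψ z]` is a nonzero multiple of `ψ [x, z]`, up to the
  -- factor `s`.
  obtain ⟨c, hc⟩ := S.exists_eq_smul hg hcart (neg_ne_zero.mpr hb) hψz hψz0 hψzne hmem
    (part_add_self hx0 (part_add_self hy0 hψz0))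
  obtain ⟨p, q, -, hcp, hp0⟩ := S.root_string (neg_ne_zero.mpr ha) hy hy0
    (by rwa [neg_neg]) hψz hψzne hc
  rw [sbr_even_skew hx0, map_neg, wt_neg, LinearMap.neg_apply, neg_neg, hxy] at hcp
  have hyz : y ◃ ψ z ≠ 0 := by
    intro h0
    refine hψ.map_ne_zero hne ?_
    rw [hψ.map_sbr, hs, map_smul, LinearMap.smul_apply, h0, smul_zero]
  have hppos : (0 : ℝ) < p * (q + 1) := by
    have : p ≠ 0 := fun h0 => hyz (hp0.mp h0)
    positivity
  -- Invariance: `tr([x, z], ψ[x, z]) = s tr([x, z], [y, ψ z]) = -s tr(z, [x, [y, ψ z]])`. As `p *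
  -- (q + 1)` is positive, the three signs are tied together.
  have hkey : w = -(s * (p * (q + 1)) * u) := by
    have h2 : (w : ℂ) = ((-(s * (p * (q + 1)) * u) : ℝ) : ℂ) := by
      rw [← hw, hψ.map_sbr, hs, map_smul, LinearMap.smul_apply, sbr_even_skew hz0 x, ← neg_one_smul ℂ,
        tr_smul_left, tr_smul_right, tr_sbr hz0 hx0, hc, tr_smul_right, hu, hcp]
      push_cast
      ring
    exact_mod_cast h2
  rw [hkey] at hw'
  set k : ℝ := p * (q + 1)
  have h3 : S.sgn ψ a * S.sgn ψ b * (s * u) > 0 := by nlinarith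
  have h4 : S.sgn ψ (a + b) * (s * u) > 0 := by
    by_contra hcon
    have : S.sgn ψ (a + b) * (s * u) * k ≤ 0 :=
      mul_nonpos_of_nonpos_of_nonneg (not_lt.mp hcon) hppos.le
    nlinarith
  refine eq_of_mul_neg (t := -(s * u)) (sgn_eq_or _) ?_ (by linarith) (by linarith)
  rcases S.sgn_eq_or (ψ := ψ) a with h | h <;> rcases S.sgn_eq_or (ψ := ψ) b with h' | h' <;>
    simp [h, h']

/-- The compact conjugation: `ψ` corrected by signs. -/
def compactConj (S : SimpleSystem D h) (ψ : g →ₛₗ[starRingEnd ℂ] g) :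
    g →ₛₗ[starRingEnd ℂ] g :=
  ψ.comp (S.scale fun a => (S.sgn ψ a : ℂ))

omit [FiniteDimensional ℂ g] in
theorem compactConj_of_mem {a : ι → ℤ} {x : g} (hx : x ∈ S.deg a) :
    S.compactConj ψ x = (S.sgn ψ a : ℂ) • ψ x := by
  rw [compactConj, LinearMap.comp_apply, S.scale_of_mem _ hx, map_smulₛₗ, Complex.conj_ofReal]

omit [FiniteDimensional ℂ g] in
theorem compactConj_cartan {H : g} (hH : H ∈ h) : S.compactConj ψ H = ψ H := by
  rw [compactConj_of_mem (S.mem_deg_zero hH), sgn_zero, Complex.ofReal_one, one_smul]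

omit [FiniteDimensional ℂ g] in
theorem compactConj_deg (hψ : S.IsChevalleyFlip ψ) {a : ι → ℤ} {x : g} (hx : x ∈ S.deg a) :
    S.compactConj ψ x ∈ S.deg (-a) := by
  rw [compactConj_of_mem hx]
  exact Submodule.smul_mem _ _ (hψ.map_deg hx)

omit [FiniteDimensional ℂ g] in
theorem compactConj_part (hψ : S.IsChevalleyFlip ψ) {q : ZMod 2} {x : g}
    (hx : x ∈ part (K := ℂ) (V := g) q) : S.compactConj ψ x ∈ part (K := ℂ) (V := g) q := by
  refine S.part_induction (P := fun x => S.compactConj ψ x ∈ part (K := ℂ) (V := g) q) (by simp)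
    (fun x y hx hy => by rw [map_add]; exact add_mem hx hy) (fun a x ha hx => ?_) hx
  rw [compactConj_of_mem ha]
  exact Submodule.smul_mem _ _ (hψ.map_part hx)

theorem compactConj_compactConj (hψ : S.IsChevalleyFlip ψ) (hg : LieSuperalgebra.IsBasic g)
    (hcart : SelfCentralizing h) {x : g} (hx : x ∈ part (K := ℂ) (V := g) 0) :
    S.compactConj ψ (S.compactConj ψ x) = x := by
  refine S.part_induction (P := fun x => S.compactConj ψ (S.compactConj ψ x) = x) (by simp)
    (fun x y hx hy => by rw [map_add, map_add, hx, hy]) (fun a x ha hx => ?_) hx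
  by_cases hx0 : x = 0
  · simp [hx0]
  have hs : S.sgn ψ (-a) = S.sgn ψ a := by
    by_cases ha0 : a = 0
    · rw [ha0, neg_zero]
    · exact sgn_neg hψ hg hcart ha0 ha hx hx0
  rw [compactConj_of_mem (compactConj_deg hψ ha), compactConj_of_mem ha, map_smulₛₗ,
    Complex.conj_ofReal, hψ.even_invol x hx, smul_smul, hs, ← Complex.ofReal_mul, sgn_mul_self,
    Complex.ofReal_one, one_smul]

/-- Reduces to multiplicativity of the signs. `sgn_add` covers the case where `a`, `b` and `a + b`
are all nonzero; the rest follows from `sgn 0 = 1` and `sgn (-a) = sgn a`. -/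
theorem compactConj_sbr (hψ : S.IsChevalleyFlip ψ) (hg : LieSuperalgebra.IsBasic g)
    (hcart : SelfCentralizing h) {x y : g} (hx : x ∈ part (K := ℂ) (V := g) 0)
    (hy : y ∈ part (K := ℂ) (V := g) 0) :
    S.compactConj ψ (x ◃ y) = S.compactConj ψ x ◃ S.compactConj ψ y := by
  refine S.part_induction
    (P := fun x => S.compactConj ψ (x ◃ y) = S.compactConj ψ x ◃ S.compactConj ψ y) (by simp)
    (fun x x' hx hx' => by simp only [map_add, LinearMap.add_apply, hx, hx'])
    (fun a x ha hx => ?_) hx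
  refine S.part_induction
    (P := fun y => S.compactConj ψ (x ◃ y) = S.compactConj ψ x ◃ S.compactConj ψ y) (by simp)
    (fun y y' hy hy' => by simp only [map_add, hy, hy']) (fun b y hb hy => ?_) hy
  rw [compactConj_of_mem (S.deg_sbr _ _ _ ha _ hb), compactConj_of_mem ha, compactConj_of_mem hb,
    hψ.map_sbr, map_smul, map_smul, LinearMap.smul_apply, smul_smul]
  by_cases hxy : x ◃ y = 0
  · rw [← hψ.map_sbr, hxy, map_zero, smul_zero, smul_zero]
  congr 1
  rw [← Complex.ofReal_mul, mul_comm (S.sgn ψ b)]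
  congr 1
  have hxne : x ≠ 0 := fun h0 => hxy (by rw [h0, map_zero, LinearMap.zero_apply])
  by_cases ha0 : a = 0
  · rw [ha0, zero_add, sgn_zero, one_mul]
  by_cases hb0 : b = 0
  · rw [hb0, add_zero, sgn_zero, mul_one]
  by_cases hab : a + b = 0
  · rw [hab, sgn_zero, eq_neg_of_add_eq_zero_right hab, sgn_neg hψ hg hcart ha0 ha hx hxne,
      sgn_mul_self]
  · exact sgn_add hψ hg hcart ha0 hb0 hab ha hx hb hy hxy

theorem sum_proj (S : SimpleSystem D h) (x : g) :
    ∑ a ∈ S.finite_deg.toFinset, S.proj a x = x := by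
  refine S.homog_induction (P := fun x => ∑ a ∈ S.finite_deg.toFinset, S.proj a x = x) (by simp)
    (fun x y hx hy => by simp only [map_add, Finset.sum_add_distrib, hx, hy]) (fun a x hx => ?_) x
  by_cases hx0 : x = 0
  · simp [hx0]
  rw [Finset.sum_eq_single a (fun b _ hb => S.proj_ne hb.symm hx), S.proj_self hx]
  intro ha
  exfalso
  simp only [Set.Finite.mem_toFinset, Set.mem_ofPred_eq, ne_eq, not_not] at ha
  rw [ha] at hx
  exact hx0 hx

omit [FiniteDimensional ℂ g] in
theorem tr_sum_left {κ : Type*} (s : Finset κ) (x : κ → g) (y : g) :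
    tr (∑ i ∈ s, x i) y = ∑ i ∈ s, tr (x i) y := by
  classical
  induction s using Finset.induction_on with
  | empty => simp [tr_zero_left]
  | insert i s hi ih => rw [Finset.sum_insert hi, Finset.sum_insert hi, tr_add_left, ih]

/-- Positive definiteness of minus the trace form with respect to the compact conjugation. -/
theorem tr_compactConj_neg (hψ : S.IsChevalleyFlip ψ) (hg : LieSuperalgebra.IsBasic g)
    (hcart : SelfCentralizing h) {x : g} (hx : x ∈ part (K := ℂ) (V := g) 0) (hne : x ≠ 0) :
    (tr x (S.compactConj ψ x)).re < 0 := by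
  have hdiag : ∀ a, ∀ z ∈ S.deg a, tr z (S.compactConj ψ x) =
      tr z (S.compactConj ψ (S.proj a x)) := by
    intro a z hz
    refine S.homog_induction
      (P := fun x => tr z (S.compactConj ψ x) = tr z (S.compactConj ψ (S.proj a x))) (by simp)
      (fun x y hx hy => by simp only [map_add, tr_add_right, hx, hy]) (fun b x hb => ?_) x
    by_cases hab : b = a
    · subst hab; rw [S.proj_self hb]
    · rw [S.proj_ne hab hb, map_zero, tr_zero_right]
      refine S.tr_of_ne (fun h0 => hab ?_) hz (compactConj_deg hψ hb)
      rw [← sub_eq_add_neg, sub_eq_zero] at h0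
      exact h0.symm
  -- In degree `0` the value is minus a sum of dimensions times squared absolute values of weights;
  -- in the other degrees the sign in `compactConj` makes it negative.
  have hterm : ∀ a, S.proj a x ≠ 0 → (tr (S.proj a x) (S.compactConj ψ x)).re < 0 := by
    intro a hxa
    have hd := S.proj_mem a x
    have h0 := S.proj_mem_part hx a
    rw [hdiag a _ hd, compactConj_of_mem hd, tr_smul_right]
    by_cases ha : a = 0
    · subst ha
      have hH : S.proj 0 x ∈ h := by rwa [S.deg_zero] at hd
      obtain ⟨t, ht, htr⟩ := S.tr_cartan_pos hg.simple hH (neg_mem (hψ.map_cartan hH))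
        (fun b => by rw [map_neg, hψ.wt_map hH, neg_neg]) hxa
      rw [← neg_one_smul ℂ, tr_smul_right] at htr
      have : tr (S.proj 0 x) (ψ (S.proj 0 x)) = ((-t : ℝ) : ℂ) := by
        push_cast; linear_combination -htr
      rw [this, sgn_zero, Complex.ofReal_one, one_mul, Complex.ofReal_re]
      linarith
    · obtain ⟨u, hu, hu'⟩ := S.sgn_tr hψ hg hcart ha hd h0 hxa
      rwa [hu, ← Complex.ofReal_mul, Complex.ofReal_re]
  have hsum : tr x (S.compactConj ψ x) =
      ∑ a ∈ S.finite_deg.toFinset, tr (S.proj a x) (S.compactConj ψ x) := by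
    rw [← tr_sum_left, S.sum_proj]
  rw [hsum, Complex.re_sum]
  obtain ⟨a, ha⟩ : ∃ a, S.proj a x ≠ 0 := by
    by_contra hcon
    push Not at hcon
    exact hne (S.eq_zero_of_proj hcon)
  have hle : ∀ a, (tr (S.proj a x) (S.compactConj ψ x)).re ≤ 0 := by
    intro a
    by_cases h0 : S.proj a x = 0
    · rw [h0, tr_zero_left, Complex.zero_re]
    · exact (hterm a h0).le
  refine Finset.sum_neg' (fun a _ => hle a) ⟨a, ?_, hterm a ha⟩
  simp only [Set.Finite.mem_toFinset, Set.mem_ofPred_eq]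
  intro hbot
  have := S.proj_mem a x
  rw [hbot] at this
  exact ha this

/-! ### Interaction with a second antilinear automorphism -/

/-- An antilinear involution that permutes the simple roots up to sign and commutes with `ψ` up
to a sign depending on the degree. -/
structure IsRealStructure (S : SimpleSystem D h) (ψ σ : g →ₛₗ[starRingEnd ℂ] g)
    (d : Equiv.Perm ι) : Prop where
  flips : ∃ c c', S.Flips d c c' σ
  invol : ∀ x, σ (σ x) = x
  comm : ∃ χ : (ι → ℤ) → ℝ, χ 0 = 1 ∧ (∀ a, χ a = 1 ∨ χ a = -1) ∧
    ∀ a, ∀ x ∈ S.deg a, σ (ψ x) = (χ a : ℂ) • ψ (σ x)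

namespace IsRealStructure

variable {σ : g →ₛₗ[starRingEnd ℂ] g} {d : Equiv.Perm ι}

omit [FiniteDimensional ℂ g] in
theorem map_sbr (hσ : S.IsRealStructure ψ σ d) (x y : g) : σ (x ◃ y) = σ x ◃ σ y := by
  obtain ⟨c, c', hf⟩ := hσ.flips
  exact hf.map_sbr x y

omit [FiniteDimensional ℂ g] in
theorem map_deg (hσ : S.IsRealStructure ψ σ d) {a : ι → ℤ} {x : g} (hx : x ∈ S.deg a) :
    σ x ∈ S.deg (-(a ∘ d.symm)) := by
  obtain ⟨c, c', hf⟩ := hσ.flips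
  exact hf.map_deg hx

omit [FiniteDimensional ℂ g] in
theorem map_part (hσ : S.IsRealStructure ψ σ d) {q : ZMod 2} {x : g}
    (hx : x ∈ part (K := ℂ) (V := g) q) : σ x ∈ part (K := ℂ) (V := g) q := by
  obtain ⟨c, c', hf⟩ := hσ.flips
  exact hf.map_part hx

omit [FiniteDimensional ℂ g] in
theorem map_cartan (hσ : S.IsRealStructure ψ σ d) {H : g} (hH : H ∈ h) : σ H ∈ h := by
  obtain ⟨c, c', hf⟩ := hσ.flips
  exact hf.map_cartan hH

omit [FiniteDimensional ℂ g] in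
theorem wt_map (hσ : S.IsRealStructure ψ σ d) {H : g} (hH : H ∈ h) (a : ι → ℤ) :
    S.wt (a ∘ d.symm) (σ H) = -starRingEnd ℂ (S.wt a H) := by
  obtain ⟨c, c', hf⟩ := hσ.flips
  exact hf.wt_map hH a

omit [FiniteDimensional ℂ g] in
theorem map_ne_zero (hσ : S.IsRealStructure ψ σ d) {x : g} (hx : x ≠ 0) : σ x ≠ 0 := fun h0 =>
  hx (by rw [← hσ.invol x, h0, map_zero])

omit [FiniteDimensional ℂ g] in
theorem comm_cartan (hσ : S.IsRealStructure ψ σ d) {H : g} (hH : H ∈ h) :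
    σ (ψ H) = ψ (σ H) := by
  obtain ⟨χ, h0, -, hχ⟩ := hσ.comm
  rw [hχ 0 H (S.mem_deg_zero hH), h0, Complex.ofReal_one, one_smul]

theorem comp_ne_zero {ι : Type*} (d : Equiv.Perm ι) {a : ι → ℤ} (ha : a ≠ 0) : -(a ∘ d.symm) ≠ 0 := by
  rw [neg_ne_zero]
  intro h0
  refine ha (funext fun i => ?_)
  have := congrFun h0 (d i)
  simpa using this

/-- The factor `χ a` by which `σ` and `ψ` fail to commute is exactly the ratio of the signs at `a`
and at the degree of `σ x`. This is seen by applying `σ` to `[x, ψ x]` and comparing the real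
numbers that define the two signs. -/
theorem comm_compactConj (hσ : S.IsRealStructure ψ σ d) (hψ : S.IsChevalleyFlip ψ)
    (hg : LieSuperalgebra.IsBasic g) (hcart : SelfCentralizing h) {x : g}
    (hx : x ∈ part (K := ℂ) (V := g) 0) :
    σ (S.compactConj ψ x) = S.compactConj ψ (σ x) := by
  refine S.part_induction (P := fun x => σ (S.compactConj ψ x) = S.compactConj ψ (σ x)) (by simp)
    (fun x y hx hy => by simp only [map_add, hx, hy]) (fun a x ha hx => ?_) hx
  by_cases ha0 : a = 0
  · subst ha0
    have hH : x ∈ h := by rwa [S.deg_zero] at ha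
    rw [compactConj_cartan hH, compactConj_cartan (hσ.map_cartan hH), hσ.comm_cartan hH]
  by_cases hx0 : x = 0
  · simp [hx0]
  obtain ⟨χ, -, hχ1, hχ⟩ := hσ.comm
  rw [compactConj_of_mem ha, compactConj_of_mem (hσ.map_deg ha), map_smulₛₗ, hχ a x ha,
    Complex.conj_ofReal, smul_smul, ← Complex.ofReal_mul]
  congr 2
  obtain ⟨t, ht, h1⟩ := S.sgn_wt hψ hg hcart ha0 ha hx hx0
  obtain ⟨t', ht', h1'⟩ := S.sgn_wt hψ hg hcart (comp_ne_zero d ha0) (hσ.map_deg ha)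
    (hσ.map_part hx) (hσ.map_ne_zero hx0)
  have h2 := hσ.wt_map (S.sbr_mem_cartan ha (hψ.map_deg ha)) a
  rw [hσ.map_sbr, hχ a x ha, ht, map_smul, map_smul, Complex.conj_ofReal] at h2
  rw [wt_neg, LinearMap.neg_apply] at ht'
  have h3 : χ a * t' = t := by
    have : ((χ a * t' : ℝ) : ℂ) = ((t : ℝ) : ℂ) := by
      push_cast
      rw [← ht']
      rw [smul_eq_mul] at h2
      linear_combination -h2
    exact_mod_cast this
  refine eq_of_mul_neg (t := t') ?_ (sgn_eq_or _) (by rw [mul_assoc, h3]; exact h1) h1'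
  rcases S.sgn_eq_or (ψ := ψ) a with h | h <;> rcases hχ1 a with h' | h' <;> simp [h, h']

omit [FiniteDimensional ℂ g] in
/-- The trace form is invariant under the linear automorphism `ψ ∘ σ`. -/
theorem tr_map (hσ : S.IsRealStructure ψ σ d) (hψ : S.IsChevalleyFlip ψ) (x y : g) :
    tr (ψ (σ x)) (ψ (σ y)) = tr x y := by
  let L : g →ₗ[ℂ] g := ψ.comp σ
  have hbij : Function.Bijective L :=
    hψ.bijective.comp (Function.Involutive.bijective hσ.invol)
  let E : g ≃ₗ[ℂ] g := LinearEquiv.ofBijective L hbij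
  have hE : ∀ z, E z = ψ (σ z) := fun z => rfl
  have hsbr : ∀ u v, E (u ◃ v) = E u ◃ E v := fun u v => by
    rw [hE, hE, hE, hσ.map_sbr, hψ.map_sbr]
  have : sbr (K := ℂ) (E x) ∘ₗ sbr (K := ℂ) (E y) = E.conj (sbr (K := ℂ) x ∘ₗ sbr (K := ℂ) y) := by
    ext z
    rw [LinearEquiv.conj_apply_apply]
    simp [hsbr]
  unfold tr
  rw [← hE, ← hE, this, LinearMap.trace_conj']

/-- The linear map `ψ ∘ σ` is an automorphism and preserves the trace form, so only signs matter:
both sides vanish unless the degrees are opposite, and then the two signs agree. -/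
theorem tr_compactConj (hσ : S.IsRealStructure ψ σ d) (hψ : S.IsChevalleyFlip ψ)
    (hg : LieSuperalgebra.IsBasic g) (hcart : SelfCentralizing h) {x y : g}
    (hx : x ∈ part (K := ℂ) (V := g) 0) (hy : y ∈ part (K := ℂ) (V := g) 0) :
    tr (S.compactConj ψ (σ x)) (S.compactConj ψ (σ y)) = tr x y := by
  refine S.part_induction
    (P := fun x => tr (S.compactConj ψ (σ x)) (S.compactConj ψ (σ y)) = tr x y)
    (by simp [tr_zero_left])
    (fun x x' hx hx' => by simp only [map_add, tr_add_left, hx, hx']) (fun a x ha hx => ?_) hx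
  refine S.part_induction
    (P := fun y => tr (S.compactConj ψ (σ x)) (S.compactConj ψ (σ y)) = tr x y)
    (by simp [tr_zero_right])
    (fun x x' hx hx' => by simp only [map_add, tr_add_right, hx, hx']) (fun b y hb hy => ?_) hy
  rw [compactConj_of_mem (hσ.map_deg ha), compactConj_of_mem (hσ.map_deg hb), tr_smul_left,
    tr_smul_right, hσ.tr_map hψ]
  by_cases hab : a + b = 0
  · by_cases hx0 : x = 0
    · simp [hx0, tr_zero_left]
    have hb' : -(b ∘ d.symm) = -(-(a ∘ d.symm)) := by
      rw [eq_neg_of_add_eq_zero_right hab]; rfl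
    have hs : S.sgn ψ (-(b ∘ d.symm)) = S.sgn ψ (-(a ∘ d.symm)) := by
      rw [hb']
      by_cases ha0 : a = 0
      · subst ha0; simp
      · exact sgn_neg hψ hg hcart (comp_ne_zero d ha0) (hσ.map_deg ha) (hσ.map_part hx)
          (hσ.map_ne_zero hx0)
    rw [hs, ← mul_assoc, ← Complex.ofReal_mul, sgn_mul_self, Complex.ofReal_one, one_mul]
  · rw [S.tr_of_ne hab ha hb, mul_zero, mul_zero]

end IsRealStructure

/-! ### The element of the Cartan subalgebra defined by the height -/

/-- The height of a degree. -/
def height (a : ι → ℤ) : ℤ := ∑ i, a i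

/-- Requiring the value `1` on every simple root could be inconsistent, as the simple roots may be
dependent on `h`. Instead let `E` act on each degree by its height. The trace form on `h` is
nondegenerate, so some `H` represents `H' ↦ trace (E ∘ ad H')`. Evaluated at a coroot `[x, y]` this
reads `wt a H * tr(x, y) = trace ([E, ad x] ∘ ad y) = height a * tr(x, y)`. -/
theorem exists_height (hψ : S.IsChevalleyFlip ψ) (hg : LieSuperalgebra.IsBasic g)
    (hcart : SelfCentralizing h) : ∃ H ∈ h, ∀ a ≠ 0, ∀ x ∈ S.deg a,
      x ∈ part (K := ℂ) (V := g) 0 → x ≠ 0 → S.wt a H = height a := by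
  let E : g →ₗ[ℂ] g := S.scale fun a => (height a : ℂ)
  let κ : h →ₗ[ℂ] h →ₗ[ℂ] ℂ := LinearMap.mk₂ ℂ (fun H H' => tr (H : g) (H' : g))
    (fun x y z => tr_add_left _ _ _) (fun c x y => tr_smul_left _ _ _)
    (fun x y z => tr_add_right _ _ _) (fun c x y => tr_smul_right _ _ _)
  have hinj : Function.Injective κ := by
    rw [← LinearMap.ker_eq_bot, LinearMap.ker_eq_bot']
    intro H hH
    by_contra hne
    have hne' : (H : g) ≠ 0 := fun h0 => hne (Subtype.ext h0)
    obtain ⟨t, ht, htr⟩ := S.tr_cartan_pos hg.simple H.2 (neg_mem (hψ.map_cartan H.2))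
      (fun b => by rw [map_neg, hψ.wt_map H.2, neg_neg]) hne'
    have h1 := LinearMap.congr_fun hH ⟨-ψ H, neg_mem (hψ.map_cartan H.2)⟩
    have h2 : tr (H : g) (-ψ H) = 0 := h1
    rw [htr] at h2
    exact ht.ne' (by exact_mod_cast h2)
  have hsurj : Function.Surjective κ :=
    (LinearMap.injective_iff_surjective_of_finrank_eq_finrank
      (Subspace.dual_finrank_eq (K := ℂ) (V := h)).symm).mp hinj
  let ℓ : h →ₗ[ℂ] ℂ :=
    { toFun := fun H => LinearMap.trace ℂ g (E ∘ₗ sbr (K := ℂ) (H : g))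
      map_add' := fun x y => by simp [LinearMap.comp_add]
      map_smul' := fun c x => by simp [LinearMap.comp_smul] }
  obtain ⟨H, hH⟩ := hsurj ℓ
  refine ⟨H, H.2, fun a ha x hx hx0 hne => ?_⟩
  obtain ⟨y, hy, hy0, hxy⟩ := S.exists_triple hg hcart ha hx hx0 hne
  obtain ⟨t, ht, htr⟩ := S.tr_triple_pos hψ hg.simple ha hx hx0 hy hy0 hxy
  have h1 : tr (H : g) (x ◃ y) = LinearMap.trace ℂ g (E ∘ₗ sbr (K := ℂ) (x ◃ y)) :=
    LinearMap.congr_fun hH ⟨x ◃ y, S.sbr_mem_cartan hx hy⟩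
  have h2 : E * sbr (K := ℂ) x = sbr (K := ℂ) x * E + (height a : ℂ) • sbr (K := ℂ) x := by
    ext z
    refine S.homog_induction (P := fun z => (E * sbr (K := ℂ) x) z =
      (sbr (K := ℂ) x * E + (height a : ℂ) • sbr (K := ℂ) x) z) (by simp)
      (fun u v hu hv => by rw [map_add, map_add, hu, hv]) (fun b z hz => ?_) z
    simp only [Module.End.mul_apply, LinearMap.add_apply, LinearMap.smul_apply, E]
    rw [S.scale_of_mem _ (S.deg_sbr _ _ _ hx _ hz), S.scale_of_mem _ hz, map_smul, ← add_smul]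
    congr 1
    simp [height, Finset.sum_add_distrib, add_comm]
  rw [← tr_sbr (S.even_of_mem H.2) hx0, S.sbr_of_mem_deg H.2 hx, tr_smul_left, htr] at h1
  have h3 : LinearMap.trace ℂ g (E ∘ₗ sbr (K := ℂ) (x ◃ y)) = height a * tr x y := by
    rw [sbr_sbr_eq hx0]
    change LinearMap.trace ℂ g (E * (_ - _)) = _
    rw [mul_sub, ← mul_assoc, h2, add_mul, map_sub, map_add,
      mul_assoc (sbr (K := ℂ) x) E, LinearMap.trace_mul_comm ℂ (sbr (K := ℂ) x), mul_assoc,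
      add_sub_cancel_left, smul_mul_assoc, map_smul, smul_eq_mul]
    rfl
  rw [h3, htr] at h1
  exact mul_right_cancel₀ (by exact_mod_cast ht.ne') h1

omit [DecidableEq ι] in
theorem height_comp (d : Equiv.Perm ι) (a : ι → ℤ) : height (a ∘ d.symm) = height a :=
  Equiv.sum_comp d.symm a

omit [DecidableEq ι] in
theorem height_neg (a : ι → ℤ) : height (-a) = -height a := by simp [height]

/-- Heights are real and invariant under `d`, so `-σ H` takes the same values on even roots as `H`,
and so does `-ψ H`. Averaging under the commuting involutions `-σ` and `-ψ` of `h` preserves these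
values. -/
theorem exists_height_invariant {σ : g →ₛₗ[starRingEnd ℂ] g} {d : Equiv.Perm ι}
    (hσ : S.IsRealStructure ψ σ d) (hψ : S.IsChevalleyFlip ψ) (hg : LieSuperalgebra.IsBasic g)
    (hcart : SelfCentralizing h) : ∃ H ∈ h, σ H = -H ∧ ψ H = -H ∧ ∀ a ≠ 0, ∀ x ∈ S.deg a,
      x ∈ part (K := ℂ) (V := g) 0 → x ≠ 0 → S.wt a H = height a := by
  obtain ⟨H, hH, hwt⟩ := S.exists_height hψ hg hcart
  have h1 : ∀ a ≠ 0, ∀ x ∈ S.deg a, x ∈ part (K := ℂ) (V := g) 0 → x ≠ 0 →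
      S.wt a (-σ H) = height a := by
    intro a ha x hx hx0 hne
    have h2 := hwt _ (IsRealStructure.comp_ne_zero d ha) _ (hσ.map_deg hx) (hσ.map_part hx0)
      (hσ.map_ne_zero hne)
    have h3 := hσ.wt_map (hσ.map_cartan hH) a
    rw [hσ.invol] at h3
    rw [wt_neg, LinearMap.neg_apply, h3, height_neg, height_comp, neg_neg] at h2
    have h4 := congrArg (starRingEnd ℂ) h2
    rw [Complex.conj_conj] at h4
    rw [map_neg, h4]
    simp
  set H₁ := (1 / 2 : ℂ) • (H - σ H) with hH₁
  have hH₁m : H₁ ∈ h := Submodule.smul_mem _ _ (sub_mem hH (hσ.map_cartan hH))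
  have hσH₁ : σ H₁ = -H₁ := by
    rw [hH₁, map_smulₛₗ, map_sub, hσ.invol]
    simp only [map_div₀, map_one, map_ofNat, ← smul_neg, neg_sub]
  have hwt₁ : ∀ a ≠ 0, ∀ x ∈ S.deg a, x ∈ part (K := ℂ) (V := g) 0 → x ≠ 0 →
      S.wt a H₁ = height a := by
    intro a ha x hx hx0 hne
    rw [hH₁, map_smul, sub_eq_add_neg, map_add, hwt a ha x hx hx0 hne, h1 a ha x hx hx0 hne,
      smul_eq_mul]
    ring
  refine ⟨(1 / 2 : ℂ) • (H₁ - ψ H₁),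
    Submodule.smul_mem _ _ (sub_mem hH₁m (hψ.map_cartan hH₁m)), ?_, ?_, ?_⟩
  · rw [map_smulₛₗ, map_sub, hσ.comm_cartan hH₁m, hσH₁, map_neg]
    simp only [map_div₀, map_one, map_ofNat, ← smul_neg]
    congr 1
    abel
  · rw [map_smulₛₗ, map_sub, hψ.even_invol _ (S.even_of_mem hH₁m)]
    simp only [map_div₀, map_one, map_ofNat, ← smul_neg, neg_sub]
  · intro a ha x hx hx0 hne
    have h5 := hwt₁ a ha x hx hx0 hne
    rw [map_smul, map_sub, hψ.wt_map hH₁m, h5, smul_eq_mul, map_intCast]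
    ring

end SimpleSystem

/-! ### Commuting subspaces of compact Lie algebras -/

section Compact

open NormedSpace

variable {E : Type*} [NormedAddCommGroup E] [InnerProductSpace ℝ E] [FiniteDimensional ℝ E]

/-- A Lie bracket on a Euclidean space for which the inner product is invariant. -/
structure IsCompactBracket (β : E →L[ℝ] E →L[ℝ] E) : Prop where
  skew : ∀ x y, β x y = -β y x
  jacobi : ∀ x y z, β x (β y z) = β (β x y) z + β y (β x z)
  inv : ∀ x y z, inner ℝ (β x y) z = inner ℝ x (β y z)

/-- Isometric automorphisms of a bracket that fix every element of `l`. -/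
structure IsIsoFixing (β : E →L[ℝ] E →L[ℝ] E) (l : List E) (T : E →L[ℝ] E) : Prop where
  map : ∀ x y, T (β x y) = β (T x) (T y)
  isometry : ∀ x y, inner ℝ (T x) (T y) = inner ℝ x y
  fix : ∀ Y ∈ l, T Y = Y

variable {β : E →L[ℝ] E →L[ℝ] E}

omit [FiniteDimensional ℝ E] in
theorem IsIsoFixing.norm_map {l : List E} {T : E →L[ℝ] E} (hT : IsIsoFixing β l T) (x : E) :
    ‖T x‖ = ‖x‖ := by
  have := hT.isometry x x
  rw [real_inner_self_eq_norm_sq, real_inner_self_eq_norm_sq] at this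
  exact (sq_eq_sq₀ (norm_nonneg _) (norm_nonneg _)).mp this

theorem isCompact_isIsoFixing (β : E →L[ℝ] E →L[ℝ] E) (l : List E) :
    IsCompact {T : E →L[ℝ] E | IsIsoFixing β l T} := by
  have : ProperSpace (E →L[ℝ] E) := FiniteDimensional.proper ℝ _
  refine Metric.isCompact_of_isClosed_isBounded ?_ ?_
  · have : {T : E →L[ℝ] E | IsIsoFixing β l T} =
        (⋂ x, ⋂ y, {T | T (β x y) = β (T x) (T y)}) ∩
        ((⋂ x, ⋂ y, {T | inner ℝ (T x) (T y) = inner ℝ x y}) ∩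
          ⋂ Y, ⋂ (_ : Y ∈ l), {T | T Y = Y}) := by
      ext T
      simp only [Set.mem_ofPred_eq, Set.mem_inter_iff, Set.mem_iInter]
      exact ⟨fun hT => ⟨hT.map, hT.isometry, hT.fix⟩, fun hT => ⟨hT.1, hT.2.1, hT.2.2⟩⟩
    rw [this]
    refine IsClosed.inter (isClosed_iInter fun x => isClosed_iInter fun y => ?_)
      (IsClosed.inter (isClosed_iInter fun x => isClosed_iInter fun y => ?_)
        (isClosed_iInter fun Y => isClosed_iInter fun _ => ?_))
    · exact isClosed_eq (by fun_prop) (by fun_prop)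
    · exact isClosed_eq (by fun_prop) (by fun_prop)
    · exact isClosed_eq (by fun_prop) (by fun_prop)
  · refine (Metric.isBounded_closedBall (x := (0 : E →L[ℝ] E)) (r := 1)).subset fun T hT => ?_
    rw [mem_closedBall_zero_iff]
    refine T.opNorm_le_bound zero_le_one fun x => ?_
    rw [IsIsoFixing.norm_map hT, one_mul]

theorem hasDerivAt_exp_smul_apply (A : E →L[ℝ] E) (x : E) (s : ℝ) :
    HasDerivAt (fun s : ℝ => exp (s • A) x) (A (exp (s • A) x)) s :=
  (hasDerivAt_exp_smul_const' (𝕂 := ℝ) A s).clm_apply (hasDerivAt_const s x) |>.congr_deriv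
    (by simp)

theorem eq_apply_zero_of_hasDerivAt_zero {F : Type*} [NormedAddCommGroup F] [NormedSpace ℝ F]
    {u : ℝ → F} (hu : ∀ s, HasDerivAt u 0 s) (s : ℝ) : u s = u 0 :=
  is_const_of_deriv_eq_zero (fun s => (hu s).differentiableAt) (fun s => (hu s).deriv) s 0

/-- Each of the three properties says that a function of `s` with zero derivative is constant; for
the bracket the function is `exp(-s ad Z) [exp(s ad Z) x, exp(s ad Z) y]`. -/
theorem IsCompactBracket.isIsoFixing_exp (hβ : IsCompactBracket β) {l : List E} {Z : E}
    (hZ : ∀ Y ∈ l, β Z Y = 0) (s : ℝ) : IsIsoFixing β l (exp (s • β Z)) := by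
  have hd := hasDerivAt_exp_smul_apply (β Z)
  have hskew : ∀ x y, inner ℝ (β Z x) y = -inner ℝ x (β Z y) := fun x y => by
    rw [hβ.skew, inner_neg_left, hβ.inv]
  refine ⟨fun x y => ?_, fun x y => ?_, fun Y hY => ?_⟩
  · have hu : ∀ s, HasDerivAt
        (fun s : ℝ => exp (s • -β Z) (β (exp (s • β Z) x) (exp (s • β Z) y))) 0 s := by
      intro s
      have h1 := (β.hasFDerivAt.comp_hasDerivAt s (hd x s)).clm_apply (hd y s)
      have h2 := (hasDerivAt_exp_smul_const (𝕂 := ℝ) (-β Z) s).clm_apply h1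
      refine h2.congr_deriv ?_
      simp only [mul_apply_eq_comp, Function.comp_apply, neg_apply,
        map_neg]
      rw [hβ.jacobi Z]
      simp
    have h0 := eq_apply_zero_of_hasDerivAt_zero hu s
    simp only [zero_smul, exp_zero, one_apply_eq_self] at h0
    let _ : NormedAlgebra ℚ (E →L[ℝ] E) := NormedAlgebra.restrictScalars ℚ ℝ _
    rw [← h0, ← mul_apply_eq_comp, smul_neg, ← exp_add_of_commute
      (Commute.neg_right (Commute.refl _)), add_neg_cancel, exp_zero,
      one_apply_eq_self]
  · have hu : ∀ s, HasDerivAt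
        (fun s : ℝ => inner ℝ (exp (s • β Z) x) (exp (s • β Z) y)) 0 s := by
      intro s
      refine ((hd x s).inner ℝ (hd y s)).congr_deriv ?_
      rw [hskew]
      ring
    have h0 := eq_apply_zero_of_hasDerivAt_zero hu s
    simpa using h0
  · have hu : ∀ s, HasDerivAt (fun s : ℝ => exp (s • β Z) Y) 0 s := by
      intro s
      refine ((hasDerivAt_exp_smul_const (𝕂 := ℝ) (β Z) s).clm_apply
        (hasDerivAt_const s Y)).congr_deriv ?_
      simp [hZ Y hY]
    have h0 := eq_apply_zero_of_hasDerivAt_zero hu s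
    simpa using h0

/-- Any element can be moved by an isometric automorphism into the centralizer of finitely many
commuting elements. -/
theorem IsCompactBracket.exists_commute (hβ : IsCompactBracket β) (H : E) (l : List E)
    (hl : ∀ X ∈ l, ∀ Y ∈ l, β X Y = 0) :
    ∃ T, IsIsoFixing β [] T ∧ ∀ X ∈ l, β (T H) X = 0 := by
  induction l with
  | nil => exact ⟨ContinuousLinearMap.id ℝ E, ⟨by simp, by simp, by simp⟩, by simp⟩
  | cons X l ih =>
    obtain ⟨T, hT, hTl⟩ := ih fun X hX Y hY => hl X (List.mem_cons_of_mem _ hX) Y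
      (List.mem_cons_of_mem _ hY)
    -- Among the isometric automorphisms fixing `l`, a compact set, take one that brings `T H`
    -- closest to `X` in the sense of maximal inner product.
    obtain ⟨R, hR, hmax⟩ := (isCompact_isIsoFixing β l).exists_isMaxOn
      ⟨ContinuousLinearMap.id ℝ E, ⟨by simp, by simp, by simp⟩⟩
      (f := fun R : E →L[ℝ] E => inner ℝ (R (T H)) X) (by fun_prop)
    have hR : IsIsoFixing β l R := hR
    set K := R (T H) with hK
    have hKl : ∀ Y ∈ l, β K Y = 0 := fun Y hY => by
      rw [hK, ← hR.fix Y hY, ← hR.map, hTl Y hY, map_zero]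
    -- The flow of `[K, X]` stays among the automorphisms fixing `l`. At the maximum its derivative
    -- `⟨[[K, X], K], X⟩ = ‖[K, X]‖²` must vanish.
    have hZl : ∀ Y ∈ l, β (β K X) Y = 0 := fun Y hY => by
      have h1 := hβ.jacobi K X Y
      rw [hl X List.mem_cons_self Y (List.mem_cons_of_mem _ hY), hKl Y hY, map_zero,
        map_zero, add_zero] at h1
      exact h1.symm
    have hder : HasDerivAt (fun s : ℝ => inner ℝ (exp (s • β (β K X)) K) X)
        (inner ℝ (β (β K X) K) X) 0 := by
      refine ((hasDerivAt_exp_smul_apply (β (β K X)) K 0).inner ℝ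
        (hasDerivAt_const 0 X)).congr_deriv ?_
      simp
    have hloc : IsLocalMax (fun s : ℝ => inner ℝ (exp (s • β (β K X)) K) X) 0 := by
      refine Filter.Eventually.of_forall fun s => ?_
      have hs := hβ.isIsoFixing_exp hZl s
      have := hmax (show IsIsoFixing β l (exp (s • β (β K X)) * R) from
        ⟨fun x y => by simp [hR.map, hs.map], fun x y => by simp [hs.isometry, hR.isometry],
          fun Y hY => by simp [hR.fix Y hY, hs.fix Y hY]⟩)
      simpa using this
    have h0 := hloc.hasDerivAt_eq_zero hder
    rw [hβ.inv, inner_self_eq_zero] at h0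
    refine ⟨R * T, ⟨fun x y => by simp [hR.map, hT.map], fun x y => by
      simp [hR.isometry, hT.isometry], by simp⟩, fun Y hY => ?_⟩
    rcases List.mem_cons.mp hY with rfl | hY
    · exact h0
    · exact hKl Y hY

/-- A commuting subspace has dimension at most that of the centralizer of any element. -/
theorem IsCompactBracket.finrank_le (hβ : IsCompactBracket β) (H : E) (t : Submodule ℝ E)
    (ht : ∀ X ∈ t, ∀ Y ∈ t, β X Y = 0) :
    Module.finrank ℝ t ≤ Module.finrank ℝ (LinearMap.ker (β H).toLinearMap) := by
  obtain ⟨s, hs⟩ := (Submodule.fg_def.mp (IsNoetherian.noetherian t))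
  obtain ⟨hfin, hspan⟩ := hs
  obtain ⟨T, hT, hTl⟩ := hβ.exists_commute H hfin.toFinset.toList (fun X hX Y hY => by
    simp only [Finset.mem_toList, Set.Finite.mem_toFinset] at hX hY
    exact ht X (hspan ▸ Submodule.subset_span hX) Y (hspan ▸ Submodule.subset_span hY))
  have hinj : Function.Injective T.toLinearMap := by
    rw [← LinearMap.ker_eq_bot, LinearMap.ker_eq_bot']
    intro x hx
    rw [← norm_eq_zero, ← hT.norm_map x]
    exact norm_eq_zero.mpr hx
  have hsurj : Function.Surjective T.toLinearMap := LinearMap.surjective_of_injective hinj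
  -- An element `T Y` of the spanning set commutes with `T H`, so `Y` commutes with `H`: thus `T`
  -- carries the centralizer of `H` onto a space containing `t`.
  have hle : t ≤ (LinearMap.ker (β H).toLinearMap).map T.toLinearMap := by
    rw [← hspan]
    refine Submodule.span_le.mpr fun X hX => ?_
    obtain ⟨Y, rfl⟩ := hsurj X
    refine ⟨Y, ?_, rfl⟩
    have h1 := hTl (T Y) (by simpa using hX)
    rw [← hT.map] at h1
    exact hinj (by simpa using h1)
  exact (Submodule.finrank_mono hle).trans (Submodule.finrank_map_le _ _)

end Compact

/-! ### Nilpotent subalgebras and compact subalgebras of a real Lie algebra -/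

section RealLie

variable {L : Type*} [LieRing L] [LieAlgebra ℝ L]

/-- On `k` the operator `ad X` is skew for a definite form, so its kernel and the kernels of its
powers coincide. -/
theorem lie_eq_zero_of_pow_eq_zero {k : LieSubalgebra ℝ L} {κ : LinearMap.BilinForm ℝ L}
    (hinv : ∀ X Y Z, κ ⁅X, Y⁆ Z = κ X ⁅Y, Z⁆) (hneg : ∀ X ∈ k, X ≠ 0 → κ X X < 0) {X Y : L}
    (hX : X ∈ k) (hY : Y ∈ k) {n : ℕ} (hn : ((LieAlgebra.ad ℝ L X) ^ n) Y = 0) : ⁅X, Y⁆ = 0 := by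
  have hmem : ∀ m : ℕ, ((LieAlgebra.ad ℝ L X) ^ m) Y ∈ k := by
    intro m
    induction m with
    | zero => simpa using hY
    | succ m ih =>
      rw [pow_succ', Module.End.mul_apply, LieAlgebra.ad_apply]
      exact k.lie_mem hX ih
  have hskew : ∀ u v, κ ⁅X, u⁆ v = -κ u ⁅X, v⁆ := fun u v => by
    rw [← lie_skew, map_neg, LinearMap.neg_apply, hinv]
  have key : ∀ m : ℕ, ((LieAlgebra.ad ℝ L X) ^ (m + 1)) Y = 0 → ⁅X, Y⁆ = 0 := by
    intro m
    induction m with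
    | zero => intro h; simpa using h
    | succ m ih =>
      intro h
      refine ih ?_
      by_contra hne
      have h1 := hneg _ (hmem (m + 1)) hne
      have h2 : κ (((LieAlgebra.ad ℝ L X) ^ (m + 1)) Y) (((LieAlgebra.ad ℝ L X) ^ (m + 1)) Y) =
          -κ (((LieAlgebra.ad ℝ L X) ^ m) Y) (((LieAlgebra.ad ℝ L X) ^ (m + 1 + 1)) Y) := by
        rw [pow_succ' _ (m + 1), Module.End.mul_apply, LieAlgebra.ad_apply, ← hskew]
        congr 2
        rw [pow_succ', Module.End.mul_apply, LieAlgebra.ad_apply]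
      rw [h, map_zero, neg_zero] at h2
      exact h1.ne h2
  refine key n ?_
  rw [pow_succ', Module.End.mul_apply, hn, map_zero]

/-- The intersection of a nilpotent subalgebra with a compactly embedded subalgebra has dimension
at most that of the centralizer of any element of the latter. -/
theorem finrank_inf_le_of_isNilpotent [FiniteDimensional ℝ L] {k : LieSubalgebra ℝ L}
    {κ : LinearMap.BilinForm ℝ L}
    (hsymm : ∀ X Y, κ X Y = κ Y X) (hinv : ∀ X Y Z, κ ⁅X, Y⁆ Z = κ X ⁅Y, Z⁆)
    (hneg : ∀ X ∈ k, X ≠ 0 → κ X X < 0) {H : L} (hH : H ∈ k) (h' : LieSubalgebra ℝ L)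
    [LieRing.IsNilpotent h'] (t : Submodule ℝ L) (ht : ∀ X ∈ k, ⁅H, X⁆ = 0 → X ∈ t) :
    Module.finrank ℝ ↥(h'.toSubmodule ⊓ k.toSubmodule) ≤ Module.finrank ℝ t := by
  -- Nilpotency of `h'` makes `ad X` nilpotent on `h'`, and it is skew on `k`; so the intersection
  -- is commutative and the Euclidean bound applies to it.
  have hcomm : ∀ X ∈ h', X ∈ k → ∀ Y ∈ h', Y ∈ k → ⁅X, Y⁆ = 0 := by
    intro X hX hXk Y hY hYk
    obtain ⟨n, hn⟩ := LieModule.isNilpotent_toEnd_of_isNilpotent ℝ h' h' ⟨X, hX⟩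
    have hpow : ∀ m : ℕ, ((((LieModule.toEnd ℝ h' h' ⟨X, hX⟩) ^ m) ⟨Y, hY⟩ : h') : L) =
        ((LieAlgebra.ad ℝ L X) ^ m) Y := by
      intro m
      induction m with
      | zero => simp
      | succ m ih =>
        rw [pow_succ', Module.End.mul_apply, pow_succ', Module.End.mul_apply, ← ih]
        rfl
    refine lie_eq_zero_of_pow_eq_zero hinv hneg hXk hYk (n := n) ?_
    rw [← hpow, hn]
    rfl
  let core : InnerProductSpace.Core ℝ k :=
    { inner := fun X Y => -κ X Y
      conj_inner_symm := fun X Y => by simp [hsymm (X : L) Y]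
      re_inner_nonneg := fun X => by
        by_cases h0 : X = 0
        · simp [h0]
        · have := hneg X X.2 (fun h => h0 (Subtype.ext h))
          simpa using this.le
      add_left := fun X Y Z => by simp [add_comm]
      smul_left := fun X Y r => by simp
      definite := fun X hX => by
        by_contra h0
        have := hneg X X.2 (fun h => h0 (Subtype.ext h))
        exact this.ne (neg_eq_zero.mp hX) }
  let _ : NormedAddCommGroup k := core.toNormedAddCommGroup
  let _ : InnerProductSpace ℝ k := InnerProductSpace.ofCore core.toCore
  have hinner : ∀ X Y : k, inner ℝ X Y = -κ X Y := fun X Y => rfl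
  let b : k →ₗ[ℝ] k →ₗ[ℝ] k := LinearMap.mk₂ ℝ (fun X Y => ⁅X, Y⁆) (by simp) (by simp) (by simp)
    (by simp)
  let β : k →L[ℝ] k →L[ℝ] k := LinearMap.toContinuousLinearMap
    ((LinearMap.toContinuousLinearMap (𝕜 := ℝ) (E := k) (F' := k)).toLinearMap ∘ₗ b)
  have hβ : ∀ X Y : k, β X Y = ⁅X, Y⁆ := fun X Y => rfl
  have hc : IsCompactBracket β :=
    { skew := fun X Y => by rw [hβ, hβ, lie_skew]
      jacobi := fun X Y Z => by simp only [hβ]; exact leibniz_lie X Y Z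
      inv := fun X Y Z => by
        rw [hβ, hβ, hinner, hinner]
        exact congrArg Neg.neg (hinv X Y Z) }
  have h1 := hc.finrank_le ⟨H, hH⟩ (h'.toSubmodule.comap k.toSubmodule.subtype)
    (fun X hX Y hY => Subtype.ext (hcomm X hX X.2 Y hY Y.2))
  have e1 : Module.finrank ℝ ↥(h'.toSubmodule.comap k.toSubmodule.subtype) =
      Module.finrank ℝ ↥(h'.toSubmodule ⊓ k.toSubmodule) := by
    rw [inf_comm, ← Submodule.map_comap_subtype]
    exact (LinearEquiv.finrank_eq (Submodule.equivMapOfInjective k.toSubmodule.subtype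
      k.toSubmodule.injective_subtype _))
  rw [← e1]
  refine h1.trans ?_
  let ι : LinearMap.ker (β ⟨H, hH⟩).toLinearMap →ₗ[ℝ] t :=
    { toFun := fun X => ⟨X, ht X X.1.2 (congrArg Subtype.val (LinearMap.mem_ker.mp X.2))⟩
      map_add' := fun _ _ => rfl
      map_smul' := fun _ _ => rfl }
  refine LinearMap.finrank_le_finrank_of_injective (f := ι) fun X Y hXY => ?_
  have h2 : ((ι X : t) : L) = (ι Y : t) := by rw [hXY]
  exact Subtype.ext (Subtype.ext h2)

end RealLie

/-! ### Existence of the antilinear automorphisms -/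

namespace SimpleSystem

variable {ι : Type*} [Fintype ι] [DecidableEq ι] {D : SuperDynkin ι} {g : Type*}
  [AddCommGroup g] [Module ℂ g] [LieSuperalgebra ℂ g] {h : Submodule ℂ g}
  (S : SimpleSystem D h)

/-- The scalars `-1` and minus the super sign satisfy the normalization with trivial permutation and
row factors `1`. The square of `ψ` is the identity on even degrees and `-1` on odd ones. -/
theorem exists_isChevalleyFlip (hsim : IsSimple g) (hcart : SelfCentralizing h) :
    ∃ ψ : g →ₛₗ[starRingEnd ℂ] g, S.IsChevalleyFlip ψ ∧ (∀ i, ψ (S.e i) = -S.f i) ∧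
      ∀ i, ψ (S.f i) = -(superSign (D.parity i) (D.parity i) • S.e i) := by
  obtain ⟨ψ, h1, h2, h3⟩ := S.exists_antilinear hsim hcart 1 (fun i => rfl) (fun _ => 1)
    (by simp) (fun _ => -1) (fun i => -(superSign (D.parity i) (D.parity i) : ℂ)) (fun i => by
      have := superSign_mul_self (D.parity i) (D.parity i)
      have h' : (superSign (D.parity i) (D.parity i) : ℂ) *
          superSign (D.parity i) (D.parity i) = 1 := by exact_mod_cast this
      push_cast
      linear_combination h')
  have he : ∀ i, ψ (S.e i) = -S.f i := fun i => by rw [h2]; simp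
  have hf : ∀ i, ψ (S.f i) = -(superSign (D.parity i) (D.parity i) • S.e i) := fun i => by
    rw [h3, neg_smul, Int.cast_smul_eq_zsmul]; simp
  have hsq : ∀ a, ∀ x ∈ S.deg a,
      ψ (ψ x) = superSign (D.degParity a) (D.degParity a) • x := by
    intro a x hx
    refine S.deg_induction
      (P := fun a x => ψ (ψ x) = superSign (D.degParity a) (D.degParity a) • x) (by simp)
      (fun a x y hx hy => by simp only [map_add, hx, hy, smul_add])
      (fun a c x hx => by rw [map_smulₛₗ, map_smulₛₗ, hx, Complex.conj_conj, smul_comm])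
      (fun i => ?_) (fun i => ?_) (fun a b x y _ _ hx hy => ?_) hx
    · have : D.degParity (Pi.single i 1) = D.parity i := by
        simp [SuperDynkin.degParity, Pi.single_apply]
      rw [this, he, map_neg, hf, neg_neg]
    · have : D.degParity (-Pi.single i 1) = D.parity i := by
        simp [SuperDynkin.degParity, Pi.single_apply]
      rw [this, hf, map_neg, map_zsmul, he, smul_neg, neg_neg]
    · have : D.degParity (a + b) = D.degParity a + D.degParity b := by
        simp [SuperDynkin.degParity, add_mul, Finset.sum_add_distrib]
      have hmul : ∀ q q' : ZMod 2, superSign (q + q') (q + q') =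
          superSign q q * superSign q' q' := by unfold superSign; decide
      rw [h1, h1, hx, hy, this, hmul, map_zsmul, map_zsmul, LinearMap.smul_apply, smul_smul,
        mul_comm]
  refine ⟨ψ, ⟨⟨_, _, h1, h2, h3, by simp, fun i => rfl⟩, fun x hx => ?_, ?_⟩, he, hf⟩
  · refine S.part_induction (P := fun x => ψ (ψ x) = x) (by simp)
      (fun x y hx hy => by simp only [map_add, hx, hy]) (fun a x ha hx => ?_) hx
    by_cases hx0 : x = 0
    · simp [hx0]
    have : D.degParity a = 0 := by
      by_contra hne
      exact hx0 (eq_zero_of_mem_part_ne hne (S.deg_le_part ha) hx)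
    rw [hsq a x ha, this, superSign_zero_left, one_smul]
  -- Because of the sign on the odd part, bijectivity is read off from the fourth power.
  · have h4 : ∀ x, ψ (ψ (ψ (ψ x))) = x := S.homog_induction (by simp)
      (fun x y hx hy => by simp only [map_add, hx, hy]) fun a x ha => by
        rw [hsq a x ha, map_zsmul, map_zsmul, hsq a x ha, smul_smul, superSign_mul_self, one_smul]
    exact ⟨Function.LeftInverse.injective (g := fun x => ψ (ψ (ψ x))) h4,
      Function.RightInverse.surjective (g := fun x => ψ (ψ (ψ x))) h4⟩

end SimpleSystem

/-! ### Scalars for the real structure. -/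

namespace AbstractVogan

variable {ι : Type*} {D : SuperDynkin ι}

/-- The row scaling of a diagram automorphism of order at most two can be chosen compatible with
the involution. -/
theorem exists_scaling (A : AbstractVogan D) :
    ∃ r : ι → ℝ, (∀ i, r i * r (A.aut i) = 1) ∧ (∀ i, D.parity i = 0 → r i = 1) ∧
      ∀ i j, D.cartan (A.aut i) (A.aut j) = r i * D.cartan i j := by
  classical
  obtain ⟨hp, r, hr0, hr⟩ := A.isAutomorphism
  have hzero : ∀ i, (∃ j, D.cartan (A.aut i) j ≠ 0) ↔ ∃ j, D.cartan i j ≠ 0 := by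
    intro i
    constructor
    · rintro ⟨j, hj⟩
      refine ⟨A.aut j, fun h0 => hj ?_⟩
      have := hr i (A.aut j)
      rwa [A.involutive, h0, mul_zero] at this
    · rintro ⟨j, hj⟩
      exact ⟨A.aut j, by rw [hr]; exact mul_ne_zero (hr0 i) hj⟩
  -- A zero row does not constrain its factor, which is reset to `1`. For a nonzero row, applying
  -- the involution twice forces `r i * r (d i) = 1`.
  refine ⟨fun i => if ∃ j, D.cartan i j ≠ 0 then r i else 1, fun i => ?_, fun i hi => ?_,
    fun i j => ?_⟩
  · simp only [hzero]
    split_ifs with hi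
    · obtain ⟨j, hj⟩ := hi
      have h1 := hr (A.aut i) (A.aut j)
      rw [A.involutive, A.involutive, hr] at h1
      have h2 : (r i * r (A.aut i) - 1) * D.cartan i j = 0 := by linear_combination -h1
      exact sub_eq_zero.mp ((mul_eq_zero.mp h2).resolve_right hj)
    · simp
  · simp only
    split_ifs with hi'
    · have h1 := hr i i
      rw [D.diag_even i hi, D.diag_even _ ((hp i).trans hi)] at h1
      linarith
    · rfl
  · simp only
    split_ifs with hi
    · exact hr i j
    · push Not at hi
      rw [hr, hi j, mul_zero, mul_zero]

/-- Scalars `c i` for the real structure `e i ↦ c i • f (d i)`. -/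
theorem exists_scalars (A : AbstractVogan D) :
    ∃ (r : ι → ℝ) (c c' : ι → ℂ) (s : ι → ℤˣ),
      (∀ i j, D.cartan (A.aut i) (A.aut j) = r i * D.cartan i j) ∧
      (∀ i, c i * c' i * superSign (D.parity i) (D.parity i) * r i = 1) ∧
      (∀ i, starRingEnd ℂ (c i) * c' (A.aut i) = 1) ∧
      (∀ i, c' i = (s i : ℤ) * superSign (D.parity i) (D.parity i) * starRingEnd ℂ (c i)) ∧
      (∀ i, i ∈ A.painted → c i = 1) ∧
      (∀ i, D.parity i = 0 → i ∉ A.painted → c i = -1) := by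
  classical
  obtain ⟨r, hrr, hre, hr⟩ := A.exists_scaling
  have hp := A.isAutomorphism.1
  set ε : ι → ℤ := fun i => superSign (D.parity i) (D.parity i) with hε
  have hεε : ∀ i, (ε i : ℂ) * ε i = 1 := fun i => by
    have := superSign_mul_self (D.parity i) (D.parity i)
    exact_mod_cast this
  have hε1 : ∀ i, ε i = 1 ∨ ε i = -1 := fun i => by
    simp only [hε, superSign]; split_ifs <;> simp
  have hεd : ∀ i, ε (A.aut i) = ε i := fun i => by simp only [hε, hp]
  have hr0 : ∀ i, r i ≠ 0 := fun i h0 => by simpa [h0] using hrr i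
  -- With `c = u / √|r|`, the normalization determines `c'`, and involutivity of `σ` becomes `conj u
  -- * (ε r) = u * |r|`. So `u` must be real if `ε r > 0` and imaginary if `ε r < 0`; at even
  -- vertices the real sign remains free and records the painting.
  let u : ι → ℂ := fun i => if (ε i : ℝ) * r i < 0 then Complex.I
    else if i ∈ A.painted then 1 else -1
  let m : ι → ℝ := fun i => Real.sqrt |r i|
  have hm0 : ∀ i, m i ≠ 0 := fun i => (Real.sqrt_pos.mpr (abs_pos.mpr (hr0 i))).ne'
  have hmm : ∀ i, m i * m i = |r i| := fun i => Real.mul_self_sqrt (abs_nonneg _)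
  have hmd : ∀ i, m i * m (A.aut i) = 1 := fun i => by
    simp only [m]
    rw [← Real.sqrt_mul (abs_nonneg _), ← abs_mul, hrr, abs_one, Real.sqrt_one]
  have hpaint : ∀ i, A.aut i ∈ A.painted ↔ i ∈ A.painted := by
    intro i
    constructor
    · intro hi
      have := A.painted_fixed _ hi
      rw [A.involutive] at this
      rwa [← this] at hi
    · intro hi
      rwa [A.painted_fixed i hi]
  have hsign : ∀ i, (ε (A.aut i) : ℝ) * r (A.aut i) < 0 ↔ (ε i : ℝ) * r i < 0 := by
    intro i
    rw [hεd]
    have h1 := hrr i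
    have h2 : 0 < r i * r (A.aut i) := by rw [h1]; exact one_pos
    rcases hε1 i with h | h <;> rw [h] <;> push_cast <;>
      rcases pos_and_pos_or_neg_and_neg_of_mul_pos h2 with ⟨h3, h4⟩ | ⟨h3, h4⟩ <;>
      constructor <;> intro h5 <;> linarith
  have hud : ∀ i, u (A.aut i) = u i := fun i => by simp only [u, hsign, hpaint]
  have hunorm : ∀ i, u i * starRingEnd ℂ (u i) = 1 := by
    intro i
    simp only [u]
    split_ifs <;> simp
  have huconj : ∀ i, starRingEnd ℂ (u i) * (ε i * r i) = u i * |r i| := by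
    intro i
    have habs : |r i| = |(ε i : ℝ) * r i| := by
      rcases hε1 i with h | h <;> simp [h]
    simp only [u]
    split_ifs with h1 h2
    · rw [habs, abs_of_neg h1]; push_cast; simp
    · rw [habs, abs_of_nonneg (not_lt.mp h1)]; push_cast; simp
    · rw [habs, abs_of_nonneg (not_lt.mp h1)]; push_cast; simp
  have hu0 : ∀ i, u i ≠ 0 := fun i h0 => by simpa [h0] using hunorm i
  have hmC : ∀ i, (m i : ℂ) ≠ 0 := fun i => by exact_mod_cast hm0 i
  have hrC : ∀ i, (r i : ℂ) ≠ 0 := fun i => by exact_mod_cast hr0 i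
  have hεC : ∀ i, (ε i : ℂ) ≠ 0 := fun i h0 => by simpa [h0] using hεε i
  have hmmC : ∀ i, (m i : ℂ) * m i = |r i| := fun i => by exact_mod_cast hmm i
  have hmdC : ∀ i, (m i : ℂ) * m (A.aut i) = 1 := fun i => by exact_mod_cast hmd i
  have hrrC : ∀ i, (r i : ℂ) * r (A.aut i) = 1 := fun i => by exact_mod_cast hrr i
  -- The unit `s i` is the sign of `r i`; it measures how far `σ` is from commuting with `ψ` at
  -- vertex `i`.
  refine ⟨r, fun i => u i / m i, fun i => m i / (u i * ε i * r i),
    fun i => if 0 < r i then 1 else -1, hr, fun i => ?_, fun i => ?_, fun i => ?_, fun i hi => ?_,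
    fun i hi hi' => ?_⟩
  · change u i / m i * (m i / (u i * ε i * r i)) * (ε i : ℂ) * r i = 1
    have := hu0 i; have := hmC i; have := hrC i; have := hεC i
    field_simp
  · simp only [hud, map_div₀, Complex.conj_ofReal, hεd]
    have h1 := hu0 i; have h2 := hmC i; have h3 := hrC i; have h4 := hεC i
    have h5 := hrC (A.aut i)
    rw [div_mul_div_comm, div_eq_one_iff_eq (by positivity)]
    apply mul_right_cancel₀ (mul_ne_zero h2 (mul_ne_zero h4 h3))
    linear_combination (starRingEnd ℂ (u i) * (ε i * r i)) * hmdC i + huconj i -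
      (u i * (m i * m i)) * (hεε i) - u i * hmmC i -
      (u i * (ε i * ε i) * (m i * m i)) * hrrC i
  · change (m i : ℂ) / (u i * ε i * r i) = _ * (ε i : ℂ) * _
    have h1 := hu0 i; have h2 := hmC i; have h3 := hrC i; have h4 := hεC i
    have hs : (((if 0 < r i then 1 else -1 : ℤˣ) : ℤ) : ℂ) * r i = |r i| := by
      split_ifs with hpos
      · rw [abs_of_pos hpos]; simp
      · rw [abs_of_neg (lt_of_le_of_ne (not_lt.mp hpos) (hr0 i))]; simp
    rw [map_div₀, Complex.conj_ofReal, div_eq_iff (by positivity)]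
    field_simp
    linear_combination hmmC i - hs -
      ((((if 0 < r i then 1 else -1 : ℤˣ) : ℤ) : ℂ) * r i) *
        ((u i * starRingEnd ℂ (u i)) * hεε i + hunorm i)
  · have hr1 := hre i (A.painted_even i hi)
    have hε1 : ε i = 1 := by simp [hε, superSign, A.painted_even i hi]
    simp [u, m, hr1, hε1, hi]
  · have hr1 := hre i hi
    have hε1 : ε i = 1 := by simp [hε, superSign, hi]
    simp [u, m, hr1, hε1, hi']

end AbstractVogan

namespace SimpleSystem

variable {ι : Type*} [Fintype ι] [DecidableEq ι] {D : SuperDynkin ι} {g : Type*}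
  [AddCommGroup g] [Module ℂ g] [LieSuperalgebra ℂ g] {h : Submodule ℂ g}
  (S : SimpleSystem D h)

/-- Both `σ² = 1` and the commutation of `σ` with `ψ` up to sign are checked on the generators and
propagate through brackets. -/
theorem exists_isRealStructure (hsim : IsSimple g) (hcart : SelfCentralizing h)
    (A : AbstractVogan D) {ψ : g →ₛₗ[starRingEnd ℂ] g} (hψ : S.IsChevalleyFlip ψ)
    (hψe : ∀ i, ψ (S.e i) = -S.f i)
    (hψf : ∀ i, ψ (S.f i) = -(superSign (D.parity i) (D.parity i) • S.e i)) :
    ∃ σ : g →ₛₗ[starRingEnd ℂ] g, S.IsRealStructure ψ σ A.aut ∧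
      (∀ i ∈ A.painted, σ (S.e i) = S.f i) ∧
      ∀ i, A.aut i = i → D.parity i = 0 → i ∉ A.painted → σ (S.e i) = -S.f i := by
  obtain ⟨r, c, c', s, hr, hcc, hinv, hs, hpt, hnp⟩ := A.exists_scalars
  have hp := A.isAutomorphism.1
  obtain ⟨σ, h1, h2, h3⟩ := S.exists_antilinear hsim hcart A.aut hp r hr c c' hcc
  have hc0 : ∀ i, c i ≠ 0 := fun i h0 => by simpa [h0] using hcc i
  have hinvol : ∀ x, σ (σ x) = x := by
    have hgen : ∀ a, ∀ x ∈ S.deg a, σ (σ x) = x := by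
      intro a x hx
      refine S.deg_induction (P := fun a x => σ (σ x) = x) (by simp)
        (fun a x y hx hy => by simp only [map_add, hx, hy])
        (fun a c x hx => by rw [map_smulₛₗ, map_smulₛₗ, hx, Complex.conj_conj])
        (fun i => ?_) (fun i => ?_) (fun a b x y _ _ hx hy => by rw [h1, h1, hx, hy]) hx
      · rw [h2, map_smulₛₗ, h3, A.involutive, smul_smul, hinv, one_smul]
      · have h4 := congrArg (starRingEnd ℂ) (hinv (A.aut i))
        rw [A.involutive, map_mul, Complex.conj_conj, map_one] at h4
        rw [h3, map_smulₛₗ, h2, A.involutive, smul_smul, mul_comm, h4, one_smul]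
    exact S.homog_induction (by simp) (fun x y hx hy => by simp only [map_add, hx, hy]) hgen
  -- The character of the grading group with value `s i` at vertex `i`; multiplicativity is what
  -- lets the sign rule pass to brackets.
  let χ : (ι → ℤ) → ℤˣ := fun a => ∏ i, s i ^ a i
  have hχadd : ∀ a b, χ (a + b) = χ a * χ b := fun a b => by
    simp only [χ, Pi.add_apply, zpow_add, Finset.prod_mul_distrib]
  have hχsingle : ∀ i, χ (Pi.single i 1) = s i := fun i => by
    simp only [χ]
    rw [Finset.prod_eq_single i (fun j _ hj => by simp [hj]) (by simp)]
    simp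
  have hχneg : ∀ a, χ (-a) = χ a := fun a => by
    simp only [χ, Pi.neg_apply, zpow_neg, Int.units_inv_eq_self]
  refine ⟨σ, ⟨⟨c, c', h1, h2, h3, hc0, hp⟩, hinvol, fun a => ((χ a : ℤ) : ℝ), ?_, ?_, ?_⟩, ?_, ?_⟩
  · simp [χ]
  · intro a
    rcases Int.units_eq_one_or (χ a) with h | h <;> simp [h]
  · intro a x hx
    refine S.deg_induction (P := fun a x => σ (ψ x) = ((((χ a : ℤ) : ℝ) : ℂ)) • ψ (σ x)) (by simp)
      (fun a x y hx hy => by simp only [map_add, hx, hy, smul_add])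
      (fun a c x hx => by
        rw [map_smulₛₗ, map_smulₛₗ, hx, map_smulₛₗ, map_smulₛₗ, Complex.conj_conj, smul_comm])
      (fun i => ?_) (fun i => ?_) (fun a b x y _ _ hx hy => ?_) hx
    · rw [hψe, map_neg, h3, h2, map_smulₛₗ, hψf, hp, hχsingle, hs i, smul_neg, smul_neg,
        ← Int.cast_smul_eq_zsmul ℂ, smul_smul, smul_smul]
      congr 2
      push_cast
      ring
    · have hss : ((s i : ℤ) : ℂ) * ((s i : ℤ) : ℂ) = 1 := by
        rcases Int.units_eq_one_or (s i) with h | h <;> simp [h]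
      rw [hψf, map_neg, map_zsmul, h2, h3, map_smulₛₗ, hψe, hχneg, hχsingle, hs i, smul_neg,
        smul_neg, ← Int.cast_smul_eq_zsmul ℂ, smul_smul, smul_smul]
      congr 2
      simp only [map_mul, Complex.conj_conj, map_intCast]
      push_cast
      linear_combination -((superSign (D.parity i) (D.parity i) : ℂ) * c i) * hss
    · rw [hψ.map_sbr, h1, hx, hy, h1, hψ.map_sbr, hχadd, map_smul, map_smul, LinearMap.smul_apply,
        smul_smul]
      congr 1
      push_cast
      ring
  · intro i hi
    rw [h2, hpt i hi, A.painted_fixed i hi, one_smul]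
  · intro i hi hpi hnpi
    rw [h2, hnp i hpi hnpi, hi, neg_one_smul]

end SimpleSystem

/-! ### Transport along isomorphisms -/

/-- The radical of `L` corresponds to a solvable ideal of `L'`, which lies in the radical of `L'`
and hence in its centre. -/
theorem LieEquiv.radical_eq_center {R L L' : Type*} [CommRing R] [LieRing L] [LieAlgebra R L]
    [LieRing L'] [LieAlgebra R L'] [IsNoetherian R L] (φ : L ≃ₗ⁅R⁆ L')
    (hr : LieAlgebra.radical R L' = LieAlgebra.center R L') :
    LieAlgebra.radical R L = LieAlgebra.center R L := by
  have : IsNoetherian R L' :=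
    isNoetherian_of_linearEquiv (φ.toLinearEquiv : L ≃ₗ[R] L')
  refine le_antisymm (fun x hx => ?_) (LieAlgebra.center_le_radical R L)
  let I : LieIdeal R L' := (LieAlgebra.radical R L).comap φ.symm.toLieHom
  have hI : LieAlgebra.IsSolvable I := by
    let j : I →ₗ⁅R⁆ LieAlgebra.radical R L :=
      { toFun := fun y => ⟨φ.symm y, LieIdeal.mem_comap.mp y.2⟩
        map_add' := fun y z => by ext; simp
        map_smul' := fun c y => by ext; simp
        map_lie' := fun {y z} => Subtype.ext (φ.symm.toLieHom.map_lie y z) }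
    refine Function.Injective.lieAlgebra_isSolvable (f := j) fun y z hyz => ?_
    exact Subtype.ext (φ.symm.injective (congrArg Subtype.val hyz))
  have hxI : φ x ∈ I := LieIdeal.mem_comap.mpr (by simpa using hx)
  have hc : φ x ∈ LieAlgebra.center R L' := hr ▸ (LieAlgebra.LieIdeal.solvable_iff_le_radical R L' I).mp hI hxI
  rw [LieModule.mem_maxTrivSubmodule] at hc ⊢
  intro y
  apply φ.injective
  exact (φ.toLieHom.map_lie y x).trans ((hc _).trans φ.toLieHom.map_zero.symm)

namespace LieSuperalgebra

variable {g w : Type*} [AddCommGroup g] [Module ℂ g] [LieSuperalgebra ℂ g]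
  [AddCommGroup w] [Module ℂ w] [LieSuperalgebra ℂ w]

/-- A linear isomorphism of Lie superalgebras. -/
structure IsIso (Ψ : w ≃ₗ[ℂ] g) : Prop where
  map_sbr : ∀ x y, Ψ (x ◃ y) = Ψ x ◃ Ψ y
  mem_part : ∀ (q : ZMod 2) x, Ψ x ∈ part (K := ℂ) q ↔ x ∈ part (K := ℂ) q

namespace IsIso

variable {Ψ : w ≃ₗ[ℂ] g}

theorem symm_sbr (hΨ : IsIso Ψ) (x y : g) : Ψ.symm (x ◃ y) = Ψ.symm x ◃ Ψ.symm y := by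
  apply Ψ.injective
  simp [hΨ.map_sbr]

theorem symm_mem (hΨ : IsIso Ψ) {q : ZMod 2} {x : g} (hx : x ∈ part (K := ℂ) q) :
    Ψ.symm x ∈ part (K := ℂ) q := by
  rw [← hΨ.mem_part]
  simpa using hx

/-- An isomorphism of Lie superalgebras restricts to the even parts. -/
def evenEquiv (hΨ : IsIso Ψ) : EvenPart ℂ w ≃ₗ⁅ℂ⁆ EvenPart ℂ g where
  toFun x := ⟨Ψ x, (hΨ.mem_part 0 _).mpr x.2⟩
  map_add' x y := by ext; simp
  map_smul' c x := by ext; simp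
  map_lie' {x y} := by ext; simp [coe_lie, hΨ.map_sbr]
  invFun x := ⟨Ψ.symm x, hΨ.symm_mem x.2⟩
  left_inv x := by ext; simp
  right_inv x := by ext; simp

theorem isSimple (hΨ : IsIso Ψ) (hg : IsSimple g) : IsSimple w := by
  obtain ⟨⟨x, y, hxy⟩, hid⟩ := hg
  refine ⟨⟨Ψ.symm x, Ψ.symm y, fun h0 => hxy ?_⟩, fun I hI hgr => ?_⟩
  · rw [← hΨ.symm_sbr] at h0
    simpa using h0
  · have key : ∀ z, z ∈ I.map (Ψ : w →ₗ[ℂ] g) ↔ Ψ.symm z ∈ I := fun z => by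
      rw [Submodule.mem_map_equiv]
    have hmap : I.map (Ψ : w →ₗ[ℂ] g) = ⊥ ∨ I.map (Ψ : w →ₗ[ℂ] g) = ⊤ := by
      refine hid _ (fun z u hu => ?_) (le_antisymm (fun z hz => ?_) (sup_le inf_le_left inf_le_left))
      · rw [key] at hu ⊢
        rw [hΨ.symm_sbr]
        exact hI _ _ hu
      · rw [key, hgr] at hz
        obtain ⟨u, hu, v, hv, huv⟩ := Submodule.mem_sup.mp hz
        refine Submodule.mem_sup.mpr ⟨Ψ u, ⟨(key _).mpr (by simpa using hu.1),
          (hΨ.mem_part 0 u).mpr hu.2⟩, Ψ v, ⟨(key _).mpr (by simpa using hv.1),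
          (hΨ.mem_part 1 v).mpr hv.2⟩, ?_⟩
        rw [← map_add, huv, LinearEquiv.apply_symm_apply]
    rcases hmap with hmap | hmap
    · left
      rw [eq_bot_iff]
      intro z hz
      have : Ψ z ∈ I.map (Ψ : w →ₗ[ℂ] g) := (key _).mpr (by simpa using hz)
      rw [hmap] at this
      simpa using this
    · right
      rw [eq_top_iff]
      rintro z -
      have : Ψ z ∈ I.map (Ψ : w →ₗ[ℂ] g) := hmap ▸ trivial
      simpa using (key _).mp this

theorem isBasic (hΨ : IsIso Ψ) (hg : LieSuperalgebra.IsBasic g) : LieSuperalgebra.IsBasic w := by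
  have := hg.finite
  have : FiniteDimensional ℂ w := Ψ.symm.finiteDimensional
  refine ⟨inferInstance, hΨ.isSimple hg.simple, hΨ.evenEquiv.radical_eq_center hg.reductive, ?_⟩
  obtain ⟨B, hB⟩ := hg.form
  refine ⟨B.compl₁₂ (Ψ : w →ₗ[ℂ] g) (Ψ : w →ₗ[ℂ] g), ⟨fun x hx y hy => ?_, fun i j x y hx hy => ?_,
    fun x y z => ?_, ?_⟩⟩
  · exact hB.even _ ((hΨ.mem_part 0 x).mpr hx) _ ((hΨ.mem_part 1 y).mpr hy)
  · exact hB.supersymm _ _ _ _ ((hΨ.mem_part i x).mpr hx) ((hΨ.mem_part j y).mpr hy)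
  · simp only [LinearMap.compl₁₂_apply, LinearEquiv.coe_coe, hΨ.map_sbr, hB.invariant]
  · exact LinearMap.Nondegenerate.congr Ψ.symm Ψ.symm hB.nondegenerate

end IsIso

end LieSuperalgebra

namespace SimpleSystem

variable {ι : Type*} [Fintype ι] [DecidableEq ι] {D : SuperDynkin ι} {g w : Type*}
  [AddCommGroup g] [Module ℂ g] [LieSuperalgebra ℂ g] {h : Submodule ℂ g}
  [AddCommGroup w] [Module ℂ w] [LieSuperalgebra ℂ w]

/-- The pullback of a simple system along an isomorphism. -/
def pullback (S : SimpleSystem D h) {Ψ : w ≃ₗ[ℂ] g} (hΨ : IsIso Ψ) (k : Submodule ℂ w)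
    (hk : ∀ x, x ∈ k ↔ Ψ x ∈ h) : SimpleSystem D k where
  root i := S.root i ∘ₗ (Ψ : w →ₗ[ℂ] g).restrict fun x hx => (hk x).mp hx
  e i := Ψ.symm (S.e i)
  f i := Ψ.symm (S.f i)
  coroot i := ⟨Ψ.symm (S.coroot i), (hk _).mpr (by simp)⟩
  e_ne i := by simpa using S.e_ne i
  f_ne i := by simpa using S.f_ne i
  e_mem i := hΨ.symm_mem (S.e_mem i)
  f_mem i := hΨ.symm_mem (S.f_mem i)
  weight_e H i := by
    apply Ψ.injective
    simpa [hΨ.map_sbr, LinearMap.restrict_apply] using S.weight_e ⟨Ψ H, (hk _).mp H.2⟩ i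
  weight_f H i := by
    apply Ψ.injective
    simpa [hΨ.map_sbr, LinearMap.restrict_apply] using S.weight_f ⟨Ψ H, (hk _).mp H.2⟩ i
  e_f i := by simp [← hΨ.symm_sbr, S.e_f]
  e_f_ne i j hij := by simp [← hΨ.symm_sbr, S.e_f_ne i j hij]
  root_coroot i j := by
    rw [← S.root_coroot i j]
    simp only [LinearMap.comp_apply]
    congr 1
    ext
    simp
  generates I hI hef := by
    have htop := S.generates (I.map (Ψ : w →ₗ[ℂ] g))
      (fun x hx y hy => by
        rw [Submodule.mem_map_equiv] at hx hy ⊢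
        rw [hΨ.symm_sbr]
        exact hI _ hx _ hy)
      (fun i => by
        rw [Submodule.mem_map_equiv, Submodule.mem_map_equiv]
        exact hef i)
    rw [eq_top_iff]
    rintro z -
    have : Ψ z ∈ I.map (Ψ : w →ₗ[ℂ] g) := htop ▸ trivial
    rw [Submodule.mem_map_equiv] at this
    simpa using this
  deg a := (S.deg a).comap (Ψ : w →ₗ[ℂ] g)
  deg_internal := by
    have h1 := S.deg_internal
    rw [DirectSum.isInternal_submodule_iff_iSupIndep_and_iSup_eq_top] at h1 ⊢
    have hcomp : (fun a => (S.deg a).comap (Ψ : w →ₗ[ℂ] g)) =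
        Submodule.orderIsoMapComap Ψ.symm ∘ S.deg := by
      funext a
      ext x
      simp [Submodule.mem_map_equiv]
    rw [hcomp]
    refine ⟨(iSupIndep_map_orderIso_iff _).mpr h1.1, ?_⟩
    rw [show (⨆ a, (Submodule.orderIsoMapComap Ψ.symm ∘ S.deg) a) =
      Submodule.orderIsoMapComap Ψ.symm (⨆ a, S.deg a) from (OrderIso.map_iSup _ _).symm, h1.2]
    exact map_top _
  deg_sbr a b x hx y hy := by
    change Ψ (x ◃ y) ∈ S.deg (a + b)
    rw [hΨ.map_sbr]
    exact S.deg_sbr a b _ hx _ hy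
  deg_e i := by simpa using S.deg_e i
  deg_f i := by simpa using S.deg_f i
  deg_zero := by
    ext x
    rw [hk, Submodule.mem_comap, S.deg_zero]
    rfl

end SimpleSystem

/-! ### Real forms -/

namespace LieSuperalgebra

variable {g : Type*} [AddCommGroup g] [Module ℂ g]

/-- The real subspace of fixed points of an antilinear map. -/
def realForm (σ : g →ₛₗ[starRingEnd ℂ] g) : Submodule ℝ g where
  carrier := {x | σ x = x}
  add_mem' {x y} hx hy := by
    change σ (x + y) = x + y
    rw [map_add, show σ x = x from hx, show σ y = y from hy]
  zero_mem' := map_zero σ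
  smul_mem' r x hx := by
    change σ ((r : ℂ) • x) = (r : ℂ) • x
    rw [LinearMap.map_smulₛₗ, Complex.conj_ofReal, show σ x = x from hx]

theorem mem_realForm {σ : g →ₛₗ[starRingEnd ℂ] g} {x : g} : x ∈ realForm σ ↔ σ x = x := Iff.rfl

/-- A conjugation of a complex Lie superalgebra: an involutive antilinear automorphism. -/
class IsConjugation [LieSuperalgebra ℂ g] (σ : g →ₛₗ[starRingEnd ℂ] g) : Prop where
  invol : ∀ x, σ (σ x) = x
  map_sbr : ∀ x y, σ (x ◃ y) = σ x ◃ σ y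
  map_part : ∀ (q : ZMod 2), ∀ x ∈ part (K := ℂ) (V := g) q, σ x ∈ part (K := ℂ) q

variable [LieSuperalgebra ℂ g] (σ : g →ₛₗ[starRingEnd ℂ] g) [IsConjugation σ]

/-- The real part of an element with respect to a conjugation. -/
def rePart (x : g) : realForm σ :=
  ⟨(2⁻¹ : ℂ) • (x + σ x), by
    rw [mem_realForm, LinearMap.map_smulₛₗ, map_add, IsConjugation.invol (σ := σ), add_comm, map_inv₀,
      map_ofNat]⟩

/-- The imaginary part of an element with respect to a conjugation. -/
def imPart (x : g) : realForm σ := rePart σ (-Complex.I • x)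

theorem coe_rePart (x : g) : (rePart σ x : g) = (2⁻¹ : ℂ) • (x + σ x) := rfl

theorem coe_imPart (x : g) : (imPart σ x : g) = (2⁻¹ * Complex.I : ℂ) • (σ x - x) := by
  rw [imPart, coe_rePart, LinearMap.map_smulₛₗ]
  simp only [map_neg, Complex.conj_I, neg_neg]
  module

theorem rePart_add_imPart (x : g) : (rePart σ x : g) + Complex.I • (imPart σ x : g) = x := by
  rw [coe_rePart, coe_imPart, smul_smul, show Complex.I * (2⁻¹ * Complex.I) = (-2⁻¹ : ℂ) by
    linear_combination (2⁻¹ : ℂ) * Complex.I_mul_I]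
  module

theorem rePart_mem {p : Submodule ℂ g} (hp : ∀ x ∈ p, σ x ∈ p) {x : g} (hx : x ∈ p) :
    (rePart σ x : g) ∈ p := p.smul_mem _ (p.add_mem hx (hp x hx))

theorem imPart_mem {p : Submodule ℂ g} (hp : ∀ x ∈ p, σ x ∈ p) {x : g} (hx : x ∈ p) :
    (imPart σ x : g) ∈ p := rePart_mem σ hp (p.smul_mem _ hx)

omit [LieSuperalgebra ℂ g] [IsConjugation σ] in
variable {σ} in
theorem conj_apply (x : realForm σ) : σ (x : g) = x := x.2

instance realFormSuperalgebra : LieSuperalgebra ℝ (realForm σ) where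
  part q := ((part (K := ℂ) (V := g) q).restrictScalars ℝ).comap (realForm σ).subtype
  isCompl := by
    constructor
    · rw [Submodule.disjoint_def]
      intro x h0 h1
      exact Subtype.ext ((Submodule.disjoint_def.mp (isCompl (K := ℂ) (V := g)).disjoint) _ h0 h1)
    · rw [codisjoint_iff, eq_top_iff]
      rintro x -
      have hx : (x : g) ∈ part (K := ℂ) (V := g) 0 ⊔ part 1 := by
        rw [(isCompl (K := ℂ) (V := g)).sup_eq_top]
        trivial
      obtain ⟨a, ha, b, hb, hab⟩ := Submodule.mem_sup.mp hx
      refine Submodule.mem_sup.mpr ⟨rePart σ a, rePart_mem σ (IsConjugation.map_part 0) ha,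
        rePart σ b, rePart_mem σ (IsConjugation.map_part 1) hb, Subtype.ext ?_⟩
      rw [Submodule.coe_add, coe_rePart, coe_rePart, ← smul_add,
        show a + σ a + (b + σ b) = (a + b) + σ (a + b) by rw [map_add]; abel, hab, conj_apply]
      module
  sbr := LinearMap.mk₂ ℝ
    (fun x y => ⟨(x : g) ◃ (y : g), by
      rw [mem_realForm, IsConjugation.map_sbr (σ := σ), conj_apply, conj_apply]⟩)
    (fun x x' y => by ext; simp) (fun r x y => by ext; exact LinearMap.map_smul₂ _ (r : ℂ) _ _)
    (fun x y y' => by ext; simp) (fun r x y => by ext; exact map_smul (sbr (K := ℂ) (x : g)) (r : ℂ) (y : g))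
  sbr_mem hx hy := sbr_mem (K := ℂ) (V := g) hx hy
  sbr_skew hx hy := Subtype.ext (by simpa using sbr_skew (K := ℂ) (V := g) hx hy)
  sbr_jacobi hx hy hz := Subtype.ext (by simpa using sbr_jacobi (K := ℂ) (V := g) hx hy hz)

theorem coe_sbr (x y : realForm σ) :
    ((sbr (K := ℝ) x y : realForm σ) : g) = (x : g) ◃ (y : g) := rfl

variable {σ} in
theorem coe_mem_part_zero (X : EvenPart ℝ (realForm σ)) : X.1.1 ∈ part (K := ℂ) (V := g) 0 := X.2

/-- The canonical map from the complexification of a real form. -/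
def realFormMap : (ℂ ⊗[ℝ] realForm σ) →ₗ[ℂ] g :=
  TensorProduct.AlgebraTensorModule.lift
    (LinearMap.toSpanSingleton ℂ (realForm σ →ₗ[ℝ] g) (realForm σ).subtype)

omit [LieSuperalgebra ℂ g] [IsConjugation σ] in
theorem realFormMap_tmul (c : ℂ) (x : realForm σ) : realFormMap σ (c ⊗ₜ x) = c • (x : g) := by
  simp [realFormMap]

theorem realFormMap_bijective : Function.Bijective (realFormMap σ) := by
  constructor
  · rw [injective_iff_map_eq_zero]
    have hform : ∀ z : ℂ ⊗[ℝ] realForm σ, ∃ u v : realForm σ,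
        z = 1 ⊗ₜ u + Complex.I ⊗ₜ v := fun z => by
      induction z using TensorProduct.induction_on with
      | zero => exact ⟨0, 0, by simp⟩
      | add a b ha hb =>
        obtain ⟨u, v, rfl⟩ := ha
        obtain ⟨u', v', rfl⟩ := hb
        exact ⟨u + u', v + v', by simp only [TensorProduct.tmul_add]; abel⟩
      | tmul c m =>
        refine ⟨c.re • m, c.im • m, ?_⟩
        rw [← TensorProduct.smul_tmul, ← TensorProduct.smul_tmul, ← TensorProduct.add_tmul]
        congr 1
        apply Complex.ext <;> simp
    intro z hz
    obtain ⟨u, v, rfl⟩ := hform z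
    have h1 : (u : g) + Complex.I • (v : g) = 0 := by simpa [realFormMap_tmul] using hz
    -- Applying `σ` conjugates the scalar; sum and difference of the two equations isolate `u` and
    -- `v`.
    have h2 : (u : g) - Complex.I • (v : g) = 0 := by
      have := congrArg σ h1
      rw [map_add, LinearMap.map_smulₛₗ, conj_apply, conj_apply, Complex.conj_I, map_zero] at this
      rw [← this]
      module
    have hu : (u : g) = 0 := by
      have : (2 : ℂ) • (u : g) = 0 := by
        calc (2 : ℂ) • (u : g) = ((u : g) + Complex.I • (v : g)) + (u - Complex.I • (v : g)) := by
              module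
          _ = 0 := by rw [h1, h2, add_zero]
      exact (smul_eq_zero.mp this).resolve_left two_ne_zero
    have hv : (v : g) = 0 := by
      rw [hu, zero_add] at h1
      exact (smul_eq_zero.mp h1).resolve_left Complex.I_ne_zero
    rw [Submodule.coe_eq_zero.mp hu, Submodule.coe_eq_zero.mp hv]
    simp
  · intro x
    exact ⟨1 ⊗ₜ rePart σ x + Complex.I ⊗ₜ imPart σ x, by
      simpa [realFormMap_tmul] using rePart_add_imPart σ x⟩

/-- The complexification of a real form is the original superalgebra. -/
def realFormEquiv : (ℂ ⊗[ℝ] realForm σ) ≃ₗ[ℂ] g :=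
  LinearEquiv.ofBijective (realFormMap σ) (realFormMap_bijective σ)

@[simp]
theorem realFormEquiv_tmul (c : ℂ) (x : realForm σ) :
    realFormEquiv σ (c ⊗ₜ x) = c • (x : g) :=
  realFormMap_tmul σ c x

variable {σ} in
theorem mem_baseChange_of_eq {p : Submodule ℝ (realForm σ)} {z : ℂ ⊗[ℝ] realForm σ}
    {u v : realForm σ} (hu : u ∈ p) (hv : v ∈ p)
    (hz : realFormEquiv σ z = (u : g) + Complex.I • (v : g)) : z ∈ p.baseChange ℂ := by
  have : z = 1 ⊗ₜ u + Complex.I ⊗ₜ v := by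
    apply (realFormEquiv σ).injective
    simpa using hz
  rw [this]
  exact add_mem (Submodule.tmul_mem_baseChange_of_mem _ hu)
    (Submodule.tmul_mem_baseChange_of_mem _ hv)

theorem mem_baseChange_comap {p : Submodule ℂ g} (hp : ∀ x ∈ p, σ x ∈ p)
    (z : ℂ ⊗[ℝ] realForm σ) :
    z ∈ ((p.restrictScalars ℝ).comap (realForm σ).subtype).baseChange ℂ ↔
      realFormEquiv σ z ∈ p := by
  refine ⟨fun hz => ?_, fun hz => ?_⟩
  · refine baseChange_induction (C := fun z => realFormEquiv σ z ∈ p) (fun m hm => ?_) (by simp)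
      (fun x y hx hy => ?_) (fun c x hx => ?_) hz
    · simpa using hm
    · rw [map_add]; exact add_mem hx hy
    · rw [map_smul]; exact p.smul_mem _ hx
  · exact mem_baseChange_of_eq (rePart_mem σ hp hz) (imPart_mem σ hp hz)
      (rePart_add_imPart σ _).symm

theorem sbr_tmul (c d : ℂ) (x y : realForm σ) :
    (c ⊗ₜ[ℝ] x) ◃ (d ⊗ₜ[ℝ] y) = (c * d) ⊗ₜ[ℝ] sbr (K := ℝ) x y :=
  LinearMap.BilinMap.baseChange_tmul _ _ _ _ _

theorem isIso_realFormEquiv : IsIso (realFormEquiv σ) where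
  map_sbr x y := by
    induction x using TensorProduct.induction_on with
    | zero => simp
    | add a b ha hb => simp only [map_add, LinearMap.add_apply, ha, hb]
    | tmul c m =>
      induction y using TensorProduct.induction_on with
      | zero => simp
      | add a b ha hb => simp only [map_add, ha, hb]
      | tmul d n =>
        rw [sbr_tmul, realFormEquiv_tmul, realFormEquiv_tmul, realFormEquiv_tmul, coe_sbr,
          map_smul, map_smul, LinearMap.smul_apply, smul_smul, mul_comm]
  mem_part q x := (mem_baseChange_comap σ (IsConjugation.map_part q) x).symm

/-- A trace is unchanged by extension of scalars and by conjugation with an isomorphism. -/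
theorem adTrace_realForm [FiniteDimensional ℂ g] (X Y : EvenPart ℝ (realForm σ)) :
    ((adTrace X Y : ℝ) : ℂ) =
      SimpleSystem.tr ((X : realForm σ) : g) ((Y : realForm σ) : g) := by
  have : FiniteDimensional ℝ g := FiniteDimensional.complexToReal g
  rw [adTrace, ← Complex.coe_algebraMap, ← LinearMap.trace_baseChange, SimpleSystem.tr,
    ← LinearMap.trace_conj' _ (realFormEquiv σ)]
  congr 1
  apply LinearMap.ext
  intro x
  obtain ⟨z, rfl⟩ := (realFormEquiv σ).surjective x
  rw [LinearEquiv.conj_apply_apply, LinearEquiv.symm_apply_apply]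
  induction z using TensorProduct.induction_on with
  | zero => simp
  | add a b ha hb => simp only [map_add, ha, hb]
  | tmul c m => simp [coe_sbr]

/-- The real points of a subspace `h` that lies in the even part and is closed under the
bracket. -/
def realPoints (h : Submodule ℂ g) (hsub : ∀ x ∈ h, ∀ y ∈ h, x ◃ y ∈ h) :
    LieSubalgebra ℝ (EvenPart ℝ (realForm σ)) where
  carrier := {X | ((X : realForm σ) : g) ∈ h}
  add_mem' hx hy := h.add_mem hx hy
  zero_mem' := h.zero_mem
  smul_mem' r _ hx := h.smul_mem (r : ℂ) hx
  lie_mem' hx hy := hsub _ hx _ hy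

theorem mem_complexify_realPoints {h : Submodule ℂ g} (hsub : ∀ x ∈ h, ∀ y ∈ h, x ◃ y ∈ h)
    (hσh : ∀ x ∈ h, σ x ∈ h) (heven : h ≤ part (K := ℂ) 0) (z : ℂ ⊗[ℝ] realForm σ) :
    z ∈ complexify (realPoints σ h hsub) ↔ realFormEquiv σ z ∈ h := by
  rw [← mem_baseChange_comap σ hσh, complexify]
  suffices evenSubspace (realPoints σ h hsub) =
    (h.restrictScalars ℝ).comap (realForm σ).subtype by rw [this]
  ext x
  constructor
  · rintro ⟨X, hX, rfl⟩
    exact hX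
  · intro hx
    exact ⟨⟨x, heven hx⟩, hx, rfl⟩

end LieSuperalgebra

/-! ### Even roots and the height -/

namespace SimpleSystem

section Roots

variable {ι : Type*} [Fintype ι] [DecidableEq ι] {D : SuperDynkin ι} {g : Type*}
  [AddCommGroup g] [Module ℂ g] [LieSuperalgebra ℂ g] {h : Submodule ℂ g}
  (S : SimpleSystem D h)

theorem proj_sbr_cartan {H : g} (hH : H ∈ h) (a : ι → ℤ) (x : g) :
    S.proj a (H ◃ x) = S.wt a H • S.proj a x := by
  refine S.homog_induction (P := fun x => S.proj a (H ◃ x) = S.wt a H • S.proj a x) (by simp)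
    (fun x y hx hy => by simp only [map_add, hx, hy, smul_add]) (fun b x hx => ?_) x
  rw [S.sbr_of_mem_deg hH hx, map_smul]
  by_cases hab : b = a
  · rw [hab]
  · rw [S.proj_ne hab hx, smul_zero, smul_zero]

theorem mem_cartan_of_proj {x : g} (hx : ∀ a ≠ 0, S.proj a x = 0) : x ∈ h := by
  have h0 : x - S.proj 0 x = 0 := S.eq_zero_of_proj fun a => by
    rw [map_sub]
    by_cases ha : a = 0
    · rw [ha, S.proj_self (S.proj_mem 0 x), sub_self]
    · rw [hx a ha, S.proj_ne (Ne.symm ha) (S.proj_mem 0 x), sub_zero]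
  rw [sub_eq_zero.mp h0]
  exact S.deg_zero.le (S.proj_mem 0 x)

/-- A nonzero component of `x` in degree `a ≠ 0` would survive in `[H, x]`, multiplied by `wt a H ≠
0` for some `H`. -/
theorem mem_cartan_of_normalizes (S : SimpleSystem D h) (hcart : SelfCentralizing h)
    {x : g} (hx0 : x ∈ part (K := ℂ) (V := g) 0) (hx : ∀ H ∈ h, H ◃ x ∈ h) : x ∈ h := by
  refine S.mem_cartan_of_proj fun a ha => ?_
  by_contra hne
  obtain ⟨H, hH, hwt⟩ := S.wt_ne_zero hcart ha (S.proj_mem a x) (S.proj_mem_part hx0 a) hne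
  have h1 := S.proj_ne (Ne.symm ha) (S.mem_deg_zero (hx H hH))
  rw [S.proj_sbr_cartan hH] at h1
  exact (smul_ne_zero hwt hne) h1

theorem mem_cartan_of_commutes {H : g} (hH : H ∈ h)
    (hreg : ∀ a ≠ 0, ∀ x ∈ S.deg a, x ∈ part (K := ℂ) (V := g) 0 → x ≠ 0 → S.wt a H ≠ 0) {x : g}
    (hx0 : x ∈ part (K := ℂ) (V := g) 0) (hx : H ◃ x = 0) : x ∈ h := by
  refine S.mem_cartan_of_proj fun a ha => ?_
  by_contra hne
  have h1 := S.proj_sbr_cartan hH a x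
  rw [hx, map_zero] at h1
  exact smul_ne_zero (hreg a ha _ (S.proj_mem a x) (S.proj_mem_part hx0 a) hne) hne h1.symm

theorem sum_root_apply (a : ι → ℤ) (H : h) : (∑ i, a i • S.root i) H = S.wt a H := by
  simp [wt_apply, LinearMap.sum_apply, S.rt_apply]

theorem exists_deg_of_mem_evenRoots {β : Module.Dual ℂ h} (hβ : β ∈ evenRoots h) :
    ∃ a ≠ 0, (∃ x ∈ S.deg a, x ∈ part (K := ℂ) (V := g) 0 ∧ x ≠ 0) ∧
      β = ∑ i, a i • S.root i := by
  obtain ⟨hβ0, x, hx0, hne, hx⟩ := hβ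
  obtain ⟨a, ha⟩ : ∃ a, S.proj a x ≠ 0 := by
    by_contra! hcon
    exact hne (S.eq_zero_of_proj hcon)
  have hwt : ∀ H : h, β H = S.wt a H := fun H => by
    have h1 := S.proj_sbr_cartan H.2 a x
    rw [hx H, map_smul] at h1
    exact smul_left_injective ℂ ha h1
  refine ⟨a, fun h0 => hβ0 (LinearMap.ext fun H => ?_),
    ⟨_, S.proj_mem a x, S.proj_mem_part hx0 a, ha⟩, LinearMap.ext fun H => ?_⟩
  · rw [hwt, h0, wt_zero]
    rfl
  · rw [hwt, sum_root_apply]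

theorem evenPositive_subset (hcart : SelfCentralizing h) : S.evenPositive ⊆ evenRoots h := by
  rintro β ⟨a, -, ha0, ⟨x, hx, hx0, hne⟩, rfl⟩
  obtain ⟨H, hH, hwt⟩ := S.wt_ne_zero hcart ha0 hx hx0 hne
  refine ⟨fun h0 => hwt ?_, x, hx0, hne, fun K => ?_⟩
  · rw [← S.sum_root_apply a ⟨H, hH⟩, h0, LinearMap.zero_apply]
  · rw [S.sum_root_apply, S.sbr_of_mem_deg K.2 hx]

end Roots

theorem height_pos {ι : Type*} [Fintype ι] {a : ι → ℤ} (ha : 0 ≤ a) (ha0 : a ≠ 0) :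
    0 < height a := by
  refine lt_of_le_of_ne (Finset.sum_nonneg fun i _ => ha i) fun h0 => ha0 (funext fun i => ?_)
  exact (Finset.sum_eq_zero_iff_of_nonneg fun i _ => ha i).mp h0.symm i (Finset.mem_univ i)

theorem height_neg_of_nonpos {ι : Type*} [Fintype ι] {a : ι → ℤ} (ha : a ≤ 0) (ha0 : a ≠ 0) :
    height a < 0 := by
  have := height_pos (a := -a) (by simpa using ha) (by simpa using ha0)
  rw [height_neg] at this
  linarith

end SimpleSystem

/-! ### The lexicographic order on the even roots. -/

theorem Module.exists_basis_head {E : Type*} [AddCommGroup E] [Module ℝ E]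
    [FiniteDimensional ℝ E] {v : E} (hv : v ≠ 0) :
    ∃ (r : ℕ) (b : Module.Basis (Fin (r + 1)) ℝ E), b 0 = v := by
  have hs : LinearIndepOn ℝ id ({v} : Set E) := LinearIndepOn.singleton hv
  let b := Module.Basis.extend hs
  have := FiniteDimensional.fintypeBasisIndex b
  let i₀ : hs.extend (Set.subset_univ _) := ⟨v, hs.subset_extend _ rfl⟩
  obtain ⟨r, hr⟩ : ∃ r, Fintype.card (hs.extend (Set.subset_univ _)) = r + 1 :=
    Nat.exists_eq_succ_of_ne_zero (Fintype.card_pos_iff.mpr ⟨i₀⟩).ne'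
  let e := Fintype.equivFinOfCardEq hr
  refine ⟨r, b.reindex (e.trans (Equiv.swap (e i₀) 0)), ?_⟩
  rw [Module.Basis.reindex_apply]
  simp [b, i₀]

section Lex

variable {V : Type*} [AddCommGroup V] [Module ℝ V] [LieSuperalgebra ℝ V] [FiniteDimensional ℝ V]
  {ι : Type*} [Fintype ι] [DecidableEq ι] {D : SuperDynkin ι}

open SimpleSystem in
/-- If an element of `𝔱` measures the height of the even roots, the positive even roots take `i𝔱`
before `𝔞`. -/
theorem takesItBeforeA_of_height {θ : EvenPart ℝ V ≃ₗ⁅ℝ⁆ EvenPart ℝ V}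
    {h : LieSubalgebra ℝ (EvenPart ℝ V)} (S : SimpleSystem D (complexify h))
    (hcart : SelfCentralizing (complexify h)) (X : tPart θ h)
    (hX : ∀ a ≠ 0, ∀ x ∈ S.deg a, x ∈ part (K := ℂ) (V := ℂ ⊗[ℝ] V) 0 → x ≠ 0 →
      S.wt a (Complex.I • toComplexify h X : complexify h) = height a) :
    TakesItBeforeA θ h S.evenPositive := by
  have hroot : ∀ β ∈ evenRoots (complexify h), ∃ a ≠ 0,
      (∃ x ∈ S.deg a, x ∈ part (K := ℂ) (V := ℂ ⊗[ℝ] V) 0 ∧ x ≠ 0) ∧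
      β = ∑ i, a i • S.root i ∧ β (Complex.I • toComplexify h X) = height a ∧
      height a ≠ 0 := by
    intro β hβ
    obtain ⟨a, ha, ⟨x, hx, hx0, hne⟩, hβa⟩ := S.exists_deg_of_mem_evenRoots hβ
    refine ⟨a, ha, ⟨x, hx, hx0, hne⟩, hβa, ?_, ?_⟩
    · rw [hβa, S.sum_root_apply, hX a ha x hx hx0 hne]
    · rcases S.nonneg_or_nonpos hx hne with h1 | h1
      · exact (height_pos h1 ha).ne'
      · exact (height_neg_of_nonpos h1 ha).ne
  let c := Module.finBasis ℝ (aPart θ h)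
  -- No even root has height zero, so `X = 0` is possible only when there are no even roots; then
  -- any bases serve.
  by_cases hX0 : X = 0
  · have hempty : evenRoots (complexify h) = ∅ := by
      rw [Set.eq_empty_iff_forall_notMem]
      intro β hβ
      obtain ⟨a, -, -, -, h1, h2⟩ := hroot β hβ
      have h3 : toComplexify h (X : h) = 0 := by
        rw [hX0]
        exact Subtype.ext (TensorProduct.tmul_zero _ _)
      rw [h3, smul_zero, map_zero] at h1
      exact h2 (by exact_mod_cast h1.symm)
    refine ⟨_, _, Module.finBasis ℝ (tPart θ h), c, ?_⟩
    have hpos : S.evenPositive = ∅ :=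
      Set.subset_empty_iff.mp ((S.evenPositive_subset hcart).trans hempty.subset)
    rw [hempty, hpos]
    simp
  -- With `X` as first basis vector, the first entry of the sequence is the height of the root,
  -- which is never zero and so decides the order alone.
  · obtain ⟨r, b, hb⟩ := Module.exists_basis_head hX0
    refine ⟨r + 1, _, b, c, ?_⟩
    ext β
    have hfirst : Fin.append (fun k => β (Complex.I • toComplexify h (b k)))
        (fun k => β (toComplexify h (c k))) (Fin.castAdd _ 0) =
        β (Complex.I • toComplexify h X) := by
      rw [Fin.append_left, hb]
    constructor
    · intro hβ
      refine ⟨S.evenPositive_subset hcart hβ, Fin.castAdd _ 0, fun j hj => ?_, ?_⟩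
      · exact absurd hj (by simp [Fin.lt_def])
      · obtain ⟨a, ha, ha0, ⟨x, hx, hx0, hne⟩, rfl⟩ := hβ
        refine ⟨height a, by exact_mod_cast height_pos ha ha0, ?_⟩
        rw [hfirst, S.sum_root_apply, hX a ha0 x hx hx0 hne]
        simp
    · rintro ⟨hβ, k, hk, t, ht, hkt⟩
      obtain ⟨a, ha0, ⟨x, hx, hx0, hne⟩, hβa, h1, h2⟩ := hroot β hβ
      rcases S.nonneg_or_nonpos hx hne with ha | ha
      · exact ⟨a, ha, ha0, ⟨x, hx, hx0, hne⟩, hβa⟩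
      · exfalso
        by_cases hk0 : k = Fin.castAdd _ 0
        · rw [hk0, hfirst, h1] at hkt
          have h3 : ((height a : ℤ) : ℝ) = t := by exact_mod_cast hkt
          have h4 : ((height a : ℤ) : ℝ) < 0 := by exact_mod_cast height_neg_of_nonpos ha ha0
          linarith
        · have h3 := hk (Fin.castAdd _ 0) (by
            refine lt_of_le_of_ne ?_ (Ne.symm hk0)
            simp [Fin.le_def])
          rw [hfirst, h1] at h3
          exact h2 (by exact_mod_cast h3)

end Lex

/-! ### The fixed subalgebra of `θ` and the trace form. -/

section Compact

variable {V : Type*} [AddCommGroup V] [Module ℝ V] [LieSuperalgebra ℝ V]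

/-- The `+1` eigenspace of an automorphism is a subalgebra. -/
def compactSubalgebra (θ : EvenPart ℝ V ≃ₗ⁅ℝ⁆ EvenPart ℝ V) :
    LieSubalgebra ℝ (EvenPart ℝ V) where
  __ := compactSpace θ
  lie_mem' {X Y} hX hY := by
    have hX' : θ X = X := sub_eq_zero.mp hX
    have hY' : θ Y = Y := sub_eq_zero.mp hY
    exact sub_eq_zero.mpr ((θ.toLieHom.map_lie X Y).trans (congrArg₂ _ hX' hY'))

theorem mem_compactSpace {θ : EvenPart ℝ V ≃ₗ⁅ℝ⁆ EvenPart ℝ V} {X : EvenPart ℝ V} :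
    X ∈ compactSpace θ ↔ θ X = X := sub_eq_zero

theorem mem_noncompactSpace {θ : EvenPart ℝ V ≃ₗ⁅ℝ⁆ EvenPart ℝ V} {X : EvenPart ℝ V} :
    X ∈ noncompactSpace θ ↔ θ X = -X := add_eq_zero_iff_eq_neg

/-- The trace form as a bilinear form. -/
def adTraceForm (V : Type*) [AddCommGroup V] [Module ℝ V] [LieSuperalgebra ℝ V] :
    LinearMap.BilinForm ℝ (EvenPart ℝ V) :=
  LinearMap.mk₂ ℝ adTrace
    (fun X X' Y => by simp [adTrace, LinearMap.add_comp])
    (fun r X Y => by simp [adTrace, LinearMap.smul_comp])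
    (fun X Y Y' => by simp [adTrace, LinearMap.comp_add])
    (fun r X Y => by simp [adTrace, LinearMap.comp_smul])

end Compact

/-! ### The Cartan involution of the real form -/

namespace SimpleSystem

variable {ι : Type*} [Fintype ι] [DecidableEq ι] {D : SuperDynkin ι} {g : Type*}
  [AddCommGroup g] [Module ℂ g] [LieSuperalgebra ℂ g] {h : Submodule ℂ g}

theorem sbr_mem_of_mem_cartan (S : SimpleSystem D h) (x : g) (hx : x ∈ h) (y : g) (hy : y ∈ h) :
    x ◃ y ∈ h := by
  rw [S.sbr_cartan hx hy]
  exact h.zero_mem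

theorem pullback_wt (S : SimpleSystem D h) {w : Type*} [AddCommGroup w] [Module ℂ w]
    [LieSuperalgebra ℂ w] {Ψ : w ≃ₗ[ℂ] g} (hΨ : IsIso Ψ) (k : Submodule ℂ w)
    (hk : ∀ x, x ∈ k ↔ Ψ x ∈ h) (a : ι → ℤ) (H : k) :
    (S.pullback hΨ k hk).wt a H = S.wt a (Ψ H) := by
  rw [wt_apply, wt_apply]
  refine Finset.sum_congr rfl fun i _ => ?_
  rw [rt_apply]
  exact congrArg _ (S.rt_apply i ⟨Ψ H, (hk _).mp H.2⟩).symm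

theorem SelfCentralizing.pullback (hcart : SelfCentralizing h) {w : Type*} [AddCommGroup w]
    [Module ℂ w] [LieSuperalgebra ℂ w] {Ψ : w ≃ₗ[ℂ] g} (hΨ : IsIso Ψ) {k : Submodule ℂ w}
    (hk : ∀ x, x ∈ k ↔ Ψ x ∈ h) : SelfCentralizing k := by
  intro x hx0 hx
  refine (hk x).mpr (hcart _ ((hΨ.mem_part 0 x).mpr hx0) fun H hH => ?_)
  have h1 := congrArg Ψ (hx (Ψ.symm H) ((hk _).mpr (by simpa using hH)))
  simpa [hΨ.map_sbr] using h1

variable {S : SimpleSystem D h} {ψ σ : g →ₛₗ[starRingEnd ℂ] g} {d : Equiv.Perm ι}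

theorem IsRealStructure.isConjugation (hσ : S.IsRealStructure ψ σ d) : IsConjugation σ :=
  ⟨hσ.invol, hσ.map_sbr, fun _ _ => hσ.map_part⟩

variable [FiniteDimensional ℂ g] [IsConjugation σ]

/-- The Cartan involution: the restriction of the compact conjugation to the even part of the
real form. -/
def cartanInvolution (hσ : S.IsRealStructure ψ σ d) (hψ : S.IsChevalleyFlip ψ)
    (hg : LieSuperalgebra.IsBasic g) (hcart : SelfCentralizing h) :
    EvenPart ℝ (realForm σ) ≃ₗ⁅ℝ⁆ EvenPart ℝ (realForm σ) :=
  let τ (X : EvenPart ℝ (realForm σ)) : EvenPart ℝ (realForm σ) :=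
    ⟨⟨S.compactConj ψ X.1.1, by
      rw [mem_realForm, hσ.comm_compactConj hψ hg hcart (coe_mem_part_zero X), conj_apply]⟩,
      compactConj_part hψ X.2⟩
  have hτ (X) : τ (τ X) = X :=
    Subtype.ext (Subtype.ext (compactConj_compactConj hψ hg hcart X.2))
  { toFun := τ
    map_add' := fun X Y => Subtype.ext (Subtype.ext (map_add (S.compactConj ψ) _ _))
    map_smul' := fun r X => Subtype.ext (Subtype.ext (by
      change S.compactConj ψ ((r : ℂ) • X.1.1) = (r : ℂ) • S.compactConj ψ X.1.1
      rw [LinearMap.map_smulₛₗ, Complex.conj_ofReal]))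
    map_lie' := fun {X Y} =>
      Subtype.ext (Subtype.ext (compactConj_sbr hψ hg hcart X.2 Y.2))
    invFun := τ
    left_inv := hτ
    right_inv := hτ }

variable (hσ : S.IsRealStructure ψ σ d) (hψ : S.IsChevalleyFlip ψ)
  (hg : LieSuperalgebra.IsBasic g) (hcart : SelfCentralizing h)

theorem coe_cartanInvolution (X : EvenPart ℝ (realForm σ)) :
    (cartanInvolution hσ hψ hg hcart X).1.1 = S.compactConj ψ X.1.1 := rfl

theorem isCartanInvolution : IsCartanInvolution (cartanInvolution hσ hψ hg hcart) where
  involutive X := Subtype.ext (Subtype.ext (compactConj_compactConj hψ hg hcart X.2))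
  invariant X Y := by
    apply Complex.ofReal_injective
    rw [adTrace_realForm, adTrace_realForm, coe_cartanInvolution, coe_cartanInvolution]
    simpa only [conj_apply] using hσ.tr_compactConj hψ hg hcart (coe_mem_part_zero X)
      (coe_mem_part_zero Y)
  pos X hX := by
    have h1 := tr_compactConj_neg hψ hg hcart (x := X.1.1) X.2 fun h0 =>
      hX (Subtype.ext (Subtype.ext h0))
    rw [← coe_cartanInvolution hσ hψ hg hcart, ← adTrace_realForm, Complex.ofReal_re] at h1
    linarith

/-- The real form of the Cartan subalgebra. -/
def realCartan (S : SimpleSystem D h) (σ : g →ₛₗ[starRingEnd ℂ] g) [IsConjugation σ] :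
    LieSubalgebra ℝ (EvenPart ℝ (realForm σ)) := realPoints σ h S.sbr_mem_of_mem_cartan

omit [FiniteDimensional ℂ g] in
theorem mem_realCartan {X : EvenPart ℝ (realForm σ)} :
    X ∈ S.realCartan σ ↔ X.1.1 ∈ h := Iff.rfl

omit [FiniteDimensional ℂ g] in
include hσ in
theorem mem_complexify_realCartan (z : ℂ ⊗[ℝ] realForm σ) :
    z ∈ complexify (S.realCartan σ) ↔ realFormEquiv σ z ∈ h :=
  mem_complexify_realPoints σ S.sbr_mem_of_mem_cartan (fun _ hx => hσ.map_cartan hx)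
    (fun _ hx => S.even_of_mem hx) z

omit [FiniteDimensional ℂ g] in
include hσ hcart in
-- Normalizing the real Cartan subalgebra implies normalizing `h`, since every element of `h` is `u
-- + iv` with `u` and `v` fixed by `σ`.
theorem isCartanSubalgebra_realCartan : (S.realCartan σ).IsCartanSubalgebra where
  nilpotent := by
    have : IsLieAbelian (S.realCartan σ) :=
      ⟨fun X Y => Subtype.ext (Subtype.ext (Subtype.ext (S.sbr_cartan X.2 Y.2)))⟩
    infer_instance
  self_normalizing := by
    refine le_antisymm (fun X hX => ?_) (LieSubalgebra.le_normalizer _)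
    rw [LieSubalgebra.mem_normalizer_iff'] at hX
    have key : ∀ Y : realForm σ, (Y : g) ∈ h → (Y : g) ◃ X.1.1 ∈ h := fun Y hY =>
      hX ⟨Y, S.even_of_mem hY⟩ hY
    refine S.mem_cartan_of_normalizes hcart X.2 fun H hH => ?_
    rw [← rePart_add_imPart σ H, map_add, LinearMap.add_apply, map_smul, LinearMap.smul_apply]
    exact h.add_mem (key _ (rePart_mem σ (fun _ hx => hσ.map_cartan hx) hH))
      (h.smul_mem _ (key _ (imPart_mem σ (fun _ hx => hσ.map_cartan hx) hH)))

theorem isStableCartan_realCartan :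
    IsStableCartan (cartanInvolution hσ hψ hg hcart) (S.realCartan σ) := by
  refine ⟨isCartanSubalgebra_realCartan hσ hcart, fun X hX => ?_⟩
  rw [mem_realCartan, coe_cartanInvolution, compactConj_cartan hX]
  exact hψ.map_cartan hX

/-- An element of the compact part of the Cartan subalgebra that measures the height of the even
roots. -/
theorem exists_height_compact :
    ∃ X ∈ S.realCartan σ, cartanInvolution hσ hψ hg hcart X = X ∧
      ∀ a ≠ 0, ∀ x ∈ S.deg a, x ∈ part (K := ℂ) (V := g) 0 → x ≠ 0 →
        S.wt a (Complex.I • X.1.1) = height a := by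
  obtain ⟨H, hH, hσH, hψH, hwt⟩ := exists_height_invariant hσ hψ hg hcart
  have hm : -Complex.I • H ∈ h := h.smul_mem _ hH
  -- Both antilinear maps negate `H` and conjugate `-i`, hence fix `-iH`.
  refine ⟨⟨⟨-Complex.I • H, ?_⟩, S.even_of_mem hm⟩, hm, Subtype.ext (Subtype.ext ?_), ?_⟩
  · rw [mem_realForm, LinearMap.map_smulₛₗ, hσH]
    simp
  · rw [coe_cartanInvolution, compactConj_cartan hm, LinearMap.map_smulₛₗ, hψH]
    simp
  · intro a ha x hx hx0 hne
    rw [smul_smul, mul_neg, Complex.I_mul_I, neg_neg, one_smul]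
    exact hwt a ha x hx hx0 hne

/-- The height element `X` lies in `𝔱`, and no even root vanishes on it, so whatever commutes with
it in `𝔨` lies in `𝔱`. The compact part of any competing Cartan subalgebra has at most the dimension
of that centralizer. -/
theorem isMaximallyCompact_realCartan :
    IsMaximallyCompact (cartanInvolution hσ hψ hg hcart) (S.realCartan σ) := by
  refine ⟨isStableCartan_realCartan hσ hψ hg hcart, fun h' hh' => ?_⟩
  have : FiniteDimensional ℝ g := FiniteDimensional.complexToReal g
  obtain ⟨X, hX, hθX, hwt⟩ := exists_height_compact hσ hψ hg hcart
  have := hh'.1.nilpotent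
  refine finrank_inf_le_of_isNilpotent (k := compactSubalgebra (cartanInvolution hσ hψ hg hcart))
    (κ := adTraceForm (realForm σ)) (fun Y Z => ?_) (fun Y Z W => ?_) (fun Y hY hY0 => ?_)
    (mem_compactSpace.mpr hθX) h' _ fun Y hY hXY => ⟨?_, hY⟩
  · apply Complex.ofReal_injective
    change ((adTrace Y Z : ℝ) : ℂ) = ((adTrace Z Y : ℝ) : ℂ)
    rw [adTrace_realForm, adTrace_realForm, tr_comm]
  · apply Complex.ofReal_injective
    change ((adTrace ⁅Y, Z⁆ W : ℝ) : ℂ) = ((adTrace Y ⁅Z, W⁆ : ℝ) : ℂ)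
    rw [adTrace_realForm, adTrace_realForm]
    exact tr_sbr Y.2 Z.2 _
  · have h1 := (isCartanInvolution hσ hψ hg hcart).pos Y hY0
    rw [mem_compactSpace.mp hY] at h1
    change adTrace Y Y < 0
    linarith
  · refine S.mem_cartan_of_commutes (H := Complex.I • X.1.1) (h.smul_mem _ hX)
      (fun a ha x hx hx0 hne => ?_) Y.2 ?_
    · rw [hwt a ha x hx hx0 hne]
      rcases S.nonneg_or_nonpos hx hne with h1 | h1
      · exact_mod_cast (height_pos h1 ha).ne'
      · exact_mod_cast (height_neg_of_nonpos h1 ha).ne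
    · have h1 : X.1.1 ◃ Y.1.1 = 0 := congrArg (fun Z => Z.1.1) hXY
      rw [map_smul, LinearMap.smul_apply, h1, smul_zero]

/-- The simple system of the complexified real form. -/
def realSystem (hσ : S.IsRealStructure ψ σ d) : SimpleSystem D (complexify (S.realCartan σ)) :=
  S.pullback (isIso_realFormEquiv σ) _ (mem_complexify_realCartan hσ)

theorem takesItBeforeA_realSystem :
    TakesItBeforeA (cartanInvolution hσ hψ hg hcart) (S.realCartan σ)
      (realSystem hσ).evenPositive := by
  have : FiniteDimensional ℝ g := FiniteDimensional.complexToReal g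
  obtain ⟨X, hX, hθX, hwt⟩ := exists_height_compact hσ hψ hg hcart
  refine takesItBeforeA_of_height _
    (hcart.pullback (isIso_realFormEquiv σ) (mem_complexify_realCartan hσ))
    ⟨⟨X, hX⟩, mem_compactSpace.mpr hθX⟩ fun a ha x hx hx0 hne => ?_
  rw [realSystem, pullback_wt]
  have h1 := hwt a ha _ hx (((isIso_realFormEquiv σ).mem_part 0 x).mpr hx0) (by simpa using hne)
  rw [← h1]
  simp [toComplexify]

include hψ hg hcart in
omit [IsConjugation σ] in
-- At an even simple root `[e i, ψ (e i)] = -h i` has weight `-2` on `e i`, so `ψ` already has the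
-- compact sign there.
theorem sgn_single {i : ι} (hi : D.parity i = 0) (hψe : ψ (S.e i) = -S.f i) :
    S.sgn ψ (Pi.single i 1) = 1 := by
  obtain ⟨t, ht, hneg⟩ := sgn_wt hψ hg hcart (by simp) (S.deg_e i) (hi ▸ S.e_mem i) (S.e_ne i)
  rw [hψe, map_neg, map_neg, wt_single, rt_coroot, D.diag_even i hi] at ht
  have ht' : t = -2 := by exact_mod_cast ht.symm
  rcases sgn_eq_or (S := S) (ψ := ψ) (Pi.single i 1) with h1 | h1
  · exact h1
  · rw [h1, ht'] at hneg
    norm_num at hneg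

include hσ hψ hg hcart in
-- The compact conjugation commutes with `σ`, so the relation for `y` gives the same one for `σ y`,
-- and the two add up.
theorem rePart_eigen {y : g} (hy : y ∈ part (K := ℂ) (V := g) 0) {s : ℝ}
    (hys : S.compactConj ψ y = (s : ℂ) • σ y) :
    S.compactConj ψ (rePart σ y) = (s : ℂ) • (rePart σ y : g) := by
  have h1 := hσ.comm_compactConj hψ hg hcart hy
  rw [hys, LinearMap.map_smulₛₗ, Complex.conj_ofReal, hσ.invol] at h1
  rw [coe_rePart, LinearMap.map_smulₛₗ, map_add, hys, ← h1, map_inv₀, map_ofNat]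
  module

include hσ hψ hg hcart in
theorem imPart_eigen {y : g} (hy : y ∈ part (K := ℂ) (V := g) 0) {s : ℝ}
    (hys : S.compactConj ψ y = (s : ℂ) • σ y) :
    S.compactConj ψ (imPart σ y) = (s : ℂ) • (imPart σ y : g) := by
  refine rePart_eigen hσ hψ hg hcart (Submodule.smul_mem _ _ hy) ?_
  rw [LinearMap.map_smulₛₗ, LinearMap.map_smulₛₗ, hys, smul_comm]

include hσ hψ hg hcart in
theorem symm_mem_complexSpan {W : Submodule ℝ (EvenPart ℝ (realForm σ))} {s : ℝ}
    (hW : ∀ X : EvenPart ℝ (realForm σ), S.compactConj ψ X.1.1 = (s : ℂ) • X.1.1 → X ∈ W) {y : g}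
    (hy : y ∈ part (K := ℂ) (V := g) 0) (hys : S.compactConj ψ y = (s : ℂ) • σ y) :
    (realFormEquiv σ).symm y ∈ complexSpan W := by
  refine mem_baseChange_of_eq (u := rePart σ y) (v := imPart σ y)
    ⟨⟨rePart σ y, rePart_mem σ (IsConjugation.map_part 0) hy⟩,
      hW _ (rePart_eigen hσ hψ hg hcart hy hys), rfl⟩
    ⟨⟨imPart σ y, imPart_mem σ (IsConjugation.map_part 0) hy⟩,
      hW _ (imPart_eigen hσ hψ hg hcart hy hys), rfl⟩ ?_
  rw [LinearEquiv.apply_symm_apply, rePart_add_imPart]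

/-- At an even fixed vertex the compact conjugation sends `e i` to `-f i`, while `σ` sends it to `f
i` or `-f i` according to the painting; so the two maps are opposite or equal on `e i`. For the
permutation, `σ` and `ψ` both conjugate and negate root values, `σ` also applying `d`, and `σ` fixes
`X`. -/
theorem isVoganDiagramOf_realSystem (A : AbstractVogan D) (hσ : S.IsRealStructure ψ σ A.aut)
    (hψe : ∀ i, ψ (S.e i) = -S.f i) (hpt : ∀ i ∈ A.painted, σ (S.e i) = S.f i)
    (hnp : ∀ i, A.aut i = i → D.parity i = 0 → i ∉ A.painted → σ (S.e i) = -S.f i) :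
    A.IsVoganDiagramOf (cartanInvolution hσ hψ hg hcart) (S.realCartan σ) (realSystem hσ) where
  orbit i X Y hXY := by
    have hwt : ∀ (j : ι) (Z : S.realCartan σ),
        (realSystem hσ).root j (toComplexify _ Z) = S.rt j Z.1.1.1 := fun j Z => by
      rw [← rt_apply, ← wt_single, realSystem, pullback_wt, wt_single]
      simp [toComplexify]
    rw [hwt, hwt, hXY, coe_cartanInvolution, compactConj_cartan X.2]
    obtain ⟨c, c', hf⟩ := hσ.flips
    obtain ⟨c₁, c₁', hf₁⟩ := hψ.flips
    have h1 := hf.rt_map X.2 i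
    rw [conj_apply] at h1
    rw [h1]
    exact (hf₁.rt_map X.2 i).symm
  painted i hi := by
    have h0 := A.painted_even i hi
    refine symm_mem_complexSpan hσ hψ hg hcart (s := -1)
      (fun X hX => mem_noncompactSpace.mpr (Subtype.ext (Subtype.ext ?_))) (h0 ▸ S.e_mem i) ?_
    · rw [coe_cartanInvolution, hX]
      simp
    · rw [compactConj_of_mem (S.deg_e i), sgn_single hψ hg hcart h0 (hψe i), hψe, hpt i hi]
      simp
  unpainted i hi h0 hp := by
    refine symm_mem_complexSpan hσ hψ hg hcart (s := 1)
      (fun X hX => mem_compactSpace.mpr (Subtype.ext (Subtype.ext ?_))) (h0 ▸ S.e_mem i) ?_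
    · rw [coe_cartanInvolution, hX]
      simp
    · rw [compactConj_of_mem (S.deg_e i), sgn_single hψ hg hcart h0 (hψe i), hψe,
        hnp i hi h0 hp]

omit [FiniteDimensional ℂ g] in
-- An element centralizing a Cartan subalgebra normalizes it, and a Cartan subalgebra is its own
-- normalizer.
theorem selfCentralizing_evenSubspace (k : LieSubalgebra ℂ (EvenPart ℂ g))
    [hk : k.IsCartanSubalgebra] : SelfCentralizing (evenSubspace k) := by
  intro x hx0 hx
  refine ⟨⟨x, hx0⟩, ?_, rfl⟩
  change (⟨x, hx0⟩ : EvenPart ℂ g) ∈ k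
  rw [← hk.self_normalizing, LieSubalgebra.mem_normalizer_iff']
  intro y hy
  have h1 : ⁅y, (⟨x, hx0⟩ : EvenPart ℂ g)⁆ = 0 := Subtype.ext (hx y ⟨y, hy, rfl⟩)
  rw [h1]
  exact k.zero_mem

end SimpleSystem

end

theorem mainTheorem2 {ι : Type*} [Fintype ι] [DecidableEq ι] (D : SuperDynkin ι)
    (hD : D.IsBasic) (A : AbstractVogan D) :
    ∃ (V : Type) (_ : AddCommGroup V) (_ : Module ℝ V) (_ : LieSuperalgebra ℝ V)
      (θ : LieSuperalgebra.EvenPart ℝ V ≃ₗ⁅ℝ⁆ LieSuperalgebra.EvenPart ℝ V)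
      (h : LieSubalgebra ℝ (LieSuperalgebra.EvenPart ℝ V))
      (S : SimpleSystem D (LieSuperalgebra.complexify h)),
      FiniteDimensional ℝ V ∧
      LieSuperalgebra.IsBasic (TensorProduct ℝ ℂ V) ∧
      IsCartanInvolution θ ∧
      IsMaximallyCompact θ h ∧
      TakesItBeforeA θ h S.evenPositive ∧
      A.IsVoganDiagramOf θ h S := by
  obtain ⟨g, _, _, _, k, hg, hk, ⟨S⟩⟩ := hD
  have := hg.finite
  have : FiniteDimensional ℝ g := FiniteDimensional.complexToReal g
  have hcart := SimpleSystem.selfCentralizing_evenSubspace k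
  obtain ⟨ψ, hψ, hψe, hψf⟩ := S.exists_isChevalleyFlip hg.simple hcart
  obtain ⟨σ, hσ, hpt, hnp⟩ := S.exists_isRealStructure hg.simple hcart A hψ hψe hψf
  have := hσ.isConjugation
  exact ⟨realForm σ, inferInstance, inferInstance, inferInstance,
    SimpleSystem.cartanInvolution hσ hψ hg hcart, S.realCartan σ, SimpleSystem.realSystem hσ,
    inferInstance, (isIso_realFormEquiv σ).isBasic hg,
    SimpleSystem.isCartanInvolution hσ hψ hg hcart,
    SimpleSystem.isMaximallyCompact_realCartan hσ hψ hg hcart,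
    SimpleSystem.takesItBeforeA_realSystem hσ hψ hg hcart,
    SimpleSystem.isVoganDiagramOf_realSystem hψ hg hcart A hσ hψe hpt hnp⟩
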